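/- Let $\mathcal I$ be the class of twice continuously differentiable functions $\phi:[0,\infty)\to[0,\infty)$, extended to $\mathbb C$ by $\phi(z)=\phi(|z|)$, such that $\Delta\phi>0$ on $\mathbb C\setminus\{0\}$ and for which there is a positive, differentiable, decreasing function $\tau$ on $[0,\infty)$ with $\tau(r)\to0$ and $\tau'(r)\to0$ as $r\to\infty$ such that: (i) $\tau(|z|)\asymp 1$ for $|z|<1$ and $\tau(|z|)\asymp(\Delta\phi(z))^{-1/2}$ for $|z|\ge1$, that is, each side is at most a constant multiple of the other, with a constant independent of $z$; (ii) either $\tau(r)r^C$ is increasing for large $r$ for some constant $C>0$, or $\lim_{r\to\infty}\tau'(r)\log\frac1{\tau(r)}=0$. ("Increasing" and "decreasing" are meant in the non-strict sense.) For $p>0$ let $\mathcal F^\phi_p$ be the space of entire functions $f$ with $$\|f\|_{\mathcal F^\phi_p}^p=\int_{\mathbb C}|f(z)|^pe^{-p\phi(z)}\,dm(z)<\infty ,$$ where $m$ is Lebesgue measure, with the topology of this norm (a quasi-norm if $p<1$). Let $Vf(z)=\int_0^zf(\zeta)\,d\zeta$ be the Volterra operator. **Theorem.** Let $p>0$ and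 $\phi\in\mathcal I$, and suppose that the sequence $$\omega_n=\frac{\|z^{n+1}\|_{\mathcal F^\phi_2}}{(n+1)\,\|z^n\|_{\mathcal F^\phi_2}}$$ is eventually decreasing and tends to $0$. Then a linear subspace $\mathcal M\subseteq\mathcal F^\phi_p$ is closed, different from $\{0\}$ and from $\mathcal F^\phi_p$, and satisfies $V\mathcal M\subseteq\mathcal M$, if and only if there is an integer $N\ge1$ such that $$\mathcal M=\{f\in\mathcal F^\phi_p: f^{(k)}(0)=0\text{ for }0\le k\le N-1\}.$$ Moreover, for every $N\ge1$, $$\{f\in\mathcal F^\phi_p: f^{(k)}(0)=0\text{ for }0\le k\le N-1\}=\overline{\operatorname{Span}\{z^k:k\ge N\}}^{\mathcal F^\phi_p}.$$ -/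

import Mathlib

open MeasureTheory Filter Topology InnerProductSpace

noncomputable section

/-- The Laplacian at `z` of the radial function `z ↦ φ |z|` on the complex plane. -/
def radialLaplacian (φ : ℝ → ℝ) (z : ℂ) : ℝ :=
  Laplacian.laplacian (fun w : ℂ => φ ‖w‖) z

/-- The class of rapidly increasing weights. A weight is a function on `[0, ∞)`, extended to the
plane as `z ↦ φ |z|`; only the values of `φ` and of `τ` on `[0, ∞)` matter. The Laplacian is
considered off the origin, where the radial extension of a `C²` function is twice differentiable
(it need not be so at the origin, and it may have a vanishing Laplacian there, as for `r ^ 4`). -/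
structure IsRapidlyIncreasing (φ : ℝ → ℝ) : Prop where
  contDiffOn : ContDiffOn ℝ 2 φ (Set.Ici 0)
  nonneg : ∀ r : ℝ, 0 ≤ r → 0 ≤ φ r
  laplacian_pos : ∀ z : ℂ, z ≠ 0 → 0 < radialLaplacian φ z
  exists_tau : ∃ τ : ℝ → ℝ,
    (∀ r : ℝ, 0 ≤ r → 0 < τ r) ∧
    DifferentiableOn ℝ τ (Set.Ici 0) ∧
    AntitoneOn τ (Set.Ici 0) ∧
    Tendsto τ atTop (𝓝 0) ∧
    Tendsto (deriv τ) atTop (𝓝 0) ∧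
    -- comparability of `τ` with `1` on the unit disc and with `(Δφ)^(-1/2)` outside of it
    (∃ k : ℝ, 0 < k ∧ ∀ z : ℂ,
      let E : ℝ := if ‖z‖ < 1 then 1 else radialLaplacian φ z ^ (-(1 / 2) : ℝ)
      τ ‖z‖ ≤ k * E ∧ E ≤ k * τ ‖z‖) ∧
    ((∃ C : ℝ, 0 < C ∧ ∃ R : ℝ, 0 < R ∧ MonotoneOn (fun r => τ r * r ^ C) (Set.Ici R)) ∨
      Tendsto (fun r => deriv τ r * Real.log (1 / τ r)) atTop (𝓝 0))

/-- The measure `e^{-p φ(|z|)} dm(z)` on the complex plane. -/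
def fockMeasure (φ : ℝ → ℝ) (p : ℝ) : Measure ℂ :=
  volume.withDensity fun z => ENNReal.ofReal (Real.exp (-(p * φ ‖z‖)))

/-- The weighted Fock space: entire functions `f` with `∫ |f|^p e^{-p φ} dm < ∞`. -/
def fockSpace (φ : ℝ → ℝ) (p : ℝ) : Submodule ℂ (ℂ → ℂ) where
  carrier := {f | Differentiable ℂ f ∧ MemLp f (ENNReal.ofReal p) (fockMeasure φ p)}
  add_mem' hf hg := ⟨hf.1.add hg.1, hf.2.add hg.2⟩
  zero_mem' := ⟨differentiable_const 0, MemLp.zero⟩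
  smul_mem' c _ hf := ⟨hf.1.const_smul c, hf.2.const_smul c⟩

/-- `‖f‖ = (∫ |f|^p e^{-p φ} dm)^{1/p}`, a norm for `1 ≤ p` and a quasi-norm for `0 < p < 1`. -/
def fockNorm (φ : ℝ → ℝ) (p : ℝ) (f : ℂ → ℂ) : ℝ :=
  (eLpNorm f (ENNReal.ofReal p) (fockMeasure φ p)).toReal

/-- The topology of the (quasi-)norm: a set is open when it contains a ball around each of its
points. -/
abbrev fockTopology (φ : ℝ → ℝ) (p : ℝ) : TopologicalSpace (fockSpace φ p) where
  IsOpen U := ∀ f ∈ U, ∃ ε : ℝ, 0 < ε ∧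
    ∀ g : fockSpace φ p, fockNorm φ p (g - f : ℂ → ℂ) < ε → g ∈ U
  isOpen_univ := fun _ _ => ⟨1, one_pos, fun _ _ => trivial⟩
  isOpen_inter := fun _ _ hs ht f hf => by
    obtain ⟨ε, hε, h⟩ := hs f hf.1
    obtain ⟨δ, hδ, h'⟩ := ht f hf.2
    exact ⟨min ε δ, lt_min hε hδ, fun g hg =>
      ⟨h g (hg.trans_le (min_le_left _ _)), h' g (hg.trans_le (min_le_right _ _))⟩⟩
  isOpen_sUnion := fun _ hS f hf => by
    obtain ⟨U, hU, hfU⟩ := hf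
    obtain ⟨ε, hε, h⟩ := hS U hU f hfU
    exact ⟨ε, hε, fun g hg => ⟨U, hU, h g hg⟩⟩

/-- The Volterra operator `V f (z) = ∫_0^z f(ζ) dζ`, integrated along the segment from `0`
to `z`. -/
def volterra (f : ℂ → ℂ) (z : ℂ) : ℂ :=
  ∫ t in (0 : ℝ)..1, f (t * z) * z

/-- The weights `ω_n = ‖z^{n+1}‖ / ((n+1) ‖z^n‖)` of `V`, with norms taken in the space for
`p = 2`. -/
def volterraWeight (φ : ℝ → ℝ) (n : ℕ) : ℝ :=
  fockNorm φ 2 (fun z => z ^ (n + 1)) / ((n + 1) * fockNorm φ 2 (fun z => z ^ n))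

/-- `V M ⊆ M`. -/
def IsVolterraInvariant {φ : ℝ → ℝ} {p : ℝ} (M : Submodule ℂ (fockSpace φ p)) : Prop :=
  ∀ f ∈ M, ∃ g ∈ M, (g : ℂ → ℂ) = volterra f

/-- The functions of the space with `f^{(k)}(0) = 0` for `k < N`. -/
def fockVanishing (φ : ℝ → ℝ) (p : ℝ) (N : ℕ) : Set (fockSpace φ p) :=
  {f | ∀ k < N, iteratedDeriv k (f : ℂ → ℂ) 0 = 0}

/-- The linear span of the monomials `z^k`, `k ≥ N`, inside the space. -/
def monomialSpan (φ : ℝ → ℝ) (p : ℝ) (N : ℕ) : Submodule ℂ (fockSpace φ p) :=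
  Submodule.span ℂ {f | ∃ k : ℕ, N ≤ k ∧ (f : ℂ → ℂ) = fun z => z ^ k}

end

/-!
Only two features of the weight matter: `φ` is nonnegative and nondecreasing on `[0, ∞)`, and it
grows at least quadratically, `φ s - φ r ≥ c (s² - r²)` for large `r ≤ s` (`HasQuadraticGrowth`).
The second holds since `(r φ')' = r Δφ` and `Δφ` is comparable to `τ⁻²`, which tends to infinity.

Write `D n = f^{(n)}(0)` for an entire function `f = ∑ D n • z ^ n / n!`. The Volterra operator `V`
shifts the sequence `D` to the right by one place. Hence for `p = 2`, where the monomials are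
orthogonal, `V` is a weighted shift on `ℓ²` with weights `ω n`, and the claim is that a weighted
shift with weights that decrease to zero is unicellular.

* *The weighted shift.* Let `x` be in `ℓ²` with `x 0 ≠ 0`, and let `y` be orthogonal to all shifts
  of `x`. If infinitely many `y n` are nonzero, choose `k` such that `|y k|` is the maximum of the
  tail from `k` on. Orthogonality to the `k`-th shift bounds `|x 0|` by a sum that tends to zero as
  `k → ∞`, by the monotonicity of the weights. So `y` has finite support, and then it vanishes.
  This is `eq_zero_of_orthogonal_shifts`; `exists_shift_combination` is the dual form: shifts of
  `x` span a dense subspace.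

* *From `p = 2` to all `p`.* Let `K n` be the maximum of `r ^ n * exp (-φ r)`. For every exponent
  the norm of `z ^ n` agrees with `K n` up to powers of `n` (`fockNorm_pow_bounds`), and a coefficient
  of a function is controlled by its norm, again up to a power of `n`
  (`norm_coeff_mul_fockNorm_le`). The maximum is attained at a radius `O(√n)`, so `V ^ k` gains the
  factor `n ^ (k / 2)` (`exists_monomialNorm_add_le`). Consequently, for large `k`, `V ^ k` maps the
  space for `p` into the one for `2`, and is continuous from a weak norm on coefficients back to the
  space for `p`. If an invariant subspace `M` contains a nonzero `f`, then the cyclicity of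
  `V ^ k f` in `ℓ²`, followed by a further power of `V`, shows that `M` contains all monomials of
  high degree (`exists_forall_unitMonomial_mem`).

* *Density.* A function of the space is approximated by its dilates, and these by their Taylor
  sums; this rests on the monotonicity of `r ↦ ∫ |f (r e^{iθ})|^p dθ`, valid for all `p > 0` since
  `|f|^p` is subharmonic (by Jensen's formula). So `M` contains all functions vanishing to high
  order, and a downward induction on the order, subtracting multiples of `V ^ k f`, gives all
  functions whose order is at least the minimal order in `M`.

* *`V` maps the space to itself.* On the circle of radius `r`, a primitive of `f` is compared with
  its values on the circle of radius `r - 1` through a chain of points that approach `r`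
  geometrically; subharmonicity bounds the increments by means of `f`
  (`exists_powMean_primitive_le`). As the weight decays fast, the first contribution is absorbed
  (`fockIntegral_primitive_ne_top`).
-/

/-! ### Subharmonicity of `|f| ^ p` -/

theorem exp_one_mul_mul_log_le_rpow {p : ℝ} (hp : 0 < p) {x : ℝ} (hx : 0 ≤ x) :
    Real.exp 1 * (p * Real.log x) ≤ x ^ p := by
  rcases hx.eq_or_lt with rfl | hx
  · simp [Real.zero_rpow hp.ne']
  · have h := Real.add_one_le_exp (p * Real.log x - 1)
    rw [Real.rpow_def_of_pos hx, mul_comm (Real.log x) p,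
      show p * Real.log x = 1 + (p * Real.log x - 1) by ring, Real.exp_add]
    have := Real.exp_pos 1
    nlinarith

theorem continuous_norm_rpow {f : ℂ → ℂ} (hf : Differentiable ℂ f) {p : ℝ} (hp : 0 < p) :
    Continuous fun z => ‖f z‖ ^ p :=
  hf.continuous.norm.rpow_const fun _ => Or.inr hp.le

theorem log_norm_le_circleAverage {f : ℂ → ℂ} (hf : Differentiable ℂ f) {c : ℂ} (hc : f c ≠ 0)
    {R : ℝ} (hR : 0 < R) :
    Real.log ‖f c‖ ≤ Real.circleAverage (fun z => Real.log ‖f z‖) c R := by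
  have han : AnalyticOnNhd ℂ f (Metric.closedBall c |R|) := fun z _ => hf.analyticAt z
  rw [han.circleAverage_log_norm hR.ne' hc]
  refine le_add_of_nonneg_left (finsum_nonneg fun u => ?_)
  by_cases hu : u ∈ Metric.closedBall c |R|
  · refine mul_nonneg (mod_cast MeromorphicOn.AnalyticOnNhd.divisor_nonneg han u) ?_
    rcases eq_or_ne u c with rfl | huc
    · simp
    · refine Real.log_nonneg ?_
      have h1 : 0 < ‖c - u‖ := norm_pos_iff.2 (sub_ne_zero.2 huc.symm)
      rw [Metric.mem_closedBall, dist_eq_norm', abs_of_pos hR] at hu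
      rw [← div_eq_mul_inv, one_le_div h1]
      exact hu
  · simp [hu]

/-- `|f| ^ p` is subharmonic for every `p > 0`. After scaling `f` so that `|f c| ^ p = e`, this is
Jensen's formula combined with `e * log (x ^ p) ≤ x ^ p`; with that scaling the inequality also
holds at `x = 0`, where `Real.log 0 = 0`. -/
theorem norm_rpow_le_circleAverage {f : ℂ → ℂ} (hf : Differentiable ℂ f) {p : ℝ} (hp : 0 < p)
    (c : ℂ) {R : ℝ} (hR : 0 < R) :
    ‖f c‖ ^ p ≤ Real.circleAverage (fun z => ‖f z‖ ^ p) c R := by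
  rcases eq_or_ne (f c) 0 with h0 | h0
  · rw [h0, norm_zero, Real.zero_rpow hp.ne']
    exact Real.circleAverage_nonneg_of_nonneg fun z _ => by positivity
  set l : ℝ := Real.exp (1 / p) / ‖f c‖ with hl
  have hlpos : 0 < l := by positivity
  set g : ℂ → ℂ := fun z => (l : ℂ) * f z with hg
  have hgd : Differentiable ℂ g := hf.const_mul _
  have hgn : ∀ z, ‖g z‖ = l * ‖f z‖ := fun z => by simp [hg, abs_of_pos hlpos]
  have hgc : ‖g c‖ = Real.exp (1 / p) := by rw [hgn, hl]; field_simp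
  have hgc0 : g c ≠ 0 := by
    rw [← norm_ne_zero_iff, hgc]; positivity
  have h1 := log_norm_le_circleAverage hgd hgc0 hR
  have hci : CircleIntegrable (fun z => Real.log ‖g z‖) c R :=
    MeromorphicOn.circleIntegrable_log_norm fun z _ => (hgd.analyticAt z).meromorphicAt
  have h2 : Real.circleAverage (fun z => (Real.exp 1 * p) • Real.log ‖g z‖) c R ≤
      Real.circleAverage (fun z => ‖g z‖ ^ p) c R := by
    refine Real.circleAverage_mono ?_ ?_ ?_
    · exact hci.const_smul
    · exact (continuous_norm_rpow hgd hp).continuousOn.circleIntegrable'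
    · intro z _
      simpa [mul_assoc] using exp_one_mul_mul_log_le_rpow hp (norm_nonneg (g z))
  rw [Real.circleAverage_fun_smul, smul_eq_mul] at h2
  have h3 : Real.circleAverage (fun z => ‖g z‖ ^ p) c R =
      l ^ p * Real.circleAverage (fun z => ‖f z‖ ^ p) c R := by
    rw [← smul_eq_mul, ← Real.circleAverage_fun_smul]
    congr 1
    ext z
    rw [hgn, Real.mul_rpow hlpos.le (norm_nonneg _), smul_eq_mul]
  have h4 : l ^ p * ‖f c‖ ^ p = Real.exp 1 := by
    rw [← Real.mul_rpow hlpos.le (norm_nonneg _), ← hgn, hgc, ← Real.exp_mul]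
    field_simp
  have h5 : Real.exp 1 ≤ Real.exp 1 * p * Real.circleAverage (fun z => Real.log ‖g z‖) c R := by
    rw [hgc, Real.log_exp] at h1
    calc Real.exp 1 = Real.exp 1 * p * (1 / p) := by field_simp
      _ ≤ _ := by gcongr
  have h6 : l ^ p * ‖f c‖ ^ p ≤ l ^ p * Real.circleAverage (fun z => ‖f z‖ ^ p) c R := by
    rw [h4, ← h3]; exact h5.trans h2
  exact le_of_mul_le_mul_left h6 (by positivity)

theorem circleAverage_eq_integral_rotate {u : ℂ → ℝ} (w : ℂ) :
    Real.circleAverage u 0 ‖w‖ =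
      (2 * Real.pi)⁻¹ * ∫ θ in (0 : ℝ)..2 * Real.pi, u (w * Complex.exp (θ * Complex.I)) := by
  rw [Real.circleAverage_eq_integral_add w.arg, smul_eq_mul]
  congr 2
  ext θ
  congr 1
  conv_rhs => rw [← Complex.norm_mul_exp_arg_mul_I w]
  simp only [circleMap, zero_add, Complex.ofReal_add]
  rw [mul_assoc, ← Complex.exp_add]
  congr 2
  ring

/-- The circle means of `|f| ^ p` around the origin increase with the radius: the function
`U w = mean over the circle of radius |w|` is subharmonic and radial, so that a maximum over a disc
which is not attained on the boundary circle contradicts the sub-mean value inequality at the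
maximum point of largest modulus. -/
theorem monotoneOn_circleAverage_norm_rpow {f : ℂ → ℂ} (hf : Differentiable ℂ f) {p : ℝ}
    (hp : 0 < p) :
    MonotoneOn (Real.circleAverage (fun z => ‖f z‖ ^ p) 0) (Set.Ici 0) := by
  set u : ℂ → ℝ := fun z => ‖f z‖ ^ p
  have huc : Continuous u := continuous_norm_rpow hf hp
  set m : ℝ → ℝ := Real.circleAverage u 0
  have hmc : Continuous m := Real.Continuous.circleAverage huc
  intro s hs r hr hsr
  by_contra! hlt
  simp only [Set.mem_Ici] at hs hr
  -- `t` is the largest point at which `m` attains its maximum over `[0, r]`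
  obtain ⟨x, hx, hxmax⟩ := isCompact_Icc.exists_isMaxOn (Set.nonempty_Icc.2 hr) hmc.continuousOn
  have hKc : IsCompact (Set.Icc 0 r ∩ m ⁻¹' {m x}) :=
    isCompact_Icc.inter_right (isClosed_singleton.preimage hmc)
  obtain ⟨t, ⟨ht, htx⟩, htmax⟩ := hKc.exists_isGreatest ⟨x, hx, rfl⟩
  have htx' : m t = m x := htx
  have hle : ∀ y ∈ Set.Icc 0 r, m y ≤ m t := fun y hy => htx' ▸ hxmax hy
  have htr : t < r := by
    refine lt_of_le_of_ne ht.2 fun h => ?_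
    have := hle s ⟨hs, hsr⟩
    rw [h] at this
    exact absurd hlt (not_lt.2 this)
  have hmr : m r < m t := by
    refine lt_of_le_of_ne (hle r ⟨hr, le_rfl⟩) fun h => ?_
    exact absurd (htmax ⟨⟨hr, le_rfl⟩, h.trans htx'⟩) (not_le.2 htr)
  set δ := r - t with hδ
  have hδ0 : 0 < δ := sub_pos.2 htr
  have hpi : (0 : ℝ) < 2 * Real.pi := by positivity
  -- the sub-mean value inequality for `w ↦ m |w|` at `t`
  have key : m t ≤ (2 * Real.pi)⁻¹ * ∫ η in (0 : ℝ)..2 * Real.pi, m ‖circleMap (t : ℂ) δ η‖ := by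
    have e1 : m t = (2 * Real.pi)⁻¹ *
        ∫ θ in (0 : ℝ)..2 * Real.pi, u (t * Complex.exp (θ * Complex.I)) := by
      rw [← circleAverage_eq_integral_rotate, Complex.norm_real, Real.norm_of_nonneg ht.1]
    have e2 : ∀ θ : ℝ, u (t * Complex.exp (θ * Complex.I)) ≤ (2 * Real.pi)⁻¹ *
        ∫ η in (0 : ℝ)..2 * Real.pi, u (circleMap (t : ℂ) δ η * Complex.exp (θ * Complex.I)) := by
      intro θ
      have := norm_rpow_le_circleAverage (f := fun z => f (z * Complex.exp (θ * Complex.I)))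
        (hf.comp (differentiable_id.mul_const _)) hp t hδ0
      simpa [Real.circleAverage_def] using this
    have hcont : Continuous fun q : ℝ × ℝ =>
        u (circleMap (t : ℂ) δ q.2 * Complex.exp (q.1 * Complex.I)) := by
      refine huc.comp ?_
      fun_prop [circleMap]
    rw [e1]
    refine mul_le_mul_of_nonneg_left ?_ (by positivity)
    calc ∫ θ in (0 : ℝ)..2 * Real.pi, u (t * Complex.exp (θ * Complex.I))
        ≤ ∫ θ in (0 : ℝ)..2 * Real.pi, (2 * Real.pi)⁻¹ * ∫ η in (0 : ℝ)..2 * Real.pi,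
            u (circleMap (t : ℂ) δ η * Complex.exp (θ * Complex.I)) := by
          refine intervalIntegral.integral_mono_on hpi.le ?_ ?_ fun θ _ => e2 θ
          · refine (huc.comp ?_).intervalIntegrable _ _
            fun_prop
          · refine Continuous.intervalIntegrable ?_ _ _
            refine continuous_const.mul ?_
            exact intervalIntegral.continuous_parametric_intervalIntegral_of_continuous' hcont _ _
      _ = ∫ η in (0 : ℝ)..2 * Real.pi, (2 * Real.pi)⁻¹ * ∫ θ in (0 : ℝ)..2 * Real.pi,
            u (circleMap (t : ℂ) δ η * Complex.exp (θ * Complex.I)) := by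
          rw [intervalIntegral.integral_const_mul, intervalIntegral.integral_const_mul]
          congr 1
          simp only [intervalIntegral.integral_of_le hpi.le]
          refine integral_integral_swap ?_
          have h := (hcont.integrableOn_Icc (μ := volume)
            (a := ((0 : ℝ), (0 : ℝ))) (b := (2 * Real.pi, 2 * Real.pi)))
          rw [← Set.Icc_prod_Icc] at h
          have h' := h.mono_set (Set.prod_mono (Set.Ioc_subset_Icc_self (a := (0 : ℝ)))
            (Set.Ioc_subset_Icc_self (a := (0 : ℝ))))
          rwa [IntegrableOn, Measure.volume_eq_prod, ← Measure.prod_restrict] at h'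
      _ = _ := by
          congr 1
          ext η
          rw [← circleAverage_eq_integral_rotate]
  -- the circle around `t` stays in the disc of radius `r` and touches its boundary, where `m` is
  -- smaller
  have hnorm : ∀ η : ℝ, ‖circleMap (t : ℂ) δ η‖ ∈ Set.Icc 0 r := by
    intro η
    refine ⟨norm_nonneg _, ?_⟩
    calc ‖circleMap (t : ℂ) δ η‖ ≤ ‖(t : ℂ)‖ + ‖(δ : ℂ) * Complex.exp (η * Complex.I)‖ :=
          norm_add_le _ _
      _ = r := by
        rw [norm_mul, Complex.norm_exp_ofReal_mul_I, Complex.norm_real, Complex.norm_real,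
          Real.norm_of_nonneg ht.1, Real.norm_of_nonneg hδ0.le]
        ring
  have hlt2 : ∫ η in (0 : ℝ)..2 * Real.pi, m ‖circleMap (t : ℂ) δ η‖ <
      ∫ η in (0 : ℝ)..2 * Real.pi, m t := by
    refine intervalIntegral.integral_lt_integral_of_continuousOn_of_le_of_exists_lt hpi ?_
      continuousOn_const (fun η _ => hle _ (hnorm η)) ⟨0, ⟨le_rfl, hpi.le⟩, ?_⟩
    · exact (hmc.comp (continuous_circleMap _ _).norm).continuousOn
    · have : circleMap (t : ℂ) δ 0 = (r : ℂ) := by simp [circleMap, hδ]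
      rw [this, Complex.norm_real, Real.norm_of_nonneg hr]
      exact hmr
  rw [intervalIntegral.integral_const, sub_zero, smul_eq_mul] at hlt2
  have := mul_lt_mul_of_pos_left hlt2 (inv_pos.2 hpi)
  rw [inv_mul_cancel_left₀ hpi.ne'] at this
  exact absurd key (not_le.2 this)

/-! ### Integral means over circles -/

/-- The integral `∫ |f (r e^{iθ})| ^ p dθ` over a full period, as an extended nonnegative real. -/
noncomputable def powMean (f : ℂ → ℂ) (p r : ℝ) : ENNReal :=
  ∫⁻ θ in Set.Ioc (-Real.pi) Real.pi, ‖f (circleMap 0 r θ)‖ₑ ^ p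

theorem enorm_rpow_eq_ofReal {p : ℝ} (hp : 0 < p) (x : ℂ) :
    ‖x‖ₑ ^ p = ENNReal.ofReal (‖x‖ ^ p) := by
  rw [← ofReal_norm, ENNReal.ofReal_rpow_of_nonneg (norm_nonneg _) hp.le]

theorem measurable_enorm_rpow {f : ℂ → ℂ} (hf : Differentiable ℂ f) (p : ℝ) :
    Measurable fun z => ‖f z‖ₑ ^ p :=
  hf.continuous.measurable.enorm.pow_const p

theorem measurable_powMean {f : ℂ → ℂ} (hf : Differentiable ℂ f) (p : ℝ) :
    Measurable (powMean f p) := by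
  have : Measurable fun q : ℝ × ℝ => ‖f (circleMap 0 q.1 q.2)‖ₑ ^ p :=
    (measurable_enorm_rpow hf p).comp (Real.circleMap.continuous (c := 0)).measurable
  exact this.lintegral_prod_right'

theorem lintegral_rotate_enorm_rpow {f : ℂ → ℂ} (hf : Differentiable ℂ f) {p : ℝ} (hp : 0 < p)
    (w : ℂ) :
    ∫⁻ θ in Set.Ioc (-Real.pi) Real.pi, ‖f (w * Complex.exp (θ * Complex.I))‖ₑ ^ p =
      ENNReal.ofReal (2 * Real.pi * Real.circleAverage (fun z => ‖f z‖ ^ p) 0 ‖w‖) := by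
  have hpi := Real.pi_pos
  have h1 : Real.circleAverage (fun z => ‖f z‖ ^ p) 0 ‖w‖ = (2 * Real.pi)⁻¹ *
      ∫ θ in (-Real.pi)..Real.pi, ‖f (w * Complex.exp (θ * Complex.I))‖ ^ p := by
    rw [Real.circleAverage_eq_integral_add (w.arg - Real.pi), smul_eq_mul]
    congr 1
    have : ∀ θ : ℝ, circleMap 0 ‖w‖ (θ + (w.arg - Real.pi)) =
        w * Complex.exp ((θ + -Real.pi : ℝ) * Complex.I) := by
      intro θ
      conv_rhs => rw [← Complex.norm_mul_exp_arg_mul_I w]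
      simp only [circleMap, zero_add]
      rw [mul_assoc, ← Complex.exp_add]
      congr 2
      push_cast
      ring
    simp only [this]
    rw [intervalIntegral.integral_comp_add_right
      (fun θ : ℝ => ‖f (w * Complex.exp (θ * Complex.I))‖ ^ p)]
    congr 1 <;> ring
  have hc : Continuous fun θ : ℝ => ‖f (w * Complex.exp (θ * Complex.I))‖ ^ p :=
    (continuous_norm_rpow hf hp).comp (by fun_prop)
  rw [h1, mul_inv_cancel_left₀ (by positivity), intervalIntegral.integral_of_le (by linarith),
    ofReal_integral_eq_lintegral_ofReal]
  · simp only [enorm_rpow_eq_ofReal hp]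
  · exact (hc.integrableOn_Icc).mono_set Set.Ioc_subset_Icc_self
  · exact Eventually.of_forall fun θ => by positivity

theorem powMean_eq_ofReal {f : ℂ → ℂ} (hf : Differentiable ℂ f) {p : ℝ} (hp : 0 < p) {r : ℝ}
    (hr : 0 ≤ r) :
    powMean f p r =
      ENNReal.ofReal (2 * Real.pi * Real.circleAverage (fun z => ‖f z‖ ^ p) 0 r) := by
  have := lintegral_rotate_enorm_rpow hf hp (r : ℂ)
  rw [Complex.norm_real, Real.norm_of_nonneg hr] at this
  rw [← this, powMean]
  simp [circleMap]

theorem lintegral_rotate_eq_powMean {f : ℂ → ℂ} (hf : Differentiable ℂ f) {p : ℝ} (hp : 0 < p)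
    (w : ℂ) :
    ∫⁻ θ in Set.Ioc (-Real.pi) Real.pi, ‖f (w * Complex.exp (θ * Complex.I))‖ₑ ^ p =
      powMean f p ‖w‖ := by
  rw [lintegral_rotate_enorm_rpow hf hp, powMean_eq_ofReal hf hp (norm_nonneg _)]

theorem powMean_mono {f : ℂ → ℂ} (hf : Differentiable ℂ f) {p : ℝ} (hp : 0 < p) {s r : ℝ}
    (hs : 0 ≤ s) (hsr : s ≤ r) : powMean f p s ≤ powMean f p r := by
  rw [powMean_eq_ofReal hf hp hs, powMean_eq_ofReal hf hp (hs.trans hsr)]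
  have := monotoneOn_circleAverage_norm_rpow hf hp hs (hs.trans hsr) hsr
  gcongr

theorem powMean_ne_top {f : ℂ → ℂ} (hf : Differentiable ℂ f) {p : ℝ} (hp : 0 < p) {r : ℝ}
    (hr : 0 ≤ r) : powMean f p r ≠ ⊤ := by
  rw [powMean_eq_ofReal hf hp hr]
  exact ENNReal.ofReal_ne_top

/-- Integration of `|f| ^ p` against a radial weight, in polar coordinates. -/
theorem lintegral_mul_radial {f : ℂ → ℂ} (hf : Differentiable ℂ f) (p : ℝ) {v : ℝ → ENNReal}
    (hv : Measurable v) :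
    ∫⁻ z, ‖f z‖ₑ ^ p * v ‖z‖ =
      ∫⁻ r in Set.Ioi 0, ENNReal.ofReal r * v r * powMean f p r := by
  rw [← Complex.lintegral_comp_polarCoord_symm]
  have htar : polarCoord.target = Set.Ioi (0 : ℝ) ×ˢ Set.Ioo (-Real.pi) Real.pi := rfl
  have hcm : ∀ q : ℝ × ℝ, Complex.polarCoord.symm q = circleMap 0 q.1 q.2 := by
    intro q
    rw [Complex.polarCoord_symm_apply, circleMap, zero_add, Complex.exp_mul_I]
    push_cast
    rfl
  have hmeas : Measurable fun q : ℝ × ℝ =>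
      ENNReal.ofReal q.1 * (‖f (circleMap 0 q.1 q.2)‖ₑ ^ p * v |q.1|) := by
    refine measurable_fst.ennreal_ofReal.mul (Measurable.mul ?_ ?_)
    · exact (measurable_enorm_rpow hf p).comp (Real.circleMap.continuous (c := 0)).measurable
    · exact hv.comp measurable_fst.abs
  simp only [hcm, norm_circleMap_zero, smul_eq_mul]
  rw [htar, Measure.volume_eq_prod, ← Measure.prod_restrict,
    lintegral_prod _ hmeas.aemeasurable]
  refine setLIntegral_congr_fun measurableSet_Ioi fun r hr => ?_
  simp only
  rw [abs_of_pos hr, powMean, Measure.restrict_congr_set Ioo_ae_eq_Ioc,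
    ← lintegral_const_mul]
  · refine lintegral_congr fun θ => ?_
    ring
  · exact (measurable_enorm_rpow hf p).comp (continuous_circleMap 0 r).measurable

theorem lintegral_ball_zero {f : ℂ → ℂ} (hf : Differentiable ℂ f) (p ρ : ℝ) :
    ∫⁻ z in Metric.ball 0 ρ, ‖f z‖ₑ ^ p =
      ∫⁻ r in Set.Ioo 0 ρ, ENNReal.ofReal r * powMean f p r := by
  have h := lintegral_mul_radial hf p (v := (Set.Iio ρ).indicator 1)
    (measurable_one.indicator measurableSet_Iio)
  have h1 : ∀ z : ℂ, ‖f z‖ₑ ^ p * (Set.Iio ρ).indicator 1 ‖z‖ =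
      (Metric.ball 0 ρ).indicator (fun z => ‖f z‖ₑ ^ p) z := by
    intro z
    by_cases hz : ‖z‖ < ρ <;> simp [Set.indicator, hz]
  have h2 : ∀ r : ℝ, ENNReal.ofReal r * (Set.Iio ρ).indicator 1 r * powMean f p r =
      (Set.Iio ρ).indicator (fun r => ENNReal.ofReal r * powMean f p r) r := by
    intro r
    by_cases hr : r < ρ <;> simp [Set.indicator, hr]
  simp only [h1, h2] at h
  rw [lintegral_indicator Metric.isOpen_ball.measurableSet, lintegral_indicator measurableSet_Iio,
    Measure.restrict_restrict measurableSet_Iio, Set.Iio_inter_Ioi] at h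
  exact h

theorem lintegral_Ioo_ofReal {ρ : ℝ} (hρ : 0 ≤ ρ) :
    ∫⁻ r in Set.Ioo 0 ρ, ENNReal.ofReal r = ENNReal.ofReal (ρ ^ 2 / 2) := by
  rw [Measure.restrict_congr_set Ioo_ae_eq_Ioc, ← ofReal_integral_eq_lintegral_ofReal,
    ← intervalIntegral.integral_of_le hρ, integral_id]
  · simp
  · exact (continuous_id.integrableOn_Icc).mono_set Set.Ioc_subset_Icc_self
  · filter_upwards [ae_restrict_mem measurableSet_Ioc] with x hx using hx.1.le

theorem lintegral_ball_zero_le {f : ℂ → ℂ} (hf : Differentiable ℂ f) {p : ℝ} (hp : 0 < p) {ρ : ℝ}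
    (hρ : 0 ≤ ρ) :
    ∫⁻ z in Metric.ball 0 ρ, ‖f z‖ₑ ^ p ≤ ENNReal.ofReal (ρ ^ 2 / 2) * powMean f p ρ := by
  rw [lintegral_ball_zero hf, ← lintegral_Ioo_ofReal hρ, ← lintegral_mul_const _ (by fun_prop)]
  refine setLIntegral_mono' measurableSet_Ioo fun r hr => ?_
  gcongr
  exact powMean_mono hf hp hr.1.le hr.2.le

/-- The sub-mean value inequality of `|f| ^ p` over discs. -/
theorem mul_enorm_rpow_le_lintegral_ball {f : ℂ → ℂ} (hf : Differentiable ℂ f) {p : ℝ} (hp : 0 < p)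
    (c : ℂ) {δ : ℝ} (hδ : 0 < δ) :
    ENNReal.ofReal (Real.pi * δ ^ 2) * ‖f c‖ₑ ^ p ≤ ∫⁻ z in Metric.ball c δ, ‖f z‖ₑ ^ p := by
  set g : ℂ → ℂ := fun z => f (z + c) with hg
  have hgd : Differentiable ℂ g := hf.comp (differentiable_id.add_const c)
  have hpi := Real.pi_pos
  have h1 : ∫⁻ z in Metric.ball c δ, ‖f z‖ₑ ^ p = ∫⁻ z in Metric.ball 0 δ, ‖g z‖ₑ ^ p := by
    rw [← (measurePreserving_add_right volume c).setLIntegral_comp_preimage_emb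
      (measurableEmbedding_addRight c)]
    congr 2
    ext z
    simp
  have h2 : ∀ r, 0 < r → ENNReal.ofReal (2 * Real.pi) * ‖f c‖ₑ ^ p ≤ powMean g p r := by
    intro r hr
    rw [powMean_eq_ofReal hgd hp hr.le, enorm_rpow_eq_ofReal hp, ← ENNReal.ofReal_mul (by positivity)]
    have := norm_rpow_le_circleAverage hgd hp 0 hr
    simp only [hg, zero_add] at this ⊢
    gcongr
  rw [h1, lintegral_ball_zero hgd]
  calc ENNReal.ofReal (Real.pi * δ ^ 2) * ‖f c‖ₑ ^ p
      = ENNReal.ofReal (δ ^ 2 / 2) * (ENNReal.ofReal (2 * Real.pi) * ‖f c‖ₑ ^ p) := by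
        rw [← mul_assoc, ← ENNReal.ofReal_mul (by positivity)]
        congr 2
        ring
    _ = ∫⁻ r in Set.Ioo 0 δ, ENNReal.ofReal r * (ENNReal.ofReal (2 * Real.pi) * ‖f c‖ₑ ^ p) := by
        rw [lintegral_mul_const _ (by fun_prop), lintegral_Ioo_ofReal hδ.le]
    _ ≤ _ := by
        refine setLIntegral_mono' measurableSet_Ioo fun r hr => ?_
        gcongr
        exact h2 r hr.1

/-- Averaging over the rotations of a disc replaces the integral over it by circle means. -/
theorem lintegral_lintegral_ball_rotate_le {f : ℂ → ℂ} (hf : Differentiable ℂ f) {p : ℝ}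
    (hp : 0 < p) {a ρ : ℝ} (ha : 0 ≤ a) (hρ : 0 ≤ ρ) :
    ∫⁻ θ in Set.Ioc (-Real.pi) Real.pi, ∫⁻ w in Metric.ball (a : ℂ) ρ,
        ‖f (w * Complex.exp ((θ : ℝ) * Complex.I))‖ₑ ^ p ≤
      ENNReal.ofReal (Real.pi * ρ ^ 2) * powMean f p (a + ρ) := by
  rw [lintegral_lintegral_swap]
  · simp only [lintegral_rotate_eq_powMean hf hp]
    calc ∫⁻ w in Metric.ball (a : ℂ) ρ, powMean f p ‖w‖
        ≤ ∫⁻ w in Metric.ball (a : ℂ) ρ, powMean f p (a + ρ) := by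
          refine setLIntegral_mono' Metric.isOpen_ball.measurableSet fun w hw => ?_
          refine powMean_mono hf hp (norm_nonneg _) ?_
          rw [Metric.mem_ball, dist_eq_norm] at hw
          calc ‖w‖ = ‖(a : ℂ) + (w - a)‖ := by ring_nf
            _ ≤ ‖(a : ℂ)‖ + ‖w - a‖ := norm_add_le _ _
            _ ≤ a + ρ := by
              rw [Complex.norm_real, Real.norm_of_nonneg ha]
              gcongr
      _ = _ := by
          rw [setLIntegral_const, Complex.volume_ball, mul_comm]
          congr 1
          rw [ENNReal.ofReal_mul Real.pi_pos.le, ENNReal.ofReal_pow hρ, mul_comm]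
          congr 1
          rw [← NNReal.coe_real_pi, ENNReal.ofReal_coe_nnreal]
  · refine Measurable.aemeasurable ?_
    refine (measurable_enorm_rpow hf p).comp (f := fun q : ℝ × ℂ =>
      q.2 * Complex.exp ((q.1 : ℝ) * Complex.I)) ?_
    fun_prop

/-! ### Growth of the weight -/

/-- The growth of a radial weight on which the description of the invariant subspaces rests: it is
continuous, nonnegative and increasing, and it eventually grows at least as fast as a positive
multiple of `r ^ 2`. -/
structure HasQuadraticGrowth (φ : ℝ → ℝ) : Prop where
  continuousOn : ContinuousOn φ (Set.Ici 0)
  nonneg : ∀ r : ℝ, 0 ≤ r → 0 ≤ φ r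
  monotoneOn : MonotoneOn φ (Set.Ici 0)
  growth : ∃ c R : ℝ, 0 < c ∧ 0 < R ∧ ∀ r s : ℝ, R ≤ r → r ≤ s → c * (s ^ 2 - r ^ 2) ≤ φ s - φ r

theorem ContDiffAt.eventually_hasDerivAt_line {f : ℂ → ℝ} {z : ℂ} (hf : ContDiffAt ℝ 2 f z)
    (v : ℂ) :
    ∀ᶠ t : ℝ in 𝓝 0, HasDerivAt (fun s : ℝ => f (z + s * v)) (fderiv ℝ f (z + t * v) v) t := by
  have hev : ∀ᶠ w in 𝓝 z, ContDiffAt ℝ 2 f w := hf.eventually (by simp)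
  have ht : Tendsto (fun t : ℝ => z + t * v) (𝓝 0) (𝓝 z) := by
    have : Continuous fun t : ℝ => z + t * v := by fun_prop
    simpa using this.tendsto 0
  filter_upwards [ht.eventually hev] with t h
  have h1 : HasFDerivAt f (fderiv ℝ f (z + t * v)) (z + t * v) :=
    (h.differentiableAt (by norm_num)).hasFDerivAt
  have h2 : HasDerivAt (fun s : ℝ => z + s * v) v t := by
    simpa using ((Complex.ofRealCLM.hasDerivAt (x := t)).mul_const v).const_add z
  exact h1.comp_hasDerivAt t h2

theorem ContDiffAt.hasDerivAt_fderiv_line {f : ℂ → ℝ} {z : ℂ} (hf : ContDiffAt ℝ 2 f z) (v : ℂ) :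
    HasDerivAt (fun t : ℝ => fderiv ℝ f (z + t * v) v) (iteratedFDeriv ℝ 2 f z ![v, v]) 0 := by
  have h1 : DifferentiableAt ℝ (fderiv ℝ f) z :=
    (hf.fderiv_right (m := 1) (by norm_num)).differentiableAt (by norm_num)
  have h2 : HasDerivAt (fun s : ℝ => z + s * v) v 0 := by
    simpa using ((Complex.ofRealCLM.hasDerivAt (x := 0)).mul_const v).const_add z
  have h3 : HasDerivAt (fun t : ℝ => fderiv ℝ f (z + t * v)) (fderiv ℝ (fderiv ℝ f) z v) 0 := by
    refine HasFDerivAt.comp_hasDerivAt (0 : ℝ) ?_ h2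
    simpa using h1.hasFDerivAt
  rw [iteratedFDeriv_two_apply]
  simpa using h3.clm_apply (hasDerivAt_const (0 : ℝ) v)

/-- The Laplacian of a radial function in polar coordinates. -/
theorem radialLaplacian_ofReal {φ : ℝ → ℝ} {r : ℝ} (hr : 0 < r) (hφ : ContDiffAt ℝ 2 φ r) :
    radialLaplacian φ r = deriv (deriv φ) r + deriv φ r / r := by
  set f : ℂ → ℝ := fun w => φ ‖w‖ with hf
  have hr0 : (r : ℂ) ≠ 0 := by exact_mod_cast hr.ne'
  have hnr : ‖(r : ℂ)‖ = r := by rw [Complex.norm_real, Real.norm_of_nonneg hr.le]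
  have hfc : ContDiffAt ℝ 2 f r := by
    refine ContDiffAt.comp (r : ℂ) ?_ (contDiffAt_norm ℝ hr0)
    rwa [hnr]
  have hφd : ∀ᶠ s in 𝓝 r, HasDerivAt φ (deriv φ s) s := by
    filter_upwards [hφ.eventually (by simp)] with s hs
    exact (hs.differentiableAt (by norm_num)).hasDerivAt
  have hφ2 : HasDerivAt (deriv φ) (deriv (deriv φ) r) r := by
    have h := (hφ.fderiv_right (m := 1) (by norm_num)).differentiableAt (by norm_num)
    have h' : DifferentiableAt ℝ (deriv φ) r := by
      have := h.clm_apply (differentiableAt_const (1 : ℝ))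
      simpa using this
    exact h'.hasDerivAt
  -- in the radial direction the function is `φ` itself
  have e1 : iteratedFDeriv ℝ 2 f r ![1, 1] = deriv (deriv φ) r := by
    have h1 := hfc.hasDerivAt_fderiv_line 1
    have h2 : HasDerivAt (fun t : ℝ => deriv φ (r + t)) (deriv (deriv φ) r) 0 := by
      have : HasDerivAt (deriv φ) (deriv (deriv φ) r) (r + 0) := by simpa using hφ2
      simpa using this.comp_const_add r 0
    refine h1.unique (h2.congr_of_eventuallyEq ?_)
    have ht : Tendsto (fun t : ℝ => r + t) (𝓝 0) (𝓝 r) := by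
      have : Continuous fun t : ℝ => r + t := by fun_prop
      simpa using this.tendsto 0
    filter_upwards [hfc.eventually_hasDerivAt_line 1, ht.eventually hφd,
      ht.eventually (lt_mem_nhds hr)] with t h3 h4 h5
    refine h3.unique ?_
    have h6 : HasDerivAt (fun s : ℝ => φ (r + s)) (deriv φ (r + t)) t := h4.comp_const_add r t
    refine h6.congr_of_eventuallyEq ?_
    have : ∀ᶠ s in 𝓝 t, 0 < r + s :=
      (continuous_const.add continuous_id).continuousAt.eventually (lt_mem_nhds h5)
    filter_upwards [this] with s hs
    have : (r : ℂ) + s * 1 = ((r + s : ℝ) : ℂ) := by push_cast; ring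
    simp only [hf]
    rw [this, Complex.norm_real, Real.norm_of_nonneg hs.le]
  -- in the tangential direction it is `φ (ρ t)` with `ρ t = √(r² + t²)`, whose derivative is
  -- `t φ'(ρ t) / ρ t`; the derivative of this product at `0` needs the continuity of `φ'` only
  have e2 : iteratedFDeriv ℝ 2 f r ![Complex.I, Complex.I] = deriv φ r / r := by
    have h1 := hfc.hasDerivAt_fderiv_line Complex.I
    set ρ : ℝ → ℝ := fun t => Real.sqrt (r ^ 2 + t ^ 2) with hρ
    have hρ0 : ρ 0 = r := by simp [hρ, hr.le]
    have hρc : Continuous ρ := by fun_prop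
    have hpos : ∀ t, 0 < r ^ 2 + t ^ 2 := fun t => by positivity
    have hρd : ∀ t, HasDerivAt ρ (t / ρ t) t := by
      intro t
      have h : HasDerivAt ρ (((2 : ℕ) : ℝ) * t ^ (2 - 1) / (2 * Real.sqrt (r ^ 2 + t ^ 2))) t :=
        ((hasDerivAt_pow 2 t).const_add (r ^ 2)).sqrt (hpos t).ne'
      refine h.congr_deriv ?_
      simp only [hρ]
      push_cast
      field_simp
    have hk : ContinuousAt (fun t => deriv φ (ρ t) / ρ t) 0 := by
      refine ContinuousAt.div ?_ hρc.continuousAt (by rw [hρ0]; exact hr.ne')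
      refine ContinuousAt.comp (g := deriv φ) ?_ hρc.continuousAt
      rw [hρ0]
      exact hφ2.continuousAt
    have h2 : HasDerivAt (fun t => t * (deriv φ (ρ t) / ρ t)) (deriv φ r / r) 0 := by
      rw [hasDerivAt_iff_tendsto_slope]
      have h3 : Tendsto (fun t => deriv φ (ρ t) / ρ t) (𝓝[≠] 0) (𝓝 (deriv φ r / r)) := by
        have := hk.tendsto.mono_left (nhdsWithin_le_nhds (s := {(0 : ℝ)}ᶜ))
        rwa [hρ0] at this
      refine h3.congr' ?_
      filter_upwards [self_mem_nhdsWithin] with t ht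
      have ht0 : t ≠ 0 := ht
      simp only [slope_def_field]
      field_simp
      simp
    refine h1.unique (h2.congr_of_eventuallyEq ?_)
    have ht : Tendsto ρ (𝓝 0) (𝓝 r) := by
      simpa [hρ0] using hρc.tendsto 0
    filter_upwards [hfc.eventually_hasDerivAt_line Complex.I, ht.eventually hφd] with t h3 h4
    refine h3.unique ?_
    have h6 : HasDerivAt (fun s : ℝ => φ (ρ s)) (deriv φ (ρ t) * (t / ρ t)) t := h4.comp t (hρd t)
    have h7 : (fun s : ℝ => f (r + s * Complex.I)) = fun s => φ (ρ s) := by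
      ext s
      simp only [hf, hρ]
      rw [Complex.norm_add_mul_I]
    rw [h7]
    exact h6.congr_deriv (by ring)
  rw [radialLaplacian, laplacian_eq_iteratedFDeriv_complexPlane]
  simp only
  rw [e1, e2]

/-- With `Δφ = φ'' + φ' / r`, the function `r φ'(r)` has derivative `r Δφ(r)`. It vanishes at the
origin, so `Δφ > 0` makes `φ` increasing; and `Δφ ≍ τ ^ (-2) → ∞` makes `φ'` grow at least
linearly. -/
theorem IsRapidlyIncreasing.hasQuadraticGrowth {φ : ℝ → ℝ} (hφ : IsRapidlyIncreasing φ) :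
    HasQuadraticGrowth φ := by
  have hc2 : ∀ r : ℝ, 0 < r → ContDiffAt ℝ 2 φ r := fun r hr =>
    hφ.contDiffOn.contDiffAt (Ici_mem_nhds hr)
  have hd : ∀ r : ℝ, 0 < r → HasDerivAt φ (deriv φ r) r := fun r hr =>
    ((hc2 r hr).differentiableAt (by norm_num)).hasDerivAt
  have hd2 : ∀ r : ℝ, 0 < r → HasDerivAt (deriv φ) (deriv (deriv φ) r) r := by
    intro r hr
    have h := ((hc2 r hr).fderiv_right (m := 1) (by norm_num)).differentiableAt (by norm_num)
    have h' : DifferentiableAt ℝ (deriv φ) r := by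
      simpa using h.clm_apply (differentiableAt_const (1 : ℝ))
    exact h'.hasDerivAt
  set g : ℝ → ℝ := fun r => r * deriv φ r
  have hgd : ∀ r : ℝ, 0 < r → HasDerivAt g (r * radialLaplacian φ r) r := by
    intro r hr
    have h : HasDerivAt g (1 * deriv φ r + r * deriv (deriv φ) r) r :=
      (hasDerivAt_id r).mul (hd2 r hr)
    refine h.congr_deriv ?_
    rw [radialLaplacian_ofReal hr (hc2 r hr)]
    field_simp
    ring
  have hLpos : ∀ r : ℝ, 0 < r → 0 < radialLaplacian φ r := fun r hr =>
    hφ.laplacian_pos r (by exact_mod_cast hr.ne')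
  have hgmono : MonotoneOn g (Set.Ioi 0) := by
    refine monotoneOn_of_deriv_nonneg (convex_Ioi 0)
      (fun r hr => (hgd r hr).continuousAt.continuousWithinAt) ?_ ?_
    · rw [interior_Ioi]
      exact fun r hr => (hgd r hr).differentiableAt.differentiableWithinAt
    · rw [interior_Ioi]
      intro r hr
      rw [(hgd r hr).deriv]
      exact mul_nonneg (le_of_lt hr) (hLpos r hr).le
  -- `φ'` is bounded near the origin, since `φ` is `C²` up to it
  have hg0 : Tendsto g (𝓝[>] 0) (𝓝 0) := by
    have h1 : ContinuousOn (derivWithin φ (Set.Ici 0)) (Set.Ici 0) :=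
      hφ.contDiffOn.continuousOn_derivWithin (uniqueDiffOn_Ici 0) (by norm_num)
    have h2 : Tendsto (fun r => r * derivWithin φ (Set.Ici 0) r) (𝓝[>] 0) (𝓝 0) := by
      have h3 : Tendsto (derivWithin φ (Set.Ici 0)) (𝓝[>] 0)
          (𝓝 (derivWithin φ (Set.Ici 0) 0)) :=
        (h1 0 Set.self_mem_Ici).mono_left (nhdsWithin_mono _ Set.Ioi_subset_Ici_self)
      have h4 : Tendsto (fun r : ℝ => r) (𝓝[>] 0) (𝓝 0) := nhdsWithin_le_nhds
      simpa using h4.mul h3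
    refine h2.congr' ?_
    filter_upwards [self_mem_nhdsWithin] with r hr
    rw [derivWithin_of_mem_nhds (Ici_mem_nhds hr)]
  have hgnn : ∀ r : ℝ, 0 < r → 0 ≤ g r := by
    intro r hr
    refine le_of_tendsto hg0 ?_
    filter_upwards [Ioo_mem_nhdsGT hr] with s hs
    exact hgmono hs.1 hr hs.2.le
  have hdnn : ∀ r : ℝ, 0 < r → 0 ≤ deriv φ r := fun r hr =>
    nonneg_of_mul_nonneg_right (hgnn r hr) hr
  refine ⟨hφ.contDiffOn.continuousOn, hφ.nonneg, ?_, ?_⟩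
  · refine monotoneOn_of_deriv_nonneg (convex_Ici 0) hφ.contDiffOn.continuousOn ?_ ?_
    · rw [interior_Ici]
      exact fun r hr => (hd r hr).differentiableAt.differentiableWithinAt
    · rw [interior_Ici]
      exact fun r hr => hdnn r hr
  · obtain ⟨τ, -, -, -, hτ0, -, ⟨k, hk, hE⟩, -⟩ := hφ.exists_tau
    have hev : ∀ᶠ r in atTop, k * τ r < 1 / 4 := by
      have : Tendsto (fun r => k * τ r) atTop (𝓝 0) := by simpa using hτ0.const_mul k
      exact this.eventually (gt_mem_nhds (by norm_num))
    obtain ⟨R₀, hR₀⟩ := eventually_atTop.1 hev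
    set R := max R₀ 1
    have hR1 : 1 ≤ R := le_max_right _ _
    -- beyond `R`, `(Δφ)^(-1/2) ≤ k τ < 1/4`
    have hL16 : ∀ r : ℝ, R ≤ r → 16 ≤ radialLaplacian φ r := by
      intro r hr
      have hr1 : 1 ≤ r := hR1.trans hr
      have hnr : ‖(r : ℂ)‖ = r := by rw [Complex.norm_real, Real.norm_of_nonneg (by linarith)]
      have h1 := (hE r).2
      simp only [hnr] at h1
      rw [if_neg (not_lt.2 hr1)] at h1
      have h2 := h1.trans (hR₀ r ((le_max_left _ _).trans hr)).le
      have hL := hLpos r (by linarith)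
      rw [Real.rpow_neg hL.le, ← Real.sqrt_eq_rpow] at h2
      have hs : 0 < Real.sqrt (radialLaplacian φ r) := Real.sqrt_pos.2 hL
      have h3 : 4 ≤ Real.sqrt (radialLaplacian φ r) := by
        rw [inv_le_comm₀ hs (by norm_num)] at h2
        linarith
      nlinarith [Real.sq_sqrt hL.le]
    -- `r φ'(r) - 8 r ^ 2` increases beyond `R`
    have hg1 : MonotoneOn (fun r => g r - 8 * r ^ 2) (Set.Ici R) := by
      have hder : ∀ r : ℝ, 0 < r →
          HasDerivAt (fun r => g r - 8 * r ^ 2) (r * radialLaplacian φ r - 8 * (2 * r)) r := by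
        intro r hr
        have h : HasDerivAt (fun r => g r - 8 * r ^ 2)
            (r * radialLaplacian φ r - 8 * (((2 : ℕ) : ℝ) * r ^ (2 - 1))) r :=
          (hgd r hr).sub ((hasDerivAt_pow 2 r).const_mul 8)
        exact h.congr_deriv (by norm_num)
      refine monotoneOn_of_deriv_nonneg (convex_Ici R)
        (fun r hr => (hder r (by simp at hr; linarith)).continuousAt.continuousWithinAt) ?_ ?_
      · rw [interior_Ici]
        intro r hr
        simp only [Set.mem_Ioi] at hr
        exact (hder r (by linarith)).differentiableAt.differentiableWithinAt
      · rw [interior_Ici]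
        intro r hr
        simp only [Set.mem_Ioi] at hr
        rw [(hder r (by linarith)).deriv]
        nlinarith [hL16 r hr.le]
    have hdl : ∀ r : ℝ, 2 * R ≤ r → 6 * r ≤ deriv φ r := by
      intro r hr
      have h1 := hg1 (Set.self_mem_Ici) (show R ≤ r by linarith) (by linarith)
      have h2 := hgnn R (by linarith)
      simp only at h1
      have h3 : 6 * r ^ 2 ≤ r * deriv φ r := by
        have : g r = r * deriv φ r := rfl
        nlinarith
      nlinarith
    refine ⟨1, 2 * R, one_pos, by linarith, fun r s hr hrs => ?_⟩
    have hmono : MonotoneOn (fun r => φ r - r ^ 2) (Set.Ici (2 * R)) := by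
      have hder : ∀ r : ℝ, 0 < r → HasDerivAt (fun r => φ r - r ^ 2) (deriv φ r - 2 * r) r := by
        intro r hr
        have h : HasDerivAt (fun r => φ r - r ^ 2)
            (deriv φ r - ((2 : ℕ) : ℝ) * r ^ (2 - 1)) r := (hd r hr).sub (hasDerivAt_pow 2 r)
        exact h.congr_deriv (by norm_num)
      refine monotoneOn_of_deriv_nonneg (convex_Ici _)
        (fun r hr => (hder r (by simp at hr; linarith)).continuousAt.continuousWithinAt) ?_ ?_
      · rw [interior_Ici]
        intro r hr
        simp only [Set.mem_Ioi] at hr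
        exact (hder r (by linarith)).differentiableAt.differentiableWithinAt
      · rw [interior_Ici]
        intro r hr
        simp only [Set.mem_Ioi] at hr
        rw [(hder r (by linarith)).deriv]
        linarith [hdl r hr.le]
    have := hmono (show r ∈ Set.Ici (2 * R) from hr) (show s ∈ Set.Ici (2 * R) from hr.trans hrs) hrs
    simp only at this
    linarith

/-! ### The integral defining the space -/

/-- The weight `e^{-p φ(r)}` as a function on the whole line, even in `r`. -/
noncomputable def radialWeight (φ : ℝ → ℝ) (p r : ℝ) : ENNReal :=
  ENNReal.ofReal (Real.exp (-(p * φ |r|)))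

/-- The integral `∫ |f| ^ p e^{-p φ} dm`, the `p`-th power of the (quasi-)norm. -/
noncomputable def fockIntegral (φ : ℝ → ℝ) (p : ℝ) (f : ℂ → ℂ) : ENNReal :=
  ∫⁻ z, ‖f z‖ₑ ^ p * radialWeight φ p ‖z‖

section Basic

variable {φ : ℝ → ℝ} {p : ℝ}

theorem HasQuadraticGrowth.continuous_abs (hφ : HasQuadraticGrowth φ) :
    Continuous fun r => φ |r| :=
  hφ.continuousOn.comp_continuous _root_.continuous_abs fun r => abs_nonneg r

theorem HasQuadraticGrowth.measurable_radialWeight (hφ : HasQuadraticGrowth φ) (p : ℝ) :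
    Measurable (radialWeight φ p) := by
  have h := hφ.continuous_abs
  exact (Real.continuous_exp.comp (continuous_const.mul h).neg).measurable.ennreal_ofReal

theorem radialWeight_ne_top (r : ℝ) : radialWeight φ p r ≠ ⊤ := ENNReal.ofReal_ne_top

theorem eLpNorm_eq_fockIntegral (hφ : HasQuadraticGrowth φ) (hp : 0 < p) (f : ℂ → ℂ) :
    eLpNorm f (ENNReal.ofReal p) (fockMeasure φ p) = fockIntegral φ p f ^ (1 / p) := by
  rw [eLpNorm_eq_lintegral_rpow_enorm_toReal (by simpa using hp) ENNReal.ofReal_ne_top,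
    ENNReal.toReal_ofReal hp.le, fockMeasure, fockIntegral]
  have h : (fun z : ℂ => ENNReal.ofReal (Real.exp (-(p * φ ‖z‖)))) =
      fun z => radialWeight φ p ‖z‖ := by
    ext z
    simp [radialWeight]
  rw [h, lintegral_withDensity_eq_lintegral_mul_non_measurable volume
    (f := fun z : ℂ => radialWeight φ p ‖z‖) ((hφ.measurable_radialWeight p).comp measurable_norm)
    (Eventually.of_forall fun z => lt_top_iff_ne_top.2 (radialWeight_ne_top _))]
  simp only [Pi.mul_apply, mul_comm]

theorem mem_fockSpace_iff (hφ : HasQuadraticGrowth φ) (hp : 0 < p) {f : ℂ → ℂ} :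
    f ∈ fockSpace φ p ↔ Differentiable ℂ f ∧ fockIntegral φ p f ≠ ⊤ := by
  change (Differentiable ℂ f ∧ MemLp f (ENNReal.ofReal p) (fockMeasure φ p)) ↔ _
  refine and_congr_right fun hf => ?_
  rw [MemLp, eLpNorm_eq_fockIntegral hφ hp, lt_top_iff_ne_top]
  have h1 : AEStronglyMeasurable f (fockMeasure φ p) := hf.continuous.aestronglyMeasurable
  have h2 : fockIntegral φ p f ^ (1 / p) ≠ ⊤ ↔ fockIntegral φ p f ≠ ⊤ := by
    rw [Ne, ENNReal.rpow_eq_top_iff_of_pos (by positivity)]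
  rw [h2]
  exact and_iff_right h1

theorem fockNorm_rpow (hφ : HasQuadraticGrowth φ) (hp : 0 < p) (f : ℂ → ℂ) :
    fockNorm φ p f ^ p = (fockIntegral φ p f).toReal := by
  rw [fockNorm, eLpNorm_eq_fockIntegral hφ hp, ENNReal.toReal_rpow, ← ENNReal.rpow_mul,
    one_div_mul_cancel hp.ne', ENNReal.rpow_one]

theorem fockNorm_nonneg (f : ℂ → ℂ) : 0 ≤ fockNorm φ p f := ENNReal.toReal_nonneg

theorem fockNorm_lt_of_fockIntegral_lt (hφ : HasQuadraticGrowth φ) (hp : 0 < p) {f : ℂ → ℂ} {ε : ℝ}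
    (hε : 0 < ε) (h : fockIntegral φ p f < ENNReal.ofReal (ε ^ p)) : fockNorm φ p f < ε := by
  rw [← Real.rpow_lt_rpow_iff (fockNorm_nonneg f) hε.le hp, fockNorm_rpow hφ hp]
  rwa [ENNReal.lt_ofReal_iff_toReal_lt (ne_top_of_lt h)] at h

theorem fockIntegral_eq_radial (hφ : HasQuadraticGrowth φ) {f : ℂ → ℂ} (hf : Differentiable ℂ f) :
    fockIntegral φ p f =
      ∫⁻ r in Set.Ioi 0, ENNReal.ofReal r * radialWeight φ p r * powMean f p r :=
  lintegral_mul_radial hf p (hφ.measurable_radialWeight p)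

theorem ENNReal.add_rpow_le_two_rpow_mul {p : ℝ} (hp : 0 < p) (a b : ENNReal) :
    (a + b) ^ p ≤ 2 ^ p * (a ^ p + b ^ p) := by
  have h : a + b ≤ 2 * max a b := by
    rw [two_mul]
    exact add_le_add (le_max_left _ _) (le_max_right _ _)
  calc (a + b) ^ p ≤ (2 * max a b) ^ p := ENNReal.rpow_le_rpow h hp.le
    _ = 2 ^ p * max a b ^ p := ENNReal.mul_rpow_of_nonneg _ _ hp.le
    _ ≤ _ := by
      gcongr
      rcases max_cases a b with ⟨h, -⟩ | ⟨h, -⟩ <;> rw [h]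
      · exact le_self_add
      · exact le_add_self

/-- A substitute, valid for every `p > 0`, for the triangle inequality for series. -/
theorem ENNReal.tsum_rpow_le {p : ℝ} (hp : 0 < p) (x l : ℕ → ENNReal) (hl : ∀ n, l n ≠ 0)
    (hl' : ∀ n, l n ≠ ⊤) :
    (∑' n, x n) ^ p ≤ (∑' n, (l n)⁻¹) ^ p * ∑' n, l n ^ p * x n ^ p := by
  set S := ∑' n, l n ^ p * x n ^ p
  have h1 : ∀ n, x n ≤ (l n)⁻¹ * S ^ (1 / p) := by
    intro n
    have h2 : (l n * x n) ^ p ≤ S := by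
      rw [ENNReal.mul_rpow_of_nonneg _ _ hp.le]
      exact ENNReal.le_tsum n
    have h3 : l n * x n ≤ S ^ (1 / p) := by
      rwa [one_div, ENNReal.le_rpow_inv_iff hp]
    calc x n = (l n)⁻¹ * (l n * x n) := by
          rw [← mul_assoc, ENNReal.inv_mul_cancel (hl n) (hl' n), one_mul]
      _ ≤ _ := by gcongr
  calc (∑' n, x n) ^ p ≤ ((∑' n, (l n)⁻¹) * S ^ (1 / p)) ^ p := by
        rw [← ENNReal.tsum_mul_right]
        exact ENNReal.rpow_le_rpow (ENNReal.tsum_le_tsum h1) hp.le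
    _ = _ := by
        rw [ENNReal.mul_rpow_of_nonneg _ _ hp.le, ← ENNReal.rpow_mul, one_div_mul_cancel hp.ne',
          ENNReal.rpow_one]

theorem fockIntegral_add_le (hφ : HasQuadraticGrowth φ) (hp : 0 < p) {f g : ℂ → ℂ}
    (hf : Differentiable ℂ f) :
    fockIntegral φ p (f + g) ≤ 2 ^ p * (fockIntegral φ p f + fockIntegral φ p g) := by
  have hm := (hφ.measurable_radialWeight p).comp measurable_norm (α := ℂ)
  have hm2 : Measurable fun z => ‖f z‖ₑ ^ p * radialWeight φ p ‖z‖ :=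
    (measurable_enorm_rpow hf p).mul hm
  have h2 : (2 : ENNReal) ^ p ≠ ⊤ := ENNReal.rpow_ne_top_of_nonneg hp.le (by norm_num)
  rw [fockIntegral, fockIntegral, fockIntegral, ← lintegral_add_left hm2,
    ← lintegral_const_mul' _ _ h2]
  refine lintegral_mono fun z => ?_
  rw [← add_mul, ← mul_assoc]
  gcongr
  refine le_trans ?_ (ENNReal.add_rpow_le_two_rpow_mul hp _ _)
  exact ENNReal.rpow_le_rpow (enorm_add_le _ _) hp.le

theorem fockIntegral_neg (f : ℂ → ℂ) : fockIntegral φ p (-f) = fockIntegral φ p f := by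
  simp [fockIntegral]

theorem tsum_inv_sq_ne_top : (∑' n : ℕ, (((n : ENNReal) + 1) ^ 2)⁻¹) ≠ ⊤ := by
  have h1 : Summable fun n : ℕ => 1 / ((n : ℝ) + 1) ^ 2 := by
    have h := (summable_nat_add_iff 1).2 (Real.summable_one_div_nat_pow.2 (by norm_num : 1 < 2))
    simpa using h
  have h2 : ∀ n : ℕ, (((n : ENNReal) + 1) ^ 2)⁻¹ = ENNReal.ofReal (1 / ((n : ℝ) + 1) ^ 2) := by
    intro n
    rw [one_div, ENNReal.ofReal_inv_of_pos (by positivity), ENNReal.ofReal_pow (by positivity),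
      ENNReal.ofReal_add (by positivity) zero_le_one, ENNReal.ofReal_natCast, ENNReal.ofReal_one]
  simp only [h2]
  exact h1.tsum_ofReal_ne_top

/-- The (quasi-)norm of a power series is controlled by those of its terms. -/
theorem fockIntegral_le_tsum (hφ : HasQuadraticGrowth φ) (hp : 0 < p) {f : ℂ → ℂ} {a : ℕ → ℂ}
    (h : ∀ z, HasSum (fun n => a n * z ^ n) (f z)) :
    fockIntegral φ p f ≤ (∑' n : ℕ, (((n : ENNReal) + 1) ^ 2)⁻¹) ^ p *
      ∑' n : ℕ, (((n : ENNReal) + 1) ^ 2) ^ p *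
        (‖a n‖ₑ ^ p * fockIntegral φ p (fun z => z ^ n)) := by
  have hm := (hφ.measurable_radialWeight p).comp measurable_norm (α := ℂ)
  set L := (∑' n : ℕ, (((n : ENNReal) + 1) ^ 2)⁻¹) ^ p
  have hLt : L ≠ ⊤ := ENNReal.rpow_ne_top_of_nonneg hp.le tsum_inv_sq_ne_top
  have hpt : ∀ z, ‖f z‖ₑ ^ p * radialWeight φ p ‖z‖ ≤ L * ∑' n : ℕ, (((n : ENNReal) + 1) ^ 2) ^ p *
      (‖a n‖ₑ ^ p * (‖z ^ n‖ₑ ^ p * radialWeight φ p ‖z‖)) := by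
    intro z
    have h1 : ‖f z‖ₑ ≤ ∑' n, ‖a n * z ^ n‖ₑ := by
      rw [← (h z).tsum_eq]
      exact enorm_tsum_le_tsum_enorm
    have h2 := (ENNReal.rpow_le_rpow h1 hp.le).trans (ENNReal.tsum_rpow_le hp
      (fun n => ‖a n * z ^ n‖ₑ) (fun n : ℕ => ((n : ENNReal) + 1) ^ 2) (fun n => by simp)
      (fun n => by finiteness))
    calc ‖f z‖ₑ ^ p * radialWeight φ p ‖z‖
        ≤ (L * ∑' n : ℕ, (((n : ENNReal) + 1) ^ 2) ^ p * ‖a n * z ^ n‖ₑ ^ p) *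
          radialWeight φ p ‖z‖ := by gcongr
      _ = _ := by
        rw [mul_assoc, ← ENNReal.tsum_mul_right]
        congr 2
        ext n
        rw [enorm_mul, ENNReal.mul_rpow_of_nonneg _ _ hp.le]
        ring
  have hmn : ∀ n : ℕ, Measurable fun z : ℂ => ‖z ^ n‖ₑ ^ p * radialWeight φ p ‖z‖ := fun n =>
    (measurable_enorm_rpow (differentiable_pow n) p).mul hm
  calc fockIntegral φ p f ≤ ∫⁻ z, L * ∑' n : ℕ, (((n : ENNReal) + 1) ^ 2) ^ p *
      (‖a n‖ₑ ^ p * (‖z ^ n‖ₑ ^ p * radialWeight φ p ‖z‖)) := lintegral_mono hpt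
    _ = _ := by
      rw [lintegral_const_mul' _ _ hLt, lintegral_tsum]
      · congr 2
        ext n
        rw [lintegral_const_mul _ ((hmn n).const_mul _), lintegral_const_mul _ (hmn n)]
        rfl
      · intro n
        exact (((hmn n).const_mul _).const_mul _).aemeasurable

theorem powMean_pow (n : ℕ) {r : ℝ} (hr : 0 ≤ r) :
    powMean (fun z => z ^ n) p r = ENNReal.ofReal (2 * Real.pi) * ENNReal.ofReal (r ^ n) ^ p := by
  rw [powMean]
  have : ∀ θ : ℝ, ‖(circleMap 0 r θ) ^ n‖ₑ ^ p = ENNReal.ofReal (r ^ n) ^ p := by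
    intro θ
    rw [← ofReal_norm, norm_pow, norm_circleMap_zero, abs_of_nonneg hr]
  simp only [this]
  rw [setLIntegral_const, Real.volume_Ioc, mul_comm]
  congr 2
  ring

/-- On each circle, a Taylor coefficient is controlled by the `p`-th power mean, up to a polynomial
factor. The sub-mean value inequality is used over discs of radius `r / (n + 2)`. -/
theorem enorm_coeff_rpow_mul_powMean_le {f : ℂ → ℂ} (hf : Differentiable ℂ f) (hp : 0 < p) (n : ℕ)
    {r : ℝ} (hr : 0 < r) :
    ‖iteratedDeriv n f 0 / n.factorial‖ₑ ^ p * powMean (fun z => z ^ n) p r ≤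
      ENNReal.ofReal (3 ^ p * (n + 2) ^ 2) * powMean f p r := by
  have hpi := Real.pi_pos
  set δ : ℝ := r / (n + 2) with hδ
  set s : ℝ := r * (n + 1) / (n + 2) with hs
  have hδ0 : 0 < δ := by positivity
  have hs0 : 0 < s := by positivity
  have hsδ : s + δ = r := by rw [hs, hδ]; field_simp; ring
  set m : ℝ := Real.circleAverage (fun z => ‖f z‖ ^ p) 0 r
  have hm0 : 0 ≤ m := Real.circleAverage_nonneg_of_nonneg fun z _ => by positivity
  have hmean : powMean f p r = ENNReal.ofReal (2 * Real.pi * m) := powMean_eq_ofReal hf hp hr.le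
  -- the disc of radius `δ` around a point of the circle of radius `s` lies in the disc of radius
  -- `r`
  have hsup : ∀ z ∈ Metric.sphere (0 : ℂ) s, ‖f z‖ ≤ ((n + 2) ^ 2 * m) ^ (1 / p) := by
    intro z hz
    have h1 := mul_enorm_rpow_le_lintegral_ball hf hp z hδ0
    have h2 : Metric.ball z δ ⊆ Metric.ball 0 r := by
      refine Metric.ball_subset_ball' ?_
      rw [mem_sphere_iff_norm, sub_zero] at hz
      rw [dist_zero_right, hz]
      linarith
    have h3 := (h1.trans (lintegral_mono_set h2)).trans (lintegral_ball_zero_le hf hp hr.le)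
    rw [hmean, enorm_rpow_eq_ofReal hp, ← ENNReal.ofReal_mul (by positivity),
      ← ENNReal.ofReal_mul (by positivity), ENNReal.ofReal_le_ofReal_iff (by positivity)] at h3
    have h4 : ‖f z‖ ^ p ≤ (n + 2) ^ 2 * m := by
      have h5 : r = (n + 2) * δ := by rw [hδ]; field_simp
      have h6 : r ^ 2 / 2 * (2 * Real.pi * m) = (Real.pi * δ ^ 2) * ((n + 2) ^ 2 * m) := by
        rw [h5]; ring
      rw [h6] at h3
      exact le_of_mul_le_mul_left h3 (by positivity)
    calc ‖f z‖ = (‖f z‖ ^ p) ^ (1 / p) := by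
          rw [← Real.rpow_mul (norm_nonneg _), mul_one_div_cancel hp.ne', Real.rpow_one]
      _ ≤ _ := Real.rpow_le_rpow (by positivity) h4 (by positivity)
  have hcauchy := Complex.norm_iteratedDeriv_le_of_forall_mem_sphere_norm_le n hs0
    (hf.diffContOnCl (s := Metric.ball 0 s)) hsup
  -- `(r / s) ^ n = (1 + 1 / (n + 1)) ^ n` is at most `e`
  have hrs : r ^ n ≤ 3 * s ^ n := by
    have h1 : r = s * (1 + 1 / (n + 1)) := by rw [hs]; field_simp; ring
    have h2 : (1 + 1 / ((n : ℝ) + 1)) ^ n ≤ 3 := by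
      calc (1 + 1 / ((n : ℝ) + 1)) ^ n ≤ (Real.exp (1 / ((n : ℝ) + 1))) ^ n := by
            gcongr
            linarith [Real.add_one_le_exp (1 / ((n : ℝ) + 1))]
        _ = Real.exp (n * (1 / ((n : ℝ) + 1))) := by rw [← Real.exp_nat_mul]
        _ ≤ Real.exp 1 := by
            refine Real.exp_le_exp.2 ?_
            rw [mul_one_div, div_le_one (by positivity)]
            linarith
        _ ≤ 3 := by linarith [Real.exp_one_lt_d9]
    calc r ^ n = s ^ n * (1 + 1 / ((n : ℝ) + 1)) ^ n := by
          conv_lhs => rw [h1]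
          rw [mul_pow]
      _ ≤ s ^ n * 3 := by gcongr
      _ = _ := mul_comm _ _
  set A : ℝ := ‖iteratedDeriv n f 0 / n.factorial‖ with hA
  have hAs : A * s ^ n ≤ ((n + 2) ^ 2 * m) ^ (1 / p) := by
    have : A = ‖iteratedDeriv n f 0‖ / n.factorial := by rw [hA, norm_div]; simp
    rw [this, div_mul_eq_mul_div, div_le_iff₀ (by positivity)]
    rw [le_div_iff₀ (by positivity)] at hcauchy
    linarith
  have hAr : (A * r ^ n) ^ p ≤ 3 ^ p * (n + 2) ^ 2 * m := by
    calc (A * r ^ n) ^ p ≤ (3 * ((n + 2) ^ 2 * m) ^ (1 / p)) ^ p := by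
          refine Real.rpow_le_rpow (by positivity) ?_ hp.le
          calc A * r ^ n ≤ A * (3 * s ^ n) := by gcongr
            _ = 3 * (A * s ^ n) := by ring
            _ ≤ _ := by gcongr
      _ = _ := by
          rw [Real.mul_rpow (by norm_num) (by positivity), ← Real.rpow_mul (by positivity),
            one_div_mul_cancel hp.ne', Real.rpow_one]
          ring
  rw [powMean_pow n hr.le, hmean, enorm_rpow_eq_ofReal hp, ENNReal.ofReal_rpow_of_nonneg
    (by positivity) hp.le, ← ENNReal.ofReal_mul (by positivity), ← ENNReal.ofReal_mul (by positivity),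
    ← ENNReal.ofReal_mul (by positivity)]
  refine ENNReal.ofReal_le_ofReal ?_
  rw [Real.mul_rpow (by positivity) (by positivity)] at hAr
  calc A ^ p * (2 * Real.pi * (r ^ n) ^ p) = 2 * Real.pi * (A ^ p * (r ^ n) ^ p) := by ring
    _ ≤ 2 * Real.pi * (3 ^ p * (n + 2) ^ 2 * m) := by gcongr
    _ = _ := by ring

theorem enorm_coeff_rpow_mul_fockIntegral_le (hφ : HasQuadraticGrowth φ) {f : ℂ → ℂ}
    (hf : Differentiable ℂ f) (hp : 0 < p) (n : ℕ) :
    ‖iteratedDeriv n f 0 / n.factorial‖ₑ ^ p * fockIntegral φ p (fun z => z ^ n) ≤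
      ENNReal.ofReal (3 ^ p * (n + 2) ^ 2) * fockIntegral φ p f := by
  rw [fockIntegral_eq_radial hφ hf, fockIntegral_eq_radial hφ (differentiable_pow n),
    ← lintegral_const_mul' _ _ (ENNReal.rpow_ne_top_of_nonneg hp.le enorm_ne_top),
    ← lintegral_const_mul' _ _ ENNReal.ofReal_ne_top]
  refine setLIntegral_mono' measurableSet_Ioi fun r hr => ?_
  have h := enorm_coeff_rpow_mul_powMean_le hf hp n hr
  calc _ = ENNReal.ofReal r * radialWeight φ p r *
      (‖iteratedDeriv n f 0 / n.factorial‖ₑ ^ p * powMean (fun z => z ^ n) p r) := by ring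
    _ ≤ ENNReal.ofReal r * radialWeight φ p r *
      (ENNReal.ofReal (3 ^ p * (n + 2) ^ 2) * powMean f p r) := by gcongr
    _ = _ := by ring

end Basic

/-! ### Norms of monomials -/

/-- `ρ > 0` is a point at which `r ^ n e^{-φ(r)}` attains its maximum over `[0, ∞)`. -/
structure IsPeak (φ : ℝ → ℝ) (n : ℕ) (ρ : ℝ) : Prop where
  pos : 0 < ρ
  le : ∀ r : ℝ, 0 ≤ r → r ^ n * Real.exp (-φ r) ≤ ρ ^ n * Real.exp (-φ ρ)

section Moments

variable {φ : ℝ → ℝ} {p : ℝ}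

theorem HasQuadraticGrowth.eventually_le (hφ : HasQuadraticGrowth φ) :
    ∀ᶠ r in atTop, r ≤ φ r := by
  obtain ⟨c, R, hc, hR, h⟩ := hφ.growth
  filter_upwards [eventually_ge_atTop R, eventually_ge_atTop (1 / c * (1 + c * R ^ 2)),
    eventually_ge_atTop 1] with r h1 h2 h3
  have h4 := h R r le_rfl h1
  have h5 := hφ.nonneg R hR.le
  have h6 : 1 + c * R ^ 2 ≤ c * r := by
    calc 1 + c * R ^ 2 = c * (1 / c * (1 + c * R ^ 2)) := by field_simp
      _ ≤ c * r := by gcongr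
  have h7 : 0 ≤ c * R ^ 2 := by positivity
  nlinarith

theorem HasQuadraticGrowth.exists_isPeak (hφ : HasQuadraticGrowth φ) {n : ℕ} (hn : 1 ≤ n) :
    ∃ ρ, IsPeak φ n ρ := by
  set h : ℝ → ℝ := fun r => r ^ n * Real.exp (-φ r) with hh
  have hc : ContinuousOn h (Set.Ici 0) :=
    (continuous_pow n).continuousOn.mul hφ.continuousOn.neg.rexp
  have hlim : Tendsto h atTop (𝓝 0) := by
    refine squeeze_zero' ?_ ?_ (Real.tendsto_pow_mul_exp_neg_atTop_nhds_zero n)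
    · filter_upwards [eventually_ge_atTop 0] with r hr
      positivity
    · filter_upwards [eventually_ge_atTop 0, hφ.eventually_le] with r hr hle
      simp only [hh]
      gcongr
  have h1pos : 0 < h 1 := by simp only [hh]; positivity
  have hev : ∀ᶠ r in cocompact ℝ ⊓ 𝓟 (Set.Ici 0), h r ≤ h 1 := by
    have h1 : ∀ᶠ r in atTop, h r ≤ h 1 := (hlim.eventually (gt_mem_nhds h1pos)).mono
      fun _ h => le_of_lt h
    rw [eventually_inf_principal, cocompact_eq_atBot_atTop, eventually_sup]
    refine ⟨?_, h1.mono fun _ h _ => h⟩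
    filter_upwards [eventually_lt_atBot 0] with r hr hr'
    exact absurd hr' (not_le.2 hr)
  obtain ⟨ρ, hρ, hmax⟩ := hc.exists_isMaxOn' isClosed_Ici (Set.mem_Ici.2 zero_le_one) hev
  refine ⟨ρ, lt_of_le_of_ne hρ fun h0 => ?_, fun r hr => hmax hr⟩
  have := hmax (Set.mem_Ici.2 zero_le_one)
  simp only [← h0, hh, Set.mem_ofPred_eq] at this
  rw [zero_pow (by omega), zero_mul] at this
  exact absurd h1pos (not_lt.2 this)

/-- The maximum points of `r ^ n e^{-φ(r)}` stay away from the origin, uniformly in `n`. -/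
theorem IsPeak.exp_neg_le (hφ : HasQuadraticGrowth φ) {n : ℕ} (hn : 1 ≤ n) {ρ : ℝ}
    (h : IsPeak φ n ρ) : Real.exp (-φ 1) ≤ ρ := by
  rcases le_or_gt 1 ρ with h1 | h1
  · exact (Real.exp_le_one_iff.2 (by linarith [hφ.nonneg 1 zero_le_one])).trans h1
  · have h2 := h.le 1 zero_le_one
    rw [one_pow, one_mul] at h2
    calc Real.exp (-φ 1) ≤ ρ ^ n * Real.exp (-φ ρ) := h2
      _ ≤ ρ ^ n * 1 := by
        gcongr
        · exact pow_nonneg h.pos.le n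
        · exact Real.exp_le_one_iff.2 (by linarith [hφ.nonneg ρ h.pos.le])
      _ = ρ ^ n := mul_one _
      _ ≤ ρ ^ 1 := pow_le_pow_of_le_one h.pos.le h1.le hn
      _ = ρ := pow_one _

/-- The maximum point of `r ^ n e^{-φ(r)}` is `O(√n)`, by comparison with half of it. -/
theorem HasQuadraticGrowth.exists_peak_sq_le (hφ : HasQuadraticGrowth φ) :
    ∃ C : ℝ, 0 < C ∧ ∀ n : ℕ, 1 ≤ n → ∀ ρ, IsPeak φ n ρ → ρ ^ 2 ≤ C * n := by
  obtain ⟨c, R, hc, hR, h⟩ := hφ.growth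
  refine ⟨4 / (3 * c) + 4 * R ^ 2, by positivity, fun n hn ρ hρ => ?_⟩
  have hn1 : (1 : ℝ) ≤ n := by exact_mod_cast hn
  have hρ0 := hρ.pos
  rcases le_or_gt R (ρ / 2) with h1 | h1
  · have h2 := h (ρ / 2) ρ h1 (by linarith)
    have h3 := hρ.le (ρ / 2) (by positivity)
    have h4 : Real.exp (φ ρ - φ (ρ / 2)) ≤ 2 ^ n := by
      have h5 : (ρ / 2) ^ n * Real.exp (-φ (ρ / 2)) =
          ρ ^ n * Real.exp (-φ ρ) * (Real.exp (φ ρ - φ (ρ / 2)) / 2 ^ n) := by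
        rw [div_pow, show -φ (ρ / 2) = -φ ρ + (φ ρ - φ (ρ / 2)) by ring, Real.exp_add]
        ring
      rw [h5] at h3
      have h6 : 0 < ρ ^ n * Real.exp (-φ ρ) := by positivity
      have h7 : Real.exp (φ ρ - φ (ρ / 2)) / 2 ^ n ≤ 1 := by
        by_contra! h8
        nlinarith
      rwa [div_le_one (by positivity)] at h7
    have h5 : (2 : ℝ) ^ n ≤ Real.exp n := by
      calc (2 : ℝ) ^ n ≤ (Real.exp 1) ^ n := by
            gcongr
            linarith [Real.add_one_le_exp (1 : ℝ)]
        _ = Real.exp n := by rw [← Real.exp_nat_mul, mul_one]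
    have h6 : φ ρ - φ (ρ / 2) ≤ n := Real.exp_le_exp.1 (h4.trans h5)
    have h7 : 3 * c * ρ ^ 2 ≤ 4 * n := by nlinarith
    have h8 : ρ ^ 2 ≤ 4 / (3 * c) * n := by
      rw [div_mul_eq_mul_div, le_div_iff₀ (by positivity)]
      linarith
    have h9 : 0 ≤ 4 * R ^ 2 * n := by positivity
    linarith
  · have h2 : ρ ^ 2 ≤ 4 * R ^ 2 := by nlinarith
    have h3 : 0 ≤ 4 / (3 * c) * (n : ℝ) := by positivity
    nlinarith [sq_nonneg R]

theorem IsPeak.add_le {n k : ℕ} {ρ σ : ℝ} (hρ : IsPeak φ n ρ) (hσ : IsPeak φ (n + k) σ) :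
    σ ^ (n + k) * Real.exp (-φ σ) ≤ σ ^ k * (ρ ^ n * Real.exp (-φ ρ)) := by
  have h := hρ.le σ hσ.pos.le
  have h0 := hσ.pos
  calc σ ^ (n + k) * Real.exp (-φ σ) = σ ^ k * (σ ^ n * Real.exp (-φ σ)) := by ring
    _ ≤ _ := by gcongr

/-- Extracting `p`-th roots from an estimate with a polynomially growing constant. -/
theorem exists_le_of_rpow_le (hp : 0 < p) {C : ℝ} (hC : 0 ≤ C) (A : ℕ) :
    ∃ C' : ℝ, 0 < C' ∧ ∃ A' : ℕ, ∀ (n : ℕ) (x y : ℝ), 1 ≤ n → 0 ≤ x → 0 ≤ y →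
      x ^ p ≤ C * (n : ℝ) ^ A * y ^ p → x ≤ C' * (n : ℝ) ^ A' * y := by
  refine ⟨C ^ (1 / p) + 1, by positivity, A * ⌈1 / p⌉₊, fun n x y hn hx hy h => ?_⟩
  have hn1 : (1 : ℝ) ≤ (n : ℝ) ^ A := one_le_pow₀ (by exact_mod_cast hn)
  calc x = (x ^ p) ^ (1 / p) := by
        rw [← Real.rpow_mul hx, mul_one_div_cancel hp.ne', Real.rpow_one]
    _ ≤ (C * (n : ℝ) ^ A * y ^ p) ^ (1 / p) := Real.rpow_le_rpow (by positivity) h (by positivity)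
    _ = C ^ (1 / p) * ((n : ℝ) ^ A) ^ (1 / p) * y := by
        rw [Real.mul_rpow (by positivity) (by positivity), Real.mul_rpow hC (by positivity),
          ← Real.rpow_mul hy, mul_one_div_cancel hp.ne', Real.rpow_one]
    _ ≤ (C ^ (1 / p) + 1) * (n : ℝ) ^ (A * ⌈1 / p⌉₊) * y := by
        gcongr
        · linarith
        · rw [pow_mul, ← Real.rpow_natCast ((n : ℝ) ^ A)]
          exact Real.rpow_le_rpow_of_exponent_le hn1 (Nat.le_ceil _)

theorem rpow_mul_radialWeight (hp : 0 < p) (n : ℕ) (z : ℂ) :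
    ‖z ^ n‖ₑ ^ p * radialWeight φ p ‖z‖ =
      ENNReal.ofReal ((‖z‖ ^ n * Real.exp (-φ ‖z‖)) ^ p) := by
  rw [enorm_rpow_eq_ofReal hp, radialWeight, ← ENNReal.ofReal_mul (by positivity), norm_pow,
    Real.mul_rpow (by positivity) (by positivity), ← Real.exp_mul, abs_norm]
  congr 3
  ring_nf

/-- The integral of `|z| ^ (n p) e^{-p φ}` is at most the maximum of the integrand, up to a power
of `n`: the integrand multiplied by `|z| ^ (a p)`, with `a p ≥ 3`, is bounded by the maximum for
the exponent `n + a`, which exceeds the one for `n` by the factor `σ ^ a = O(n ^ (a / 2))` only. -/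
theorem fockIntegral_pow_le (hφ : HasQuadraticGrowth φ) (hp : 0 < p) :
    ∃ C : ℝ, 0 ≤ C ∧ ∃ A : ℕ, ∀ n : ℕ, 1 ≤ n → ∀ ρ, IsPeak φ n ρ →
      fockIntegral φ p (fun z => z ^ n) ≤
        ENNReal.ofReal (C * (n : ℝ) ^ A * (ρ ^ n * Real.exp (-φ ρ)) ^ p) := by
  obtain ⟨D, hD, hpk⟩ := hφ.exists_peak_sq_le
  set a : ℕ := ⌈3 / p⌉₊
  have hap : 3 ≤ a * p := by
    have := Nat.le_ceil (3 / p)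
    rwa [div_le_iff₀ hp] at this
  set I : ENNReal := ∫⁻ z : ℂ, ENNReal.ofReal ((1 + ‖z‖) ^ (-3 : ℝ))
  have hIt : I ≠ ⊤ := by
    refine (finite_integral_one_add_norm (μ := volume) (E := ℂ) (r := 3) ?_).ne
    rw [Complex.finrank_real_complex]
    norm_num
  set E : ℝ := 1 + D * (1 + a) with hE
  have hE1 : 1 ≤ E := by
    have : 0 ≤ D * (1 + a) := by positivity
    linarith
  refine ⟨8 * (1 + (E ^ a) ^ p) * I.toReal, by positivity, a * ⌈p⌉₊, fun n hn ρ hρ => ?_⟩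
  have hn1 : (1 : ℝ) ≤ n := by exact_mod_cast hn
  set P : ℝ := ρ ^ n * Real.exp (-φ ρ)
  have hP0 : 0 < P := by have := hρ.pos; positivity
  obtain ⟨σ, hσ⟩ := hφ.exists_isPeak (n := n + a) (by omega)
  have hσ0 := hσ.pos
  have hσa : σ ^ a ≤ E ^ a * (n : ℝ) ^ a := by
    rw [← mul_pow]
    have h1 := hpk (n + a) (by omega) σ hσ
    have h2 : σ ≤ 1 + σ ^ 2 := by nlinarith
    refine pow_le_pow_left₀ hσ0.le (h2.trans ?_) a
    push_cast at h1
    have h3 : D * (n + a) ≤ D * (1 + a) * n := by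
      have : (n : ℝ) + a ≤ (1 + a) * n := by nlinarith [(Nat.cast_nonneg a : (0 : ℝ) ≤ a)]
      calc D * (n + a) ≤ D * ((1 + a) * n) := by gcongr
        _ = _ := by ring
    rw [hE]
    linarith
  have hup : ∀ z : ℂ, ‖z‖ ^ (n + a) * Real.exp (-φ ‖z‖) ≤ E ^ a * (n : ℝ) ^ a * P := fun z =>
    ((hσ.le _ (norm_nonneg z)).trans (hρ.add_le hσ)).trans (by gcongr)
  set B : ℝ := (1 + (E ^ a) ^ p) * (n : ℝ) ^ (a * ⌈p⌉₊) * P ^ p with hB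
  have hna : (1 : ℝ) ≤ (n : ℝ) ^ a := one_le_pow₀ hn1
  have hnap : ((n : ℝ) ^ a) ^ p ≤ (n : ℝ) ^ (a * ⌈p⌉₊) := by
    rw [pow_mul, ← Real.rpow_natCast ((n : ℝ) ^ a)]
    exact Real.rpow_le_rpow_of_exponent_le hna (Nat.le_ceil _)
  have hsum : ∀ z : ℂ, (‖z‖ ^ n * Real.exp (-φ ‖z‖)) ^ p +
      (‖z‖ ^ (n + a) * Real.exp (-φ ‖z‖)) ^ p ≤ B := by
    intro z
    have h1 : (‖z‖ ^ n * Real.exp (-φ ‖z‖)) ^ p ≤ (n : ℝ) ^ (a * ⌈p⌉₊) * P ^ p := by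
      calc (‖z‖ ^ n * Real.exp (-φ ‖z‖)) ^ p ≤ P ^ p :=
            Real.rpow_le_rpow (by positivity) (hρ.le _ (norm_nonneg z)) hp.le
        _ ≤ _ := le_mul_of_one_le_left (by positivity) (one_le_pow₀ hn1)
    have h2 : (‖z‖ ^ (n + a) * Real.exp (-φ ‖z‖)) ^ p ≤
        (E ^ a) ^ p * (n : ℝ) ^ (a * ⌈p⌉₊) * P ^ p := by
      calc (‖z‖ ^ (n + a) * Real.exp (-φ ‖z‖)) ^ p ≤ (E ^ a * (n : ℝ) ^ a * P) ^ p :=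
            Real.rpow_le_rpow (by positivity) (hup z) hp.le
        _ = (E ^ a) ^ p * ((n : ℝ) ^ a) ^ p * P ^ p := by
            rw [Real.mul_rpow (by positivity) (by positivity),
              Real.mul_rpow (by positivity) (by positivity)]
        _ ≤ _ := by gcongr
    rw [hB]
    linarith
  -- the weight `(1 + |z|) ^ 3`, which makes the integral converge, costs a shift of the exponent
  have hpt : ∀ z : ℂ, (‖z‖ ^ n * Real.exp (-φ ‖z‖)) ^ p ≤ 8 * B * (1 + ‖z‖) ^ (-3 : ℝ) := by
    intro z
    have hz := norm_nonneg z
    have h3 : (1 + ‖z‖) ^ (3 : ℝ) ≤ 8 * (1 + (‖z‖ ^ a) ^ p) := by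
      rcases le_or_gt ‖z‖ 1 with hz1 | hz1
      · have h4 : (1 + ‖z‖) ^ (3 : ℝ) ≤ 8 := by
          calc (1 + ‖z‖) ^ (3 : ℝ) ≤ (2 : ℝ) ^ (3 : ℝ) :=
                Real.rpow_le_rpow (by positivity) (by linarith) (by norm_num)
            _ = 8 := by norm_num
        have h5 : 0 ≤ (‖z‖ ^ a) ^ p := by positivity
        linarith
      · have h4 : (1 + ‖z‖) ^ (3 : ℝ) ≤ 8 * (‖z‖ ^ a) ^ p := by
          calc (1 + ‖z‖) ^ (3 : ℝ) ≤ (2 * ‖z‖) ^ (3 : ℝ) :=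
                Real.rpow_le_rpow (by positivity) (by linarith) (by norm_num)
            _ = 8 * ‖z‖ ^ (3 : ℝ) := by
                rw [Real.mul_rpow (by norm_num) hz]
                norm_num
            _ ≤ 8 * (‖z‖ ^ a) ^ p := by
                gcongr
                rw [← Real.rpow_natCast, ← Real.rpow_mul hz]
                exact Real.rpow_le_rpow_of_exponent_le hz1.le hap
        linarith
    rw [Real.rpow_neg (by positivity), ← div_eq_mul_inv, le_div_iff₀ (by positivity)]
    set x := (‖z‖ ^ n * Real.exp (-φ ‖z‖)) ^ p with hx
    have h5 : x * (‖z‖ ^ a) ^ p = (‖z‖ ^ (n + a) * Real.exp (-φ ‖z‖)) ^ p := by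
      rw [hx, ← Real.mul_rpow (by positivity) (by positivity)]
      congr 1
      ring
    have h6 := hsum z
    calc x * (1 + ‖z‖) ^ (3 : ℝ) ≤ x * (8 * (1 + (‖z‖ ^ a) ^ p)) := by gcongr
      _ = 8 * (x + x * (‖z‖ ^ a) ^ p) := by ring
      _ ≤ 8 * B := by rw [h5]; linarith
  calc fockIntegral φ p (fun z => z ^ n)
      = ∫⁻ z : ℂ, ENNReal.ofReal ((‖z‖ ^ n * Real.exp (-φ ‖z‖)) ^ p) := by
        refine lintegral_congr fun z => ?_
        exact rpow_mul_radialWeight hp n z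
    _ ≤ ∫⁻ z : ℂ, ENNReal.ofReal (8 * B) * ENNReal.ofReal ((1 + ‖z‖) ^ (-3 : ℝ)) := by
        refine lintegral_mono fun z => ?_
        rw [← ENNReal.ofReal_mul (by positivity)]
        exact ENNReal.ofReal_le_ofReal (hpt z)
    _ = ENNReal.ofReal (8 * B) * I := lintegral_const_mul' _ _ ENNReal.ofReal_ne_top
    _ = ENNReal.ofReal (8 * B * I.toReal) := by
        rw [ENNReal.ofReal_mul (p := 8 * B) (by positivity), ENNReal.ofReal_toReal hIt]
    _ = _ := by
        congr 1
        rw [hB]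
        ring

/-- The integral of `|z| ^ (n p) e^{-p φ}` is at least the maximum of the integrand, up to a factor
`n`: the integrand is comparable to its maximum on the annulus of radii `ρ n / (n + 1)` and `ρ`. -/
theorem le_fockIntegral_pow (hφ : HasQuadraticGrowth φ) (hp : 0 < p) :
    ∃ c : ℝ, 0 < c ∧ ∀ n : ℕ, 1 ≤ n → ∀ ρ, IsPeak φ n ρ →
      ENNReal.ofReal (c / n * (ρ ^ n * Real.exp (-φ ρ)) ^ p) ≤
        fockIntegral φ p (fun z => z ^ n) := by
  have hpi := Real.pi_pos
  refine ⟨Real.pi * (Real.exp (-φ 1)) ^ 2 / 2 / 3 ^ p, by positivity, fun n hn ρ hρ => ?_⟩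
  have hn1 : (1 : ℝ) ≤ n := by exact_mod_cast hn
  have hρ0 := hρ.pos
  have hρ1 := hρ.exp_neg_le hφ hn
  set P : ℝ := ρ ^ n * Real.exp (-φ ρ) with hP
  have hP0 : 0 < P := by positivity
  set s : ℝ := ρ * (n / (n + 1)) with hs
  have hs0 : 0 < s := by positivity
  have hsρ : s ≤ ρ := by
    rw [hs]
    refine mul_le_of_le_one_right hρ0.le ?_
    rw [div_le_one (by positivity)]
    linarith
  -- to the left of the maximum point `φ` is smaller, so that only `r ^ n` matters there
  have hpt : ∀ r : ℝ, s ≤ r → r ≤ ρ → P / 3 ≤ r ^ n * Real.exp (-φ r) := by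
    intro r h1 h2
    have h3 : ρ ^ n ≤ 3 * r ^ n := by
      have h4 : ρ = s * (1 + 1 / n) := by rw [hs]; field_simp
      have h5 : (1 + 1 / (n : ℝ)) ^ n ≤ 3 := by
        calc (1 + 1 / (n : ℝ)) ^ n ≤ (Real.exp (1 / (n : ℝ))) ^ n := by
              gcongr
              linarith [Real.add_one_le_exp (1 / (n : ℝ))]
          _ = Real.exp 1 := by
              rw [← Real.exp_nat_mul]
              congr 1
              field_simp
          _ ≤ 3 := by linarith [Real.exp_one_lt_d9]
      calc ρ ^ n = s ^ n * (1 + 1 / (n : ℝ)) ^ n := by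
            conv_lhs => rw [h4]
            rw [mul_pow]
        _ ≤ r ^ n * 3 := by
            have : 0 ≤ r := hs0.le.trans h1
            gcongr
        _ = _ := mul_comm _ _
    have h4 : Real.exp (-φ ρ) ≤ Real.exp (-φ r) := by
      refine Real.exp_le_exp.2 (neg_le_neg ?_)
      exact hφ.monotoneOn (show (0 : ℝ) ≤ r by linarith) hρ0.le h2
    have hr0 : 0 ≤ r := hs0.le.trans h1
    rw [div_le_iff₀ (by norm_num), hP]
    calc ρ ^ n * Real.exp (-φ ρ) ≤ (3 * r ^ n) * Real.exp (-φ r) := by gcongr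
      _ = _ := by ring
  set S : Set ℂ := Metric.ball 0 ρ \ Metric.ball 0 s with hS
  have hSm : MeasurableSet S := Metric.isOpen_ball.measurableSet.diff Metric.isOpen_ball.measurableSet
  have hvb : ∀ t : ℝ, 0 ≤ t → volume (Metric.ball (0 : ℂ) t) = ENNReal.ofReal (Real.pi * t ^ 2) := by
    intro t ht
    rw [Complex.volume_ball, ENNReal.ofReal_mul hpi.le, ENNReal.ofReal_pow ht, mul_comm,
      ← NNReal.coe_real_pi, ENNReal.ofReal_coe_nnreal]
  have hSv : volume S = ENNReal.ofReal (Real.pi * ρ ^ 2 - Real.pi * s ^ 2) := by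
    rw [hS, measure_sdiff (Metric.ball_subset_ball hsρ)
      Metric.isOpen_ball.measurableSet.nullMeasurableSet (by rw [hvb s hs0.le]; finiteness),
      hvb ρ hρ0.le, hvb s hs0.le, ENNReal.ofReal_sub _ (by positivity)]
  have hvol : Real.pi * (Real.exp (-φ 1)) ^ 2 / 2 / n ≤ Real.pi * ρ ^ 2 - Real.pi * s ^ 2 := by
    have h1 : Real.pi * ρ ^ 2 - Real.pi * s ^ 2 =
        Real.pi * ρ ^ 2 * ((2 * n + 1) / (n + 1) ^ 2) := by
      rw [hs]; field_simp; ring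
    have h2 : 1 / (2 * (n : ℝ)) ≤ (2 * n + 1) / (n + 1) ^ 2 := by
      rw [div_le_div_iff₀ (by positivity) (by positivity)]
      nlinarith
    rw [h1]
    calc Real.pi * (Real.exp (-φ 1)) ^ 2 / 2 / n
        = Real.pi * (Real.exp (-φ 1)) ^ 2 * (1 / (2 * (n : ℝ))) := by field_simp
      _ ≤ _ := by gcongr
  calc ENNReal.ofReal (Real.pi * (Real.exp (-φ 1)) ^ 2 / 2 / 3 ^ p / n * P ^ p)
      ≤ ENNReal.ofReal ((P / 3) ^ p) * volume S := by
        rw [hSv, ← ENNReal.ofReal_mul (by positivity)]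
        refine ENNReal.ofReal_le_ofReal ?_
        rw [Real.div_rpow hP0.le (by norm_num)]
        calc Real.pi * (Real.exp (-φ 1)) ^ 2 / 2 / 3 ^ p / n * P ^ p
            = P ^ p / 3 ^ p * (Real.pi * (Real.exp (-φ 1)) ^ 2 / 2 / n) := by ring
          _ ≤ _ := by gcongr
    _ = ∫⁻ z in S, ENNReal.ofReal ((P / 3) ^ p) := (setLIntegral_const _ _).symm
    _ ≤ ∫⁻ z in S, ‖z ^ n‖ₑ ^ p * radialWeight φ p ‖z‖ := by
        refine setLIntegral_mono' hSm fun z hz => ?_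
        rw [rpow_mul_radialWeight hp]
        refine ENNReal.ofReal_le_ofReal (Real.rpow_le_rpow (by positivity) (hpt _ ?_ ?_) hp.le)
        · simpa using hz.2
        · have := hz.1
          rw [mem_ball_zero_iff] at this
          exact this.le
    _ ≤ _ := setLIntegral_le_lintegral _ _

theorem fockIntegral_pow_ne_top (hφ : HasQuadraticGrowth φ) (hp : 0 < p) (n : ℕ) :
    fockIntegral φ p (fun z => z ^ n) ≠ ⊤ := by
  have h : ∀ n : ℕ, 1 ≤ n → fockIntegral φ p (fun z => z ^ n) ≠ ⊤ := by
    intro n hn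
    obtain ⟨ρ, hρ⟩ := hφ.exists_isPeak hn
    obtain ⟨C, -, A, hC⟩ := fockIntegral_pow_le hφ hp
    exact ne_top_of_le_ne_top ENNReal.ofReal_ne_top (hC n hn ρ hρ)
  rcases Nat.eq_zero_or_pos n with rfl | hn
  · -- `1` is bounded on the unit disc, and by `|z|` outside of it
    rw [fockIntegral_eq_radial hφ (differentiable_pow 0)]
    have h1 := h 1 le_rfl
    rw [fockIntegral_eq_radial hφ (differentiable_pow 1)] at h1
    rw [← Set.Ioc_union_Ioi_eq_Ioi zero_le_one]
    refine ne_top_of_le_ne_top ?_ (lintegral_union_le _ _ _)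
    refine ENNReal.add_ne_top.2 ⟨?_, ?_⟩
    · have h2 : ∀ r ∈ Set.Ioc (0 : ℝ) 1,
          ENNReal.ofReal r * radialWeight φ p r * powMean (fun z => z ^ 0) p r ≤
            1 * 1 * ENNReal.ofReal (2 * Real.pi) := by
        intro r hr
        rw [powMean_pow 0 hr.1.le]
        simp only [pow_zero, ENNReal.ofReal_one, ENNReal.one_rpow, mul_one]
        refine mul_le_mul' (mul_le_one' ?_ ?_) le_rfl
        · rw [← ENNReal.ofReal_one]
          exact ENNReal.ofReal_le_ofReal hr.2
        · rw [radialWeight, ← ENNReal.ofReal_one]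
          refine ENNReal.ofReal_le_ofReal (Real.exp_le_one_iff.2 ?_)
          have := hφ.nonneg |r| (abs_nonneg r)
          have := mul_nonneg hp.le this
          linarith
      refine ne_top_of_le_ne_top ?_ (setLIntegral_mono' measurableSet_Ioc h2)
      rw [setLIntegral_const, Real.volume_Ioc]
      finiteness
    · refine ne_top_of_le_ne_top h1 ?_
      refine (setLIntegral_mono' measurableSet_Ioi fun r hr => ?_).trans
        (lintegral_mono_set (Set.Ioi_subset_Ioi zero_le_one))
      have hr1 : (1 : ℝ) < r := hr
      rw [powMean_pow 0 (by linarith), powMean_pow 1 (by linarith)]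
      gcongr
      · exact hr1.le
      · norm_num
  · exact h n hn

theorem fockIntegral_pow_ne_zero (hφ : HasQuadraticGrowth φ) (hp : 0 < p) (n : ℕ) :
    fockIntegral φ p (fun z => z ^ n) ≠ 0 := by
  have hm := (hφ.measurable_radialWeight p).comp measurable_norm (α := ℂ)
  have hm2 : Measurable fun z : ℂ => ‖z ^ n‖ₑ ^ p * radialWeight φ p ‖z‖ :=
    (measurable_enorm_rpow (differentiable_pow n) p).mul hm
  rw [fockIntegral, Ne, lintegral_eq_zero_iff hm2]
  intro h
  have h1 : ∀ᵐ z : ℂ, z = 0 := by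
    filter_upwards [h] with z hz
    by_contra hz0
    rw [rpow_mul_radialWeight hp, Pi.zero_apply, ENNReal.ofReal_eq_zero] at hz
    have : 0 < ‖z‖ := norm_pos_iff.2 hz0
    exact absurd hz (not_le.2 (by positivity))
  have h2 : volume ({0}ᶜ : Set ℂ) = 0 := h1
  have h3 := measure_add_measure_compl (μ := volume) (measurableSet_singleton (0 : ℂ))
  rw [h2, measure_singleton, add_zero] at h3
  have h4 : volume (Metric.ball (0 : ℂ) 1) ≤ 0 := h3 ▸ measure_mono (Set.subset_univ _)
  exact (Metric.measure_ball_pos volume (0 : ℂ) one_pos).not_ge h4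

theorem fockNorm_pow_pos (hφ : HasQuadraticGrowth φ) (hp : 0 < p) (n : ℕ) :
    0 < fockNorm φ p (fun z => z ^ n) := by
  rcases (fockNorm_nonneg (φ := φ) (p := p) fun z => z ^ n).eq_or_lt with h | h
  · have h1 := fockNorm_rpow hφ hp fun z => z ^ n
    rw [← h, Real.zero_rpow hp.ne', eq_comm, ENNReal.toReal_eq_zero_iff] at h1
    exact absurd h1 (not_or.2 ⟨fockIntegral_pow_ne_zero hφ hp n, fockIntegral_pow_ne_top hφ hp n⟩)
  · exact h

/-- The norm of `z ^ n` is comparable to the maximum of `r ^ n e^{-φ(r)}`, up to factors which are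
polynomial in `n`. The maximum does not depend on `p`. -/
theorem fockNorm_pow_bounds (hφ : HasQuadraticGrowth φ) (hp : 0 < p) :
    ∃ C : ℝ, 0 < C ∧ ∃ A : ℕ, ∀ n : ℕ, 1 ≤ n → ∀ ρ, IsPeak φ n ρ →
      fockNorm φ p (fun z => z ^ n) ≤ C * (n : ℝ) ^ A * (ρ ^ n * Real.exp (-φ ρ)) ∧
      ρ ^ n * Real.exp (-φ ρ) ≤ C * (n : ℝ) ^ A * fockNorm φ p (fun z => z ^ n) := by
  obtain ⟨C₁, hC₁, A₁, h₁⟩ := fockIntegral_pow_le hφ hp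
  obtain ⟨c, hc, h₂⟩ := le_fockIntegral_pow hφ hp
  obtain ⟨D₁, hD₁, B₁, hB₁⟩ := exists_le_of_rpow_le hp hC₁ A₁
  obtain ⟨D₂, hD₂, B₂, hB₂⟩ := exists_le_of_rpow_le hp (C := 1 / c) (by positivity) 1
  refine ⟨max D₁ D₂, lt_max_of_lt_left hD₁, max B₁ B₂, fun n hn ρ hρ => ?_⟩
  have hn1 : (1 : ℝ) ≤ n := by exact_mod_cast hn
  have hρ0 := hρ.pos
  have hN := fockNorm_nonneg (φ := φ) (p := p) fun z => z ^ n
  have hP : 0 ≤ ρ ^ n * Real.exp (-φ ρ) := by positivity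
  constructor
  · refine (hB₁ n _ _ hn hN hP ?_).trans ?_
    · rw [fockNorm_rpow hφ hp]
      exact ENNReal.toReal_le_of_le_ofReal (by positivity) (h₁ n hn ρ hρ)
    · gcongr
      · exact le_max_left _ _
      · exact le_max_left _ _
  · refine (hB₂ n _ _ hn hP hN ?_).trans ?_
    · rw [fockNorm_rpow hφ hp]
      have h := (ENNReal.ofReal_le_iff_le_toReal (fockIntegral_pow_ne_top hφ hp n)).1 (h₂ n hn ρ hρ)
      rw [div_mul_eq_mul_div, div_le_iff₀ (by positivity)] at h
      rw [pow_one, one_div, mul_assoc, ← div_eq_inv_mul, le_div_iff₀ hc]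
      linarith
    · gcongr
      · exact le_max_right _ _
      · exact le_max_right _ _

theorem norm_coeff_mul_fockNorm_le (hφ : HasQuadraticGrowth φ) (hp : 0 < p) :
    ∃ C : ℝ, 0 < C ∧ ∃ A : ℕ, ∀ n : ℕ, 1 ≤ n → ∀ f ∈ fockSpace φ p,
      ‖iteratedDeriv n f 0 / n.factorial‖ * fockNorm φ p (fun z => z ^ n) ≤
        C * (n : ℝ) ^ A * fockNorm φ p f := by
  obtain ⟨D, hD, B, hB⟩ := exists_le_of_rpow_le hp (C := 3 ^ p * 9) (by positivity) 2
  refine ⟨D, hD, B, fun n hn f hf => ?_⟩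
  have hn1 : (1 : ℝ) ≤ n := by exact_mod_cast hn
  rw [mem_fockSpace_iff hφ hp] at hf
  have hN := fockNorm_nonneg (φ := φ) (p := p) fun z => z ^ n
  refine hB n _ _ hn (by positivity) (fockNorm_nonneg f) ?_
  have h := enorm_coeff_rpow_mul_fockIntegral_le hφ hf.1 hp n
  have h1 := ENNReal.toReal_mono (ENNReal.mul_ne_top ENNReal.ofReal_ne_top hf.2) h
  rw [ENNReal.toReal_mul, ENNReal.toReal_mul, enorm_rpow_eq_ofReal hp,
    ENNReal.toReal_ofReal (by positivity), ENNReal.toReal_ofReal (by positivity),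
    ← fockNorm_rpow hφ hp, ← fockNorm_rpow hφ hp, ← Real.mul_rpow (by positivity) hN] at h1
  refine h1.trans ?_
  have := fockNorm_nonneg (φ := φ) (p := p) f
  have h2 : ((n : ℝ) + 2) ^ 2 ≤ 9 * (n : ℝ) ^ 2 := by nlinarith
  calc 3 ^ p * ((n : ℝ) + 2) ^ 2 * fockNorm φ p f ^ p
      ≤ 3 ^ p * (9 * (n : ℝ) ^ 2) * fockNorm φ p f ^ p := by gcongr
    _ = _ := by ring

end Moments

/-! ### The Volterra operator -/

section Volterra

variable {φ : ℝ → ℝ} {p : ℝ} {f g : ℂ → ℂ}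

theorem volterra_zero (f : ℂ → ℂ) : volterra f 0 = 0 := by simp [volterra]

theorem volterra_eq_sub (hf : Differentiable ℂ f) (hg : ∀ z, HasDerivAt g (f z) z) :
    volterra f = fun z => g z - g 0 := by
  ext w
  have h1 : ∀ t ∈ Set.uIcc (0 : ℝ) 1,
      HasDerivAt (fun t : ℝ => g (t * w)) (f (t * w) * w) t := by
    intro t _
    have h2 : HasDerivAt (fun t : ℝ => (t : ℂ) * w) w t := by
      simpa using (Complex.ofRealCLM.hasDerivAt (x := t)).mul_const w
    exact (hg _).comp_of_eq t h2 rfl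
  have h3 := intervalIntegral.integral_eq_sub_of_hasDerivAt h1 (by
    refine Continuous.intervalIntegrable ?_ _ _
    exact (hf.continuous.comp (by fun_prop)).mul continuous_const)
  simpa [volterra] using h3

theorem hasDerivAt_volterra (hf : Differentiable ℂ f) (z : ℂ) :
    HasDerivAt (volterra f) (f z) z := by
  obtain ⟨G, hG⟩ := hf.isExactOn_univ
  rw [volterra_eq_sub hf fun z => hG z trivial]
  exact (hG z trivial).sub_const _

theorem differentiable_volterra (hf : Differentiable ℂ f) : Differentiable ℂ (volterra f) :=
  fun z => (hasDerivAt_volterra hf z).differentiableAt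

theorem iteratedDeriv_succ_volterra (hf : Differentiable ℂ f) (k : ℕ) :
    iteratedDeriv (k + 1) (volterra f) 0 = iteratedDeriv k f 0 := by
  rw [iteratedDeriv_succ', show deriv (volterra f) = f from
    funext fun z => (hasDerivAt_volterra hf z).deriv]

/-- The increment of a primitive of `f` over a radial segment of length `δ`, bounded by the integral
of `|f| ^ p` over a disc. The mean value inequality bounds it by a value of `f` on the segment, to
which the sub-mean value inequality applies. -/
theorem ofReal_mul_enorm_sub_rpow_le (hf : Differentiable ℂ f) (hg : ∀ z, HasDerivAt g (f z) z)
    (hp : 0 < p) {a δ : ℝ} (hδ : 0 < δ) {ζ : ℂ} (hζ : ‖ζ‖ = 1) :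
    ENNReal.ofReal (Real.pi * δ ^ 2) * ‖g ((a + δ : ℝ) * ζ) - g (a * ζ)‖ₑ ^ p ≤
      ENNReal.ofReal δ ^ p * ∫⁻ w in Metric.ball (a : ℂ) (2 * δ), ‖f (w * ζ)‖ₑ ^ p := by
  have hh : Differentiable ℂ fun w => f (w * ζ) := hf.comp (differentiable_id.mul_const _)
  have hc : Continuous fun x : ℝ => ‖f (x * ζ)‖ := by
    have := hf.continuous
    fun_prop
  obtain ⟨x, hx, hmax⟩ := (isCompact_Icc (a := a) (b := a + δ)).exists_isMaxOn
    (Set.nonempty_Icc.2 (by linarith)) hc.continuousOn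
  have hmv : ‖g ((a + δ : ℝ) * ζ) - g (a * ζ)‖ ≤ ‖f (x * ζ)‖ * ((a + δ) - a) := by
    refine norm_image_sub_le_of_norm_deriv_le_segment' (f := fun t : ℝ => g (t * ζ))
      (f' := fun t : ℝ => f (t * ζ) * ζ) (fun t _ => ?_) (fun t ht => ?_) (a + δ)
      ⟨by linarith, le_rfl⟩
    · have h2 : HasDerivAt (fun t : ℝ => (t : ℂ) * ζ) ζ t := by
        simpa using (Complex.ofRealCLM.hasDerivAt (x := t)).mul_const ζ
      exact ((hg _).comp_of_eq t h2 rfl).hasDerivWithinAt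
    · rw [norm_mul, hζ, mul_one]
      exact hmax (Set.Ico_subset_Icc_self ht)
  have h1 : ‖g ((a + δ : ℝ) * ζ) - g (a * ζ)‖ₑ ≤ ENNReal.ofReal δ * ‖f (x * ζ)‖ₑ := by
    rw [← ofReal_norm, ← ofReal_norm, ← ENNReal.ofReal_mul hδ.le]
    refine ENNReal.ofReal_le_ofReal (hmv.trans (le_of_eq ?_))
    ring
  have h2 := mul_enorm_rpow_le_lintegral_ball hh hp (x : ℂ) hδ
  have h3 : Metric.ball (x : ℂ) δ ⊆ Metric.ball (a : ℂ) (2 * δ) := by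
    refine Metric.ball_subset_ball' ?_
    rw [Complex.dist_eq, ← Complex.ofReal_sub, Complex.norm_real, Real.norm_eq_abs, abs_of_nonneg]
      <;> linarith [hx.1, hx.2]
  calc ENNReal.ofReal (Real.pi * δ ^ 2) * ‖g ((a + δ : ℝ) * ζ) - g (a * ζ)‖ₑ ^ p
      ≤ ENNReal.ofReal (Real.pi * δ ^ 2) * (ENNReal.ofReal δ * ‖f (x * ζ)‖ₑ) ^ p := by gcongr
    _ = ENNReal.ofReal δ ^ p * (ENNReal.ofReal (Real.pi * δ ^ 2) * ‖f (x * ζ)‖ₑ ^ p) := by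
        rw [ENNReal.mul_rpow_of_nonneg _ _ hp.le]
        ring
    _ ≤ _ := by
        gcongr
        exact h2.trans (lintegral_mono_set h3)

/-- The increments of a primitive of `f` between the circles of radii `a` and `a + δ`, in the mean
over the circle. -/
theorem lintegral_enorm_sub_rpow_le (hf : Differentiable ℂ f) (hg : ∀ z, HasDerivAt g (f z) z)
    (hp : 0 < p) {a δ : ℝ} (ha : 0 ≤ a) (hδ : 0 < δ) :
    ∫⁻ θ in Set.Ioc (-Real.pi) Real.pi, ‖g ((a + δ : ℝ) * Complex.exp ((θ : ℝ) * Complex.I)) -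
        g (a * Complex.exp ((θ : ℝ) * Complex.I))‖ₑ ^ p ≤
      4 * ENNReal.ofReal δ ^ p * powMean f p (a + 2 * δ) := by
  have hpi := Real.pi_pos
  have hc0 : ENNReal.ofReal (Real.pi * δ ^ 2) ≠ 0 := by
    rw [Ne, ENNReal.ofReal_eq_zero, not_le]
    positivity
  refine (ENNReal.mul_le_mul_iff_right hc0 ENNReal.ofReal_ne_top).1 ?_
  rw [← lintegral_const_mul' _ _ ENNReal.ofReal_ne_top]
  calc _ ≤ ∫⁻ θ in Set.Ioc (-Real.pi) Real.pi, ENNReal.ofReal δ ^ p *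
        ∫⁻ w in Metric.ball (a : ℂ) (2 * δ), ‖f (w * Complex.exp ((θ : ℝ) * Complex.I))‖ₑ ^ p :=
        lintegral_mono fun θ => ofReal_mul_enorm_sub_rpow_le hf hg hp hδ
          (Complex.norm_exp_ofReal_mul_I θ)
    _ = ENNReal.ofReal δ ^ p * ∫⁻ θ in Set.Ioc (-Real.pi) Real.pi,
        ∫⁻ w in Metric.ball (a : ℂ) (2 * δ), ‖f (w * Complex.exp ((θ : ℝ) * Complex.I))‖ₑ ^ p :=
        lintegral_const_mul' _ _ (ENNReal.rpow_ne_top_of_nonneg hp.le ENNReal.ofReal_ne_top)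
    _ ≤ ENNReal.ofReal δ ^ p * (ENNReal.ofReal (Real.pi * (2 * δ) ^ 2) *
        powMean f p (a + 2 * δ)) := by
        gcongr
        exact lintegral_lintegral_ball_rotate_le hf hp ha (by positivity)
    _ = _ := by
        have : ENNReal.ofReal (Real.pi * (2 * δ) ^ 2) = 4 * ENNReal.ofReal (Real.pi * δ ^ 2) := by
          rw [show Real.pi * (2 * δ) ^ 2 = 4 * (Real.pi * δ ^ 2) by ring,
            ENNReal.ofReal_mul (by norm_num)]
          norm_num
        rw [this]
        ring

/-- The means of a primitive `g` of `f` over the circles of radii `r - 1` and `r`. The segment from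
`r - 1` to `r` is cut at the points `r - 2 ^ (-i)`: the discs used to bound `g' = f` on the `i`-th
piece then stay inside the circle of radius `r`, and the bounds sum up geometrically. -/
theorem exists_powMean_primitive_le (hp : 0 < p) :
    ∃ C : ENNReal, C ≠ ⊤ ∧ ∀ f g : ℂ → ℂ, Differentiable ℂ f → (∀ z, HasDerivAt g (f z) z) →
      ∀ r : ℝ, 1 ≤ r → powMean g p r ≤ 2 ^ p * (powMean g p (r - 1) + C * powMean f p r) := by
  set q : ENNReal := ENNReal.ofReal (3 / 4) ^ p with hq
  have hq1 : q < 1 := by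
    refine ENNReal.rpow_lt_one ?_ hp
    rw [ENNReal.ofReal_lt_one]
    norm_num
  -- the `i`-th increment is of size `2 ^ (-i)`, so the weights `(3 / 2) ^ i` may be inserted into
  -- the sum at the cost of the convergent series of their inverses
  set l : ℕ → ENNReal := fun i => ENNReal.ofReal ((3 / 2) ^ i) with hl
  set Λ : ENNReal := ∑' i, (l i)⁻¹ with hΛ
  have hΛt : Λ ≠ ⊤ := by
    have h1 : ∀ i, (l i)⁻¹ = ENNReal.ofReal (2 / 3) ^ i := by
      intro i
      rw [hl, ← ENNReal.ofReal_inv_of_pos (by positivity), ← ENNReal.ofReal_pow (by norm_num),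
        ← inv_pow]
      norm_num
    rw [hΛ]
    simp only [h1]
    rw [ENNReal.tsum_geometric, Ne, ENNReal.inv_eq_top, tsub_eq_zero_iff_le, not_le,
      ENNReal.ofReal_lt_one]
    norm_num
  refine ⟨Λ ^ p * (4 * (1 - q)⁻¹), ?_, fun f g hf hg r hr => ?_⟩
  · refine ENNReal.mul_ne_top (ENNReal.rpow_ne_top_of_nonneg hp.le hΛt)
      (ENNReal.mul_ne_top (by norm_num) ?_)
    rw [Ne, ENNReal.inv_eq_top, tsub_eq_zero_iff_le, not_le]
    exact hq1
  have hgd : Differentiable ℂ g := fun z => (hg z).differentiableAt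
  set a : ℕ → ℝ := fun i => r - (1 / 2) ^ i with ha
  set δ : ℕ → ℝ := fun i => (1 / 2) ^ (i + 1) with hδ
  have hδ0 : ∀ i, 0 < δ i := fun i => by simp only [hδ]; positivity
  have haδ : ∀ i, a i + δ i = a (i + 1) := fun i => by simp only [ha, hδ]; ring
  have haδ2 : ∀ i, a i + 2 * δ i = r := fun i => by simp only [ha, hδ]; ring
  have ha0 : ∀ i, 0 ≤ a i := fun i => by
    have : ((1 : ℝ) / 2) ^ i ≤ 1 := pow_le_one₀ (by norm_num) (by norm_num)
    simp only [ha]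
    linarith
  have halim : Tendsto a atTop (𝓝 r) := by
    have := tendsto_pow_atTop_nhds_zero_of_lt_one (r := (1 : ℝ) / 2) (by norm_num) (by norm_num)
    simpa [ha] using this.const_sub r
  set e : ℝ → ℂ := fun θ => Complex.exp (θ * Complex.I) with he
  set x : ℕ → ℝ → ENNReal := fun i θ => ‖g (a (i + 1) * e θ) - g (a i * e θ)‖ₑ with hx
  have hgc := hgd.continuous
  have hxm : ∀ i, Measurable (x i) := fun i => by
    refine Continuous.measurable ?_
    simp only [hx]
    fun_prop
  have hpt : ∀ θ, ‖g (r * e θ)‖ₑ ≤ ‖g ((r - 1 : ℝ) * e θ)‖ₑ + ∑' i, x i θ := by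
    intro θ
    have h1 : ∀ n : ℕ, ‖g (a n * e θ)‖ₑ ≤ ‖g ((r - 1 : ℝ) * e θ)‖ₑ + ∑' i, x i θ := by
      intro n
      have h2 : g (a n * e θ) = g ((r - 1 : ℝ) * e θ) +
          ∑ i ∈ Finset.range n, (g (a (i + 1) * e θ) - g (a i * e θ)) := by
        rw [Finset.sum_range_sub (fun i => g (a i * e θ))]
        simp [ha]
      rw [h2]
      refine (enorm_add_le _ _).trans ?_
      gcongr
      exact (enorm_sum_le _ _).trans (ENNReal.sum_le_tsum _)
    have h3 : Tendsto (fun n => ‖g (a n * e θ)‖ₑ) atTop (𝓝 ‖g (r * e θ)‖ₑ) := by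
      have h4 : Continuous fun t : ℝ => ‖g (t * e θ)‖ₑ := by fun_prop
      exact (h4.tendsto r).comp halim
    exact le_of_tendsto' h3 h1
  have hcm : ∀ t : ℝ, powMean g p t =
      ∫⁻ θ in Set.Ioc (-Real.pi) Real.pi, ‖g (t * e θ)‖ₑ ^ p := by
    intro t
    simp [powMean, circleMap, he]
  have hterm : ∀ i, ∫⁻ θ in Set.Ioc (-Real.pi) Real.pi, l i ^ p * x i θ ^ p ≤
      4 * q ^ i * powMean f p r := by
    intro i
    rw [lintegral_const_mul _ ((hxm i).pow_const p)]
    have h1 := lintegral_enorm_sub_rpow_le hf hg hp (ha0 i) (hδ0 i)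
    rw [haδ2, haδ] at h1
    have h2 : l i * ENNReal.ofReal (δ i) ≤ ENNReal.ofReal (3 / 4) ^ i := by
      rw [hl, ← ENNReal.ofReal_mul (by positivity), ← ENNReal.ofReal_pow (by norm_num)]
      refine ENNReal.ofReal_le_ofReal ?_
      simp only [hδ]
      rw [pow_succ, ← mul_assoc, ← mul_pow]
      norm_num
    calc l i ^ p * ∫⁻ θ in Set.Ioc (-Real.pi) Real.pi, x i θ ^ p
        ≤ l i ^ p * (4 * ENNReal.ofReal (δ i) ^ p * powMean f p r) := by gcongr
      _ = 4 * (l i * ENNReal.ofReal (δ i)) ^ p * powMean f p r := by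
          rw [ENNReal.mul_rpow_of_nonneg _ _ hp.le]
          ring
      _ ≤ 4 * (ENNReal.ofReal (3 / 4) ^ i) ^ p * powMean f p r := by gcongr
      _ = _ := by
          rw [hq, ← ENNReal.rpow_natCast, ← ENNReal.rpow_natCast, ← ENNReal.rpow_mul,
            ← ENNReal.rpow_mul, mul_comm p]
  have hΛp : Λ ^ p ≠ ⊤ := ENNReal.rpow_ne_top_of_nonneg hp.le hΛt
  have h2p : (2 : ENNReal) ^ p ≠ ⊤ := ENNReal.rpow_ne_top_of_nonneg hp.le (by norm_num)
  have hgm : Measurable fun θ => ‖g ((r - 1 : ℝ) * e θ)‖ₑ ^ p := by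
    refine Measurable.pow_const (Continuous.measurable ?_) p
    fun_prop
  calc powMean g p r = ∫⁻ θ in Set.Ioc (-Real.pi) Real.pi, ‖g (r * e θ)‖ₑ ^ p := hcm r
    _ ≤ ∫⁻ θ in Set.Ioc (-Real.pi) Real.pi, 2 ^ p * (‖g ((r - 1 : ℝ) * e θ)‖ₑ ^ p +
          Λ ^ p * ∑' i, l i ^ p * x i θ ^ p) := by
        refine lintegral_mono fun θ => ?_
        refine (ENNReal.rpow_le_rpow (hpt θ) hp.le).trans
          ((ENNReal.add_rpow_le_two_rpow_mul hp _ _).trans ?_)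
        gcongr
        refine ENNReal.tsum_rpow_le hp _ l (fun i => ?_) (fun i => ENNReal.ofReal_ne_top)
        rw [Ne, ENNReal.ofReal_eq_zero, not_le]
        positivity
    _ = 2 ^ p * (powMean g p (r - 1) + Λ ^ p *
          ∑' i, ∫⁻ θ in Set.Ioc (-Real.pi) Real.pi, l i ^ p * x i θ ^ p) := by
        rw [lintegral_const_mul' _ _ h2p, lintegral_add_left hgm, lintegral_const_mul' _ _ hΛp,
          lintegral_tsum fun i => (((hxm i).pow_const p).const_mul _).aemeasurable, hcm]
    _ ≤ 2 ^ p * (powMean g p (r - 1) + Λ ^ p * ∑' i, 4 * q ^ i * powMean f p r) := by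
        gcongr with i
        exact hterm i
    _ = _ := by
        rw [ENNReal.tsum_mul_right, ENNReal.tsum_mul_left, ENNReal.tsum_geometric]
        ring

/-- The weight `r e^{-p φ(r)}` eventually decays by any given factor over an interval of length one,
because `φ r - φ (r - 1)` tends to infinity. -/
theorem HasQuadraticGrowth.eventually_weight_le (hφ : HasQuadraticGrowth φ) (hp : 0 < p) {q : ℝ}
    (hq : 0 < q) :
    ∀ᶠ r in atTop, ENNReal.ofReal r * radialWeight φ p r ≤
      ENNReal.ofReal q * (ENNReal.ofReal (r - 1) * radialWeight φ p (r - 1)) := by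
  obtain ⟨c, R, hc, hR, h⟩ := hφ.growth
  have hlim : Tendsto (fun r : ℝ => 2 * Real.exp (-(p * c * r))) atTop (𝓝 0) := by
    have : Tendsto (fun r : ℝ => p * c * r) atTop atTop := tendsto_id.const_mul_atTop (by positivity)
    simpa using (Real.tendsto_exp_neg_atTop_nhds_zero.comp this).const_mul 2
  filter_upwards [eventually_ge_atTop (R + 1), eventually_ge_atTop 2,
    hlim.eventually (gt_mem_nhds hq)] with r h1 h2 h3
  rw [radialWeight, radialWeight, abs_of_pos (by linarith), abs_of_pos (by linarith),
    ← ENNReal.ofReal_mul (by linarith), ← ENNReal.ofReal_mul (by linarith),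
    ← ENNReal.ofReal_mul hq.le]
  refine ENNReal.ofReal_le_ofReal ?_
  have h4 := h (r - 1) r (by linarith) (by linarith)
  have h5 : c * r ≤ φ r - φ (r - 1) := by nlinarith
  have h6 : Real.exp (-(p * φ r)) ≤ Real.exp (-(p * c * r)) * Real.exp (-(p * φ (r - 1))) := by
    rw [← Real.exp_add]
    refine Real.exp_le_exp.2 ?_
    nlinarith
  calc r * Real.exp (-(p * φ r))
      ≤ (2 * (r - 1)) * (Real.exp (-(p * c * r)) * Real.exp (-(p * φ (r - 1)))) := by
        gcongr <;> linarith
    _ = 2 * Real.exp (-(p * c * r)) * ((r - 1) * Real.exp (-(p * φ (r - 1)))) := by ring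
    _ ≤ _ := by
        have : 0 ≤ (r - 1) * Real.exp (-(p * φ (r - 1))) :=
          mul_nonneg (by linarith) (Real.exp_pos _).le
        gcongr

theorem setLIntegral_Ioc_radial_ne_top (hφ : HasQuadraticGrowth φ) (hp : 0 < p)
    (hg : Differentiable ℂ g) {a b : ℝ} (ha : 0 ≤ a) :
    ∫⁻ r in Set.Ioc a b, ENNReal.ofReal r * radialWeight φ p r * powMean g p r ≠ ⊤ := by
  rcases le_or_gt b a with hb | hb
  · simp [Set.Ioc_eq_empty (not_lt.2 hb)]
  have h : ∀ r ∈ Set.Ioc a b, ENNReal.ofReal r * radialWeight φ p r * powMean g p r ≤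
      ENNReal.ofReal b * 1 * powMean g p b := by
    intro r hr
    have hr0 : 0 ≤ r := ha.trans hr.1.le
    refine mul_le_mul' (mul_le_mul' (ENNReal.ofReal_le_ofReal hr.2) ?_) (powMean_mono hg hp hr0 hr.2)
    rw [radialWeight, ← ENNReal.ofReal_one]
    refine ENNReal.ofReal_le_ofReal (Real.exp_le_one_iff.2 ?_)
    have := mul_nonneg hp.le (hφ.nonneg |r| (abs_nonneg r))
    linarith
  refine ne_top_of_le_ne_top ?_ (setLIntegral_mono' measurableSet_Ioc h)
  rw [setLIntegral_const, Real.volume_Ioc]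
  have := powMean_ne_top hg hp (ha.trans hb.le)
  finiteness

/-- A primitive of a function of the space belongs to the space. As `r e^{-p φ(r)}` is eventually
much smaller than its value at `r - 1`, the contribution of `powMean g p (r - 1)` can be absorbed
into the integral of `powMean g p r`. -/
theorem fockIntegral_primitive_ne_top (hφ : HasQuadraticGrowth φ) (hp : 0 < p)
    (hf : Differentiable ℂ f) (hg : ∀ z, HasDerivAt g (f z) z) (hN : fockIntegral φ p f ≠ ⊤) :
    fockIntegral φ p g ≠ ⊤ := by
  have hgd : Differentiable ℂ g := fun z => (hg z).differentiableAt
  obtain ⟨C, hC, hstep⟩ := exists_powMean_primitive_le hp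
  have h2p : (2 : ENNReal) ^ p ≠ ⊤ := ENNReal.rpow_ne_top_of_nonneg hp.le (by norm_num)
  set W : ℝ → ENNReal := fun r => ENNReal.ofReal r * radialWeight φ p r
  have hWm : Measurable W := (measurable_id.ennreal_ofReal).mul (hφ.measurable_radialWeight p)
  have hgm := measurable_powMean hgd p
  obtain ⟨r₁, hr₁⟩ := eventually_atTop.1
    (hφ.eventually_weight_le hp (q := 2⁻¹ * ((2 : ℝ) ^ p)⁻¹) (by positivity))
  set r₀ : ℝ := max r₁ 1
  have hr₀1 : 1 ≤ r₀ := le_max_right _ _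
  set F : ℝ → ENNReal := fun r => W r * powMean g p r with hF
  have hq : ∀ r, r₀ ≤ r → 2 ^ p * (W r * powMean g p (r - 1)) ≤ 2⁻¹ * F (r - 1) := by
    intro r hr
    have h1 : W r ≤ ENNReal.ofReal (2⁻¹ * ((2 : ℝ) ^ p)⁻¹) * W (r - 1) :=
      hr₁ r ((le_max_left _ _).trans hr)
    have h2 : (2 : ENNReal) ^ p * ENNReal.ofReal (2⁻¹ * ((2 : ℝ) ^ p)⁻¹) = 2⁻¹ := by
      have h3 : (2 : ENNReal) ^ p = ENNReal.ofReal ((2 : ℝ) ^ p) := by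
        rw [← ENNReal.ofReal_rpow_of_pos (by norm_num)]
        norm_num
      rw [h3, ← ENNReal.ofReal_mul (by positivity)]
      rw [show (2 : ℝ) ^ p * (2⁻¹ * ((2 : ℝ) ^ p)⁻¹) = 2⁻¹ by field_simp,
        ENNReal.ofReal_inv_of_pos (by norm_num)]
      norm_num
    calc 2 ^ p * (W r * powMean g p (r - 1))
        ≤ 2 ^ p * (ENNReal.ofReal (2⁻¹ * ((2 : ℝ) ^ p)⁻¹) * W (r - 1) * powMean g p (r - 1)) := by
          gcongr
      _ = (2 ^ p * ENNReal.ofReal (2⁻¹ * ((2 : ℝ) ^ p)⁻¹)) * F (r - 1) := by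
          simp only [hF]
          ring
      _ = _ := by rw [h2]
  set B : ENNReal := ∫⁻ r in Set.Ioc (r₀ - 1) r₀, F r
  have hBt : B ≠ ⊤ := setLIntegral_Ioc_radial_ne_top hφ hp hgd (by linarith)
  set K : ENNReal := 2 ^ p * (C * fockIntegral φ p f) with hK
  have hbound : ∀ n : ℕ, ∫⁻ r in Set.Ioc r₀ (r₀ + n), F r ≤ B + 2 * K := by
    intro n
    set I : ENNReal := ∫⁻ r in Set.Ioc r₀ (r₀ + n), F r
    have hIt : I ≠ ⊤ := setLIntegral_Ioc_radial_ne_top hφ hp hgd (by linarith)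
    have hshift : ∫⁻ r in Set.Ioc r₀ (r₀ + n), F (r - 1) =
        ∫⁻ r in Set.Ioc (r₀ - 1) (r₀ + n - 1), F r := by
      have h := (measurePreserving_sub_right volume (1 : ℝ)).setLIntegral_comp_preimage_emb
        (MeasurableEquiv.subRight (1 : ℝ)).measurableEmbedding F
        (Set.Ioc (r₀ - 1) (r₀ + n - 1))
      rw [← h]
      congr 2
      ext x
      simp
    have h1 : I ≤ 2⁻¹ * (B + I) + K := by
      calc I ≤ ∫⁻ r in Set.Ioc r₀ (r₀ + n),
              (2⁻¹ * F (r - 1) + 2 ^ p * (C * (W r * powMean f p r))) := by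
            refine setLIntegral_mono' measurableSet_Ioc fun r hr => ?_
            calc F r ≤ W r * (2 ^ p * (powMean g p (r - 1) + C * powMean f p r)) := by
                  simp only [hF]
                  gcongr
                  exact hstep f g hf hg r (hr₀1.trans hr.1.le)
              _ = 2 ^ p * (W r * powMean g p (r - 1)) + 2 ^ p * (C * (W r * powMean f p r)) := by
                  ring
              _ ≤ _ := add_le_add (hq r hr.1.le) le_rfl
        _ = 2⁻¹ * (∫⁻ r in Set.Ioc (r₀ - 1) (r₀ + n - 1), F r) +
            2 ^ p * (C * ∫⁻ r in Set.Ioc r₀ (r₀ + n), W r * powMean f p r) := by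
            rw [lintegral_add_left, lintegral_const_mul' _ _ (by norm_num), hshift,
              lintegral_const_mul' _ _ h2p, lintegral_const_mul' _ _ hC]
            refine Measurable.const_mul ?_ _
            exact (hWm.mul hgm).comp (measurable_id.sub_const 1)
        _ ≤ 2⁻¹ * (B + I) + K := by
            refine add_le_add (mul_le_mul' le_rfl ?_) ?_
            · refine (lintegral_mono_set (t := Set.Ioc (r₀ - 1) r₀ ∪ Set.Ioc r₀ (r₀ + n)) ?_).trans
                (lintegral_union_le _ _ _)
              intro x hx
              rcases le_or_gt x r₀ with h | h
              · exact Or.inl ⟨hx.1, h⟩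
              · exact Or.inr ⟨h, by linarith [hx.2]⟩
            · rw [hK, fockIntegral_eq_radial hφ hf]
              gcongr
              exact fun x hx => lt_of_lt_of_le (by linarith) hx.1.le
    -- `I` is finite, so half of it can be absorbed on the left
    have h2 : I + I ≤ B + 2 * K + I := by
      calc I + I = 2 * I := (two_mul I).symm
        _ ≤ 2 * (2⁻¹ * (B + I) + K) := by gcongr
        _ = 2 * 2⁻¹ * (B + I) + 2 * K := by ring
        _ = B + 2 * K + I := by
            rw [ENNReal.mul_inv_cancel (by norm_num) (by norm_num)]
            ring
    exact (ENNReal.add_le_add_iff_right hIt).1 h2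
  have htail : ∫⁻ r in Set.Ioi r₀, F r ≤ B + 2 * K := by
    have hU : Set.Ioi r₀ = ⋃ n : ℕ, Set.Ioc r₀ (r₀ + n) := by
      ext x
      simp only [Set.mem_Ioi, Set.mem_iUnion, Set.mem_Ioc]
      refine ⟨fun h => ?_, fun ⟨n, h, _⟩ => h⟩
      obtain ⟨n, hn⟩ := exists_nat_ge (x - r₀)
      exact ⟨n, h, by linarith⟩
    rw [hU, setLIntegral_iUnion_of_directed]
    · exact iSup_le hbound
    · refine Monotone.directed_le fun m n hmn => Set.Ioc_subset_Ioc_right ?_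
      have : (m : ℝ) ≤ n := by exact_mod_cast hmn
      linarith
  rw [fockIntegral_eq_radial hφ hgd, ← Set.Ioc_union_Ioi_eq_Ioi (show (0 : ℝ) ≤ r₀ by linarith)]
  refine ne_top_of_le_ne_top ?_ (lintegral_union_le _ _ _)
  refine ENNReal.add_ne_top.2 ⟨setLIntegral_Ioc_radial_ne_top hφ hp hgd le_rfl, ?_⟩
  exact ne_top_of_le_ne_top (by finiteness) htail

theorem volterra_mem_fockSpace (hφ : HasQuadraticGrowth φ) (hp : 0 < p) (hf : f ∈ fockSpace φ p) :
    volterra f ∈ fockSpace φ p := by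
  rw [mem_fockSpace_iff hφ hp] at hf ⊢
  exact ⟨differentiable_volterra hf.1,
    fockIntegral_primitive_ne_top hφ hp hf.1 (hasDerivAt_volterra hf.1) hf.2⟩

end Volterra

/-! ### Density of the polynomials -/

section Density

variable {φ : ℝ → ℝ} {p : ℝ} {f : ℂ → ℂ}

theorem powMean_dilate (f : ℂ → ℂ) (p t r : ℝ) :
    powMean (fun z => f (t * z)) p r = powMean f p (t * r) := by
  simp only [powMean, circleMap, zero_add]
  refine lintegral_congr fun θ => ?_
  push_cast
  rw [mul_assoc]

theorem powMean_sub_le {g : ℂ → ℂ} (hf : Differentiable ℂ f) (hp : 0 < p) (r : ℝ) :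
    powMean (fun z => f z - g z) p r ≤ 2 ^ p * (powMean f p r + powMean g p r) := by
  have h2p : (2 : ENNReal) ^ p ≠ ⊤ := ENNReal.rpow_ne_top_of_nonneg hp.le (by norm_num)
  rw [powMean, powMean, powMean, ← lintegral_add_left, ← lintegral_const_mul' _ _ h2p]
  · refine lintegral_mono fun θ => ?_
    exact (ENNReal.rpow_le_rpow (enorm_sub_le) hp.le).trans
      (ENNReal.add_rpow_le_two_rpow_mul hp _ _)
  · exact (measurable_enorm_rpow hf p).comp (continuous_circleMap 0 r).measurable

theorem tendsto_powMean_dilate_sub (hf : Differentiable ℂ f) (hp : 0 < p) {r : ℝ} (hr : 0 ≤ r)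
    {t : ℕ → ℝ} (ht : Tendsto t atTop (𝓝 1)) :
    Tendsto (fun n => powMean (fun z => f (t n * z) - f z) p r) atTop (𝓝 0) := by
  have h : ∀ n, powMean (fun z => f (t n * z) - f z) p r = ENNReal.ofReal (2 * Real.pi *
      Real.circleAverage (fun z => ‖f (t n * z) - f z‖ ^ p) 0 r) := fun n =>
    powMean_eq_ofReal ((hf.comp (differentiable_id.const_mul _)).sub hf) hp hr
  have hfc := hf.continuous
  have hc : Continuous fun s : ℝ => Real.circleAverage (fun z => ‖f (s * z) - f z‖ ^ p) 0 r := by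
    refine (intervalIntegral.continuous_parametric_intervalIntegral_of_continuous' ?_ _ _).const_smul
      ((2 * Real.pi)⁻¹ : ℝ)
    refine Continuous.rpow_const ?_ fun _ => Or.inr hp.le
    fun_prop
  have h1 := (hc.tendsto 1).comp ht
  have h0 : Real.circleAverage (fun z => ‖f ((1 : ℝ) * z) - f z‖ ^ p) 0 r = 0 := by
    simp [Real.zero_rpow hp.ne', Real.circleAverage_const]
  rw [h0] at h1
  simp only [h]
  have h2 := ENNReal.tendsto_ofReal (h1.const_mul (2 * Real.pi))
  simpa using h2

/-- The dilates `f (t z)` of a function of the space converge to it as `t → 1`. The integral means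
of the dilates are dominated by those of `f`, because circle means increase with the radius. -/
theorem tendsto_fockIntegral_dilate_sub (hφ : HasQuadraticGrowth φ) (hp : 0 < p)
    (hf : Differentiable ℂ f) (hN : fockIntegral φ p f ≠ ⊤) {t : ℕ → ℝ} (ht : Tendsto t atTop (𝓝 1))
    (ht0 : ∀ n, 0 ≤ t n) (ht1 : ∀ n, t n ≤ 1) :
    Tendsto (fun n => fockIntegral φ p (fun z => f (t n * z) - f z)) atTop (𝓝 0) := by
  have hd : ∀ n, Differentiable ℂ fun z => f (t n * z) := fun n =>
    hf.comp (differentiable_id.const_mul _)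
  have hWm : Measurable fun r => ENNReal.ofReal r * radialWeight φ p r :=
    (measurable_id.ennreal_ofReal).mul (hφ.measurable_radialWeight p)
  have hrad : ∀ n, fockIntegral φ p (fun z => f (t n * z) - f z) =
      ∫⁻ r in Set.Ioi 0, ENNReal.ofReal r * radialWeight φ p r *
        powMean (fun z => f (t n * z) - f z) p r :=
    fun n => fockIntegral_eq_radial hφ ((hd n).sub hf)
  simp only [hrad]
  rw [show (0 : ENNReal) = ∫⁻ r in Set.Ioi (0 : ℝ), 0 by simp]
  refine tendsto_lintegral_of_dominated_convergence
    (fun r => 2 ^ p * 2 * (ENNReal.ofReal r * radialWeight φ p r * powMean f p r))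
    (fun n => hWm.mul (measurable_powMean ((hd n).sub hf) p)) (fun n => ?_) ?_ ?_
  · filter_upwards [ae_restrict_mem measurableSet_Ioi] with r hr
    have hr0 : (0 : ℝ) < r := hr
    have h1 := powMean_sub_le (g := f) (hd n) hp r
    rw [powMean_dilate] at h1
    have h2 : powMean f p (t n * r) ≤ powMean f p r :=
      powMean_mono hf hp (mul_nonneg (ht0 n) hr0.le) (mul_le_of_le_one_left hr0.le (ht1 n))
    calc ENNReal.ofReal r * radialWeight φ p r * powMean (fun z => f (t n * z) - f z) p r
        ≤ ENNReal.ofReal r * radialWeight φ p r * (2 ^ p * (powMean f p r + powMean f p r)) := by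
          gcongr
          exact h1.trans (by gcongr)
      _ = _ := by ring
  · rw [lintegral_const_mul' _ _ (by finiteness), ← fockIntegral_eq_radial hφ hf]
    finiteness
  · filter_upwards [ae_restrict_mem measurableSet_Ioi] with r hr
    have h1 := tendsto_powMean_dilate_sub hf hp (le_of_lt hr) ht
    have h2 := ENNReal.Tendsto.const_mul h1 (a := ENNReal.ofReal r * radialWeight φ p r)
      (Or.inr (ENNReal.mul_ne_top ENNReal.ofReal_ne_top (radialWeight_ne_top r)))
    simpa using h2

theorem pow_mem_fockSpace (hφ : HasQuadraticGrowth φ) (hp : 0 < p) (n : ℕ) :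
    (fun z : ℂ => z ^ n) ∈ fockSpace φ p :=
  (mem_fockSpace_iff hφ hp).2 ⟨differentiable_pow n, fockIntegral_pow_ne_top hφ hp n⟩

theorem hasSum_taylor (hf : Differentiable ℂ f) (z : ℂ) :
    HasSum (fun n : ℕ => iteratedDeriv n f 0 / n.factorial * z ^ n) (f z) := by
  have h := Complex.hasSum_taylorSeries_of_entire hf 0 z
  refine h.congr_fun ?_
  intro n
  simp only [sub_zero, smul_eq_mul]
  ring

/-- The Taylor series of a dilate by `t < 1` converges in the space: the coefficients of `f` are
bounded by powers of `n`, and the dilation provides the geometric factor `t ^ n`. -/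
theorem tsum_coeff_dilate_ne_top (hφ : HasQuadraticGrowth φ) (hp : 0 < p)
    (hf : Differentiable ℂ f) (hN : fockIntegral φ p f ≠ ⊤) {t : ℝ} (ht0 : 0 < t) (ht1 : t < 1) :
    ∑' n : ℕ, (((n : ENNReal) + 1) ^ 2) ^ p * (‖iteratedDeriv n f 0 / n.factorial * (t : ℂ) ^ n‖ₑ ^ p *
      fockIntegral φ p (fun z => z ^ n)) ≠ ⊤ := by
  set k : ℕ := ⌈p⌉₊
  have hq0 : 0 < t ^ p := Real.rpow_pos_of_pos ht0 p
  have hq1 : t ^ p < 1 := Real.rpow_lt_one ht0.le ht1 hp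
  have hsum : Summable fun n : ℕ => 3 ^ p * (((n : ℝ) + 2) ^ (2 * k + 2) * (t ^ p) ^ n) := by
    refine Summable.mul_left _ ?_
    have h := summable_pow_mul_geometric_of_norm_lt_one (2 * k + 2) (r := t ^ p)
      (by rwa [Real.norm_of_nonneg hq0.le])
    have h1 := ((summable_nat_add_iff 2).2 h).mul_left ((t ^ p) ^ 2)⁻¹
    refine h1.congr fun n => ?_
    push_cast
    rw [pow_add (t ^ p) n 2]
    field_simp
  have hterm : ∀ n : ℕ, (((n : ENNReal) + 1) ^ 2) ^ p *
      (‖iteratedDeriv n f 0 / n.factorial * (t : ℂ) ^ n‖ₑ ^ p *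
        fockIntegral φ p (fun z => z ^ n)) ≤
      ENNReal.ofReal (3 ^ p * (((n : ℝ) + 2) ^ (2 * k + 2) * (t ^ p) ^ n)) * fockIntegral φ p f := by
    intro n
    have h1 := enorm_coeff_rpow_mul_fockIntegral_le hφ hf hp n
    have h2 : (((n : ENNReal) + 1) ^ 2) ^ p ≤ ENNReal.ofReal (((n : ℝ) + 2) ^ (2 * k)) := by
      have h3 : ((n : ENNReal) + 1) ^ 2 = ENNReal.ofReal (((n : ℝ) + 1) ^ 2) := by
        rw [ENNReal.ofReal_pow (by positivity), ENNReal.ofReal_add (by positivity) zero_le_one,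
          ENNReal.ofReal_natCast, ENNReal.ofReal_one]
      rw [h3, ENNReal.ofReal_rpow_of_nonneg (by positivity) hp.le]
      refine ENNReal.ofReal_le_ofReal ?_
      calc (((n : ℝ) + 1) ^ 2) ^ p ≤ (((n : ℝ) + 1) ^ 2) ^ (k : ℝ) := by
            refine Real.rpow_le_rpow_of_exponent_le (one_le_pow₀ ?_) (Nat.le_ceil _)
            have : (0 : ℝ) ≤ n := n.cast_nonneg
            linarith
        _ = ((n : ℝ) + 1) ^ (2 * k) := by rw [Real.rpow_natCast, ← pow_mul]
        _ ≤ _ := by gcongr; norm_num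
    have h4 : ‖(t : ℂ) ^ n‖ₑ ^ p = ENNReal.ofReal ((t ^ p) ^ n) := by
      rw [enorm_rpow_eq_ofReal hp, norm_pow, Complex.norm_real, Real.norm_of_nonneg ht0.le,
        ← Real.rpow_natCast, ← Real.rpow_natCast, ← Real.rpow_mul ht0.le, ← Real.rpow_mul ht0.le,
        mul_comm p]
    rw [enorm_mul, ENNReal.mul_rpow_of_nonneg _ _ hp.le, h4]
    calc _ = (((n : ENNReal) + 1) ^ 2) ^ p * ENNReal.ofReal ((t ^ p) ^ n) *
          (‖iteratedDeriv n f 0 / n.factorial‖ₑ ^ p * fockIntegral φ p (fun z => z ^ n)) := by ring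
      _ ≤ ENNReal.ofReal (((n : ℝ) + 2) ^ (2 * k)) * ENNReal.ofReal ((t ^ p) ^ n) *
          (ENNReal.ofReal (3 ^ p * (n + 2) ^ 2) * fockIntegral φ p f) := by gcongr
      _ = _ := by
          rw [← ENNReal.ofReal_mul (by positivity), ← mul_assoc, ← ENNReal.ofReal_mul (by positivity)]
          congr 2
          ring
  refine ne_top_of_le_ne_top ?_ (ENNReal.tsum_le_tsum hterm)
  rw [ENNReal.tsum_mul_right]
  exact ENNReal.mul_ne_top hsum.tsum_ofReal_ne_top hN

theorem sum_mem_monomialSpan (hφ : HasQuadraticGrowth φ) (hp : 0 < p) {N : ℕ} (s : Finset ℕ)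
    {a : ℕ → ℂ} (ha : ∀ k < N, a k = 0) :
    ∃ g ∈ monomialSpan φ p N, (g : ℂ → ℂ) = fun z => ∑ n ∈ s, a n * z ^ n := by
  refine ⟨∑ n ∈ s, a n • ⟨fun z : ℂ => z ^ n, pow_mem_fockSpace hφ hp n⟩,
    Submodule.sum_mem _ fun n _ => ?_, ?_⟩
  · rcases lt_or_ge n N with h | h
    · rw [ha n h, zero_smul]
      exact Submodule.zero_mem _
    · exact Submodule.smul_mem _ _ (Submodule.subset_span ⟨n, h, rfl⟩)
  · ext z
    simp

/-- A function of the space is the limit of polynomials whose coefficients vanish wherever its own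
do: of Taylor sums of its dilates. -/
theorem exists_mem_monomialSpan_fockIntegral_lt (hφ : HasQuadraticGrowth φ) (hp : 0 < p)
    (hf : Differentiable ℂ f) (hN : fockIntegral φ p f ≠ ⊤) {N : ℕ}
    (hvan : ∀ k < N, iteratedDeriv k f 0 = 0) {ε : ENNReal} (hε : 0 < ε) :
    ∃ g ∈ monomialSpan φ p N, fockIntegral φ p ((g : ℂ → ℂ) - f) < ε := by
  have h2p : (2 : ENNReal) ^ p ≠ ⊤ := ENNReal.rpow_ne_top_of_nonneg hp.le (by norm_num)
  have h2p0 : (2 : ENNReal) ^ p ≠ 0 := by simp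
  set η : ENNReal := (2 ^ p)⁻¹ * (ε / 2) with hη
  have hη0 : 0 < η := by
    refine ENNReal.mul_pos (ENNReal.inv_ne_zero.2 h2p) (ENNReal.div_pos hε.ne' (by norm_num)).ne'
  set t : ℕ → ℝ := fun n => 1 - 1 / ((n : ℝ) + 2) with ht
  have hfr : ∀ n : ℕ, 1 / ((n : ℝ) + 2) < 1 := fun n => by
    rw [div_lt_one (by positivity)]
    linarith [(Nat.cast_nonneg n : (0 : ℝ) ≤ n)]
  have ht0 : ∀ n, 0 < t n := fun n => by simp only [ht]; linarith [hfr n]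
  have ht1 : ∀ n, t n < 1 := fun n => by
    have : 0 < 1 / ((n : ℝ) + 2) := by positivity
    simp only [ht]
    linarith
  have htl : Tendsto t atTop (𝓝 1) := by
    have h := (tendsto_const_div_atTop_nhds_zero_nat (1 : ℝ)).comp (tendsto_add_atTop_nat 2)
    have h1 : Tendsto (fun n : ℕ => 1 / ((n : ℝ) + 2)) atTop (𝓝 0) := by
      refine h.congr fun n => ?_
      simp
    simpa [ht] using h1.const_sub 1
  obtain ⟨n, hn⟩ := ((tendsto_fockIntegral_dilate_sub hφ hp hf hN htl (fun n => (ht0 n).le)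
    fun n => (ht1 n).le).eventually (gt_mem_nhds hη0)).exists
  set s : ℝ := t n
  set a : ℕ → ℂ := fun k => iteratedDeriv k f 0 / k.factorial * (s : ℂ) ^ k with ha
  have hsum : ∀ z, HasSum (fun k => a k * z ^ k) (f (s * z)) := fun z => by
    have h := hasSum_taylor hf (s * z)
    simp only [mul_pow, ← mul_assoc] at h
    exact h
  have hfin := tsum_coeff_dilate_ne_top hφ hp hf hN (ht0 n) (ht1 n)
  set u : ℕ → ENNReal := fun k => (((k : ENNReal) + 1) ^ 2) ^ p *
    (‖a k‖ₑ ^ p * fockIntegral φ p (fun z => z ^ k)) with hu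
  set L : ENNReal := (∑' n : ℕ, (((n : ENNReal) + 1) ^ 2)⁻¹) ^ p
  have hLt : L ≠ ⊤ := ENNReal.rpow_ne_top_of_nonneg hp.le tsum_inv_sq_ne_top
  have htail : Tendsto (fun m => L * ∑' k, u (k + m)) atTop (𝓝 0) := by
    have := ENNReal.Tendsto.const_mul (ENNReal.tendsto_sum_nat_add u hfin) (a := L) (Or.inr hLt)
    simpa using this
  obtain ⟨m, hm⟩ := (htail.eventually (gt_mem_nhds hη0)).exists
  obtain ⟨g, hg, hgz⟩ := sum_mem_monomialSpan hφ hp (N := N) (Finset.range m) (a := a)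
    fun k hk => by simp [ha, hvan k hk]
  refine ⟨g, hg, ?_⟩
  -- the remainder of the Taylor series of the dilate
  set b : ℕ → ℂ := fun k => if k < m then 0 else a k with hb
  have hrem : ∀ z, HasSum (fun k => b k * z ^ k) (f (s * z) - (g : ℂ → ℂ) z) := by
    intro z
    have h1 : HasSum (fun k => if k < m then a k * z ^ k else 0) ((g : ℂ → ℂ) z) := by
      have h2 : HasSum (fun k => if k < m then a k * z ^ k else 0)
          (∑ k ∈ Finset.range m, if k < m then a k * z ^ k else 0) :=
        hasSum_sum_of_ne_finset_zero fun k hk => if_neg (by simpa using hk)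
      convert h2 using 1
      rw [hgz]
      exact Finset.sum_congr rfl fun k hk => by simp [Finset.mem_range.1 hk]
    refine ((hsum z).sub h1).congr_fun ?_
    intro k
    simp only [hb]
    split_ifs <;> simp
  have h1 := fockIntegral_le_tsum hφ hp hrem
  have h2 : ∑' k : ℕ, (((k : ENNReal) + 1) ^ 2) ^ p *
      (‖b k‖ₑ ^ p * fockIntegral φ p (fun z => z ^ k)) = ∑' k, u (k + m) := by
    rw [← Summable.sum_add_tsum_nat_add' (k := m) ENNReal.summable, Finset.sum_eq_zero, zero_add]
    · refine tsum_congr fun k => ?_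
      simp [hb, hu]
    · intro k hk
      simp [hb, Finset.mem_range.1 hk, hp]
  rw [h2] at h1
  have h3 : (g : ℂ → ℂ) - f = (fun z => f (s * z) - f z) + -fun z => f (s * z) - (g : ℂ → ℂ) z := by
    ext z
    simp
  rw [h3]
  calc _ ≤ 2 ^ p * (fockIntegral φ p (fun z => f (s * z) - f z) +
        fockIntegral φ p (-fun z => f (s * z) - (g : ℂ → ℂ) z)) :=
        fockIntegral_add_le hφ hp ((hf.comp (differentiable_id.const_mul _)).sub hf)
    _ < 2 ^ p * (η + η) := by
        refine (ENNReal.mul_lt_mul_iff_right h2p0 h2p).2 ?_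
        rw [fockIntegral_neg]
        exact ENNReal.add_lt_add hn (h1.trans_lt hm)
    _ = ε := by
        rw [hη, ← mul_add, ENNReal.add_halves, ← mul_assoc, ENNReal.mul_inv_cancel h2p0 h2p,
          one_mul]

end Density

/-! ### Cyclic vectors of weighted shifts -/

section WeightedShift

variable {b : ℕ → ℝ}

theorem antitone_add_div (hb : ∀ n, 0 < b n) (hanti : Antitone fun n => b (n + 1) / b n) (k : ℕ) :
    Antitone fun n => b (n + k) / b n := by
  refine antitone_nat_of_succ_le fun n => ?_
  have h := hanti (Nat.le_add_right n k)
  simp only at h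
  rw [div_le_div_iff₀ (hb _) (hb _)] at h ⊢
  rw [show n + 1 + k = n + k + 1 by ring]
  linarith

theorem exists_ge_isMax_tail {y : ℕ → ℝ} (hy : Tendsto y atTop (𝓝 0)) {i : ℕ} (hi : 0 < y i) :
    ∃ k, i ≤ k ∧ 0 < y k ∧ ∀ n, k ≤ n → y n ≤ y k := by
  obtain ⟨m, hm⟩ := eventually_atTop.1 (hy.eventually (gt_mem_nhds hi))
  obtain ⟨k, hk, hmax⟩ := Finset.exists_max_image (Finset.Icc i (max i m)) y
    ⟨i, by simp⟩
  rw [Finset.mem_Icc] at hk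
  have hik : y i ≤ y k := hmax i (by simp)
  refine ⟨k, hk.1, hi.trans_le hik, fun n hn => ?_⟩
  rcases le_or_gt n (max i m) with h | h
  · exact hmax n (Finset.mem_Icc.2 ⟨hk.1.trans hn, h⟩)
  · exact (hm n ((le_max_right _ _).trans h.le)).le.trans hik

/-- A summable bound, uniform in `k`, of the terms in `tendsto_tsum_shift_div`. -/
theorem norm_mul_shift_div_le (hb : ∀ n, 0 < b n) (hanti : Antitone fun n => b (n + 1) / b n)
    {m : ℕ} {c : ℕ → ℂ} {A : ℝ} (hA : ∀ n, ‖c n‖ * b n ≤ A) {k : ℕ} (hk : m ≤ k) (n : ℕ) :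
    ‖c (n + 1)‖ * (b (k + (n + 1)) / b k) ≤ A / b m * (b (n + 1 + m) / b (n + 1)) := by
  have h2 := antitone_add_div hb hanti (n + 1) hk
  simp only at h2
  have hm0 := hb m
  have hn0 := hb (n + 1)
  have := hb (n + 1 + m)
  calc ‖c (n + 1)‖ * (b (k + (n + 1)) / b k) ≤ ‖c (n + 1)‖ * (b (m + (n + 1)) / b m) := by gcongr
    _ = (‖c (n + 1)‖ * b (n + 1)) / b m * (b (n + 1 + m) / b (n + 1)) := by
        rw [show m + (n + 1) = n + 1 + m by ring]
        field_simp
    _ ≤ _ := by gcongr; exact hA _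

theorem tendsto_tsum_shift_div (hb : ∀ n, 0 < b n) (hanti : Antitone fun n => b (n + 1) / b n)
    (hlim : Tendsto (fun n => b (n + 1) / b n) atTop (𝓝 0)) {m : ℕ}
    (hsum : Summable fun n => b (n + m) / b n) {c : ℕ → ℂ} {A : ℝ} (hA : ∀ n, ‖c n‖ * b n ≤ A) :
    Tendsto (fun k => ∑' n, ‖c (n + 1)‖ * (b (k + (n + 1)) / b k)) atTop (𝓝 0) := by
  have h := tendsto_tsum_of_dominated_convergence (𝓕 := atTop)
    (f := fun k n => ‖c (n + 1)‖ * (b (k + (n + 1)) / b k)) (g := fun _ => (0 : ℝ))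
    (bound := fun n => A / b m * (b (n + 1 + m) / b (n + 1)))
    (((summable_nat_add_iff 1).2 hsum).mul_left _) ?_ ?_
  · simpa using h
  · intro n
    have h1 : Tendsto (fun k => ‖c (n + 1)‖ * (b n / b 0 * (b (k + 1) / b k))) atTop (𝓝 0) := by
      simpa using (hlim.const_mul (b n / b 0)).const_mul ‖c (n + 1)‖
    refine squeeze_zero (fun k => ?_) (fun k => ?_) h1
    · have := hb (k + (n + 1)); have := hb k
      positivity
    · have h2 := antitone_add_div hb hanti n (Nat.zero_le (k + 1))
      simp only [zero_add] at h2
      have h3 : b (k + (n + 1)) / b k = b (k + 1 + n) / b (k + 1) * (b (k + 1) / b k) := by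
        rw [show k + (n + 1) = k + 1 + n by ring]
        have := (hb (k + 1)).ne'
        field_simp
      rw [h3]
      have := hb k; have := hb (k + 1)
      gcongr
  · filter_upwards [eventually_ge_atTop m] with k hk n
    have := hb k
    have := hb (k + (n + 1))
    rw [Real.norm_of_nonneg (by positivity)]
    exact norm_mul_shift_div_le hb hanti hA hk n

/-- A null sequence `y` orthogonal to all shifts of `(c n * b n)`, where `c 0 ≠ 0`, vanishes. If it
has finite support, the last index in the support gives a contradiction. Otherwise, take an index
`k` at which `|y|` is maximal among the later indices: dividing the orthogonality relation for the
`k`-th shift by `y k` bounds `|c 0|` by a series which tends to `0` as `k → ∞`. -/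
theorem eq_zero_of_orthogonal_shifts (hb : ∀ n, 0 < b n)
    (hanti : Antitone fun n => b (n + 1) / b n)
    (hlim : Tendsto (fun n => b (n + 1) / b n) atTop (𝓝 0)) {m : ℕ}
    (hsum : Summable fun n => b (n + m) / b n) {c : ℕ → ℂ} (hc0 : c 0 ≠ 0) {A : ℝ}
    (hA : ∀ n, ‖c n‖ * b n ≤ A) {y : ℕ → ℂ} (hy : Tendsto (fun n => ‖y n‖) atTop (𝓝 0))
    (horth : ∀ k, HasSum (fun n => (starRingEnd ℂ) (c n * b (n + k)) * y (n + k)) 0) :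
    ∀ n, y n = 0 := by
  by_contra! hne
  have key : ∀ k, m ≤ k → 0 < ‖y k‖ → (∀ n, k ≤ n → ‖y n‖ ≤ ‖y k‖) →
      ‖c 0‖ ≤ ∑' n, ‖c (n + 1)‖ * (b (k + (n + 1)) / b k) := by
    intro k hmk hk hmax
    have hk0 := hb k
    have hsumm : Summable fun n => ‖c (n + 1)‖ * (b (k + (n + 1)) / b k) := by
      refine Summable.of_nonneg_of_le (fun n => ?_)
        (fun n => norm_mul_shift_div_le hb hanti hA hmk n)
        (((summable_nat_add_iff 1).2 hsum).mul_left _)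
      have := hb (k + (n + 1))
      positivity
    have h1 := (hasSum_nat_add_iff' 1).2 (horth k)
    simp only [Finset.range_one, Finset.sum_singleton, zero_add, zero_sub] at h1
    have h2 := tsum_of_norm_bounded (hsumm.mul_left (b k * ‖y k‖)).hasSum
      (f := fun n => (starRingEnd ℂ) (c (n + 1) * b (n + 1 + k)) * y (n + 1 + k)) fun n => by
        have hbn := hb (n + 1 + k)
        rw [norm_mul, RCLike.norm_conj, norm_mul, Complex.norm_real, Real.norm_of_nonneg hbn.le]
        calc ‖c (n + 1)‖ * b (n + 1 + k) * ‖y (n + 1 + k)‖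
            ≤ ‖c (n + 1)‖ * b (n + 1 + k) * ‖y k‖ := by
              gcongr
              exact hmax _ (by omega)
          _ = _ := by
              rw [show k + (n + 1) = n + 1 + k by ring]
              field_simp
    rw [h1.tsum_eq, norm_neg, norm_mul, RCLike.norm_conj, norm_mul, Complex.norm_real,
      Real.norm_of_nonneg hk0.le, tsum_mul_left] at h2
    refine le_of_mul_le_mul_left ?_ (show 0 < b k * ‖y k‖ by positivity)
    calc b k * ‖y k‖ * ‖c 0‖ = ‖c 0‖ * b k * ‖y k‖ := by ring
      _ ≤ _ := h2
  by_cases hfin : ∃ K, ∀ i, K ≤ i → y i = 0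
  · classical
    have hK := Nat.find_spec hfin
    have hK0 : Nat.find hfin ≠ 0 := by
      intro h0
      obtain ⟨n, hn⟩ := hne
      exact hn (hK n (by omega))
    obtain ⟨K, hKK⟩ := Nat.exists_eq_succ_of_ne_zero hK0
    have hyK : y K ≠ 0 := by
      intro h0
      refine Nat.find_min hfin (m := K) (by omega) fun i hi => ?_
      rcases hi.eq_or_lt with rfl | hi
      · exact h0
      · exact hK i (by omega)
    have h1 : HasSum (fun n => (starRingEnd ℂ) (c n * b (n + K)) * y (n + K))
        ((starRingEnd ℂ) (c 0 * b (0 + K)) * y (0 + K)) :=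
      hasSum_single 0 fun n hn => by
        rw [hK (n + K) (by omega), mul_zero]
    have h2 := h1.unique (horth K)
    rw [zero_add] at h2
    have h3 : (b K : ℂ) ≠ 0 := by exact_mod_cast (hb K).ne'
    simp [hc0, h3, hyK] at h2
  · push Not at hfin
    obtain ⟨K, hK⟩ := eventually_atTop.1 ((tendsto_tsum_shift_div hb hanti hlim hsum hA).eventually
      (gt_mem_nhds (norm_pos_iff.2 hc0)))
    obtain ⟨i, hi, hyi⟩ := hfin (max K m)
    obtain ⟨k, hik, hk0, hmax⟩ := exists_ge_isMax_tail hy (norm_pos_iff.2 hyi)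
    have h1 := key k (by omega) hk0 hmax
    exact absurd h1 (not_le.2 (hK k (by omega)))

/-- The sequence `c`, shifted `k` places to the right. -/
def shiftRight (c : ℕ → ℂ) (k n : ℕ) : ℂ := if k ≤ n then c (n - k) else 0

theorem shiftRight_add (c : ℕ → ℂ) (k n : ℕ) : shiftRight c k (n + k) = c n := by
  simp [shiftRight]

/-- Let the weights `b (n + 1) / b n` of a weighted shift decrease to `0`, and let those of one of
its powers be summable. Then the shifts of a sequence `c` with `c 0 ≠ 0` and `(c n * b n)` in `ℓ²`
approximate all unit vectors, that is, the sequence is a cyclic vector. The approximation in `ℓ²`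
is stated in the weaker supremum norm. -/
theorem exists_shift_combination (hb : ∀ n, 0 < b n)
    (hanti : Antitone fun n => b (n + 1) / b n)
    (hlim : Tendsto (fun n => b (n + 1) / b n) atTop (𝓝 0)) {m : ℕ}
    (hsum : Summable fun n => b (n + m) / b n) {c : ℕ → ℂ} (hc0 : c 0 ≠ 0)
    (hc : Summable fun n => (‖c n‖ * b n) ^ 2) (j : ℕ) {ε : ℝ} (hε : 0 < ε) :
    ∃ l : ℕ →₀ ℂ, ∀ n,
      ‖(l.sum fun k x => x * shiftRight c k n) - (if n = j then 1 else 0)‖ * b n ≤ ε := by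
  -- the shifted sequences as vectors of `ℓ²`
  have hmem : ∀ k, Memℓp (fun n => shiftRight c k n * (b n : ℂ)) 2 := by
    intro k
    rw [memℓp_gen_iff (by norm_num)]
    simp only [ENNReal.toReal_ofNat, Real.rpow_ofNat, norm_mul, Complex.norm_real]
    refine (summable_nat_add_iff k).1 ?_
    refine Summable.of_nonneg_of_le (fun n => by positivity) (fun n => ?_)
      (hc.mul_left ((b k / b 0) ^ 2))
    rw [shiftRight_add, Real.norm_of_nonneg (hb _).le, ← mul_pow]
    have h1 := antitone_add_div hb hanti k (Nat.zero_le n)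
    simp only [zero_add] at h1
    have := hb n
    have := hb (n + k)
    refine pow_le_pow_left₀ (by positivity) ?_ 2
    calc ‖c n‖ * b (n + k) = b (n + k) / b n * (‖c n‖ * b n) := by field_simp
      _ ≤ _ := by gcongr
  set X : ℕ → lp (fun _ : ℕ => ℂ) 2 := fun k => ⟨fun n => shiftRight c k n * (b n : ℂ), hmem k⟩
    with hX
  have hXa : ∀ k n, (X k : ℕ → ℂ) n = shiftRight c k n * (b n : ℂ) := fun k n => rfl
  obtain ⟨A, hA⟩ : ∃ A, ∀ n, ‖c n‖ * b n ≤ A := by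
    refine ⟨1 + ∑' n, (‖c n‖ * b n) ^ 2, fun n => ?_⟩
    have h1 : (‖c n‖ * b n) ^ 2 ≤ ∑' n, (‖c n‖ * b n) ^ 2 :=
      hc.le_tsum n fun i _ => by positivity
    nlinarith [sq_nonneg (‖c n‖ * b n - 1)]
  have horth : (Submodule.span ℂ (Set.range X))ᗮ = ⊥ := by
    rw [Submodule.eq_bot_iff]
    intro y hy
    have hy2 : Summable fun n => ‖y n‖ ^ 2 := by
      have := (memℓp_gen_iff (p := 2) (by norm_num)).1 (lp.memℓp y)
      simpa using this
    have hy0 : Tendsto (fun n => ‖y n‖) atTop (𝓝 0) := by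
      have h := (Real.continuous_sqrt.tendsto 0).comp hy2.tendsto_atTop_zero
      rw [Real.sqrt_zero] at h
      refine h.congr fun n => ?_
      simp [Real.sqrt_sq]
    have h0 : ∀ n, y n = 0 := by
      refine eq_zero_of_orthogonal_shifts hb hanti hlim hsum hc0 hA hy0 fun k => ?_
      have h1 : inner ℂ (X k) y = 0 :=
        (Submodule.mem_orthogonal _ _).1 hy _ (Submodule.subset_span ⟨k, rfl⟩)
      have h2 := lp.hasSum_inner (𝕜 := ℂ) (X k) y
      rw [h1] at h2
      have h3 := (hasSum_nat_add_iff' k).2 h2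
      rw [Finset.sum_eq_zero, sub_zero] at h3
      · refine h3.congr_fun fun n => ?_
        rw [hXa, shiftRight_add, RCLike.inner_apply, mul_comm]
      · intro i hi
        rw [hXa, shiftRight, if_neg (by simpa using hi)]
        simp
    ext n
    simp [h0 n]
  have hdense : (Submodule.span ℂ (Set.range X)).topologicalClosure = ⊤ :=
    (Submodule.topologicalClosure_eq_top_iff).2 horth
  set e : lp (fun _ : ℕ => ℂ) 2 := lp.single 2 j (b j : ℂ) with he
  have hemem : e ∈ closure (Submodule.span ℂ (Set.range X) : Set (lp (fun _ : ℕ => ℂ) 2)) := by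
    rw [← Submodule.topologicalClosure_coe, hdense]
    trivial
  obtain ⟨w, hw, hdist⟩ := Metric.mem_closure_iff.1 hemem ε hε
  obtain ⟨l, hl⟩ := Finsupp.mem_span_range_iff_exists_finsupp.1 hw
  refine ⟨l, fun n => ?_⟩
  have h1 : ‖(w - e : lp (fun _ : ℕ => ℂ) 2) n‖ ≤ ε := by
    refine (lp.norm_apply_le_norm (by norm_num) (w - e) n).trans ?_
    rw [← dist_eq_norm, dist_comm]
    exact hdist.le
  have h2 : (w : ℕ → ℂ) n = (l.sum fun k x => x * shiftRight c k n) * b n := by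
    rw [← hl, Finsupp.sum, Finsupp.sum, lp.coeFn_sum, Finset.sum_apply, Finset.sum_mul]
    refine Finset.sum_congr rfl fun k _ => ?_
    rw [lp.coeFn_smul, Pi.smul_apply, hXa, smul_eq_mul, mul_assoc]
  have h3 : (e : ℕ → ℂ) n = (if n = j then 1 else 0) * b n := by
    rw [he, lp.single_apply]
    by_cases h : n = j
    · subst h; simp
    · simp [h]
  rw [lp.coeFn_sub, Pi.sub_apply, h2, h3, ← sub_mul, norm_mul, Complex.norm_real,
    Real.norm_of_nonneg (hb n).le] at h1
  exact h1

end WeightedShift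

/-! ### Comparison of the moments for two exponents -/

section MonomialNorm

variable {φ : ℝ → ℝ} {p q : ℝ}

/-- The norm of `z ^ n / n!`. In terms of the derivatives `D n` at the origin an entire function is
`∑ D n • z ^ n / n!`, and the Volterra operator shifts the sequence `D` by one place. -/
noncomputable def monomialNorm (φ : ℝ → ℝ) (p : ℝ) (n : ℕ) : ℝ :=
  fockNorm φ p (fun z => z ^ n) / n.factorial

theorem monomialNorm_pos (hφ : HasQuadraticGrowth φ) (hp : 0 < p) (n : ℕ) :
    0 < monomialNorm φ p n :=
  div_pos (fockNorm_pow_pos hφ hp n) (by positivity)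

/-- A shift by `k` places gains an arbitrary power of `n` and allows a change of the exponent: the
peak of `r ^ (n + k) * exp (-φ r)` is at a radius `O(√n)`, whence a factor `n ^ (k / 2)` from the
norms, against a factor `n ^ k` from the factorials; all other losses are powers of `n` that
do not depend on `k`. -/
theorem exists_monomialNorm_add_le (hφ : HasQuadraticGrowth φ) (hp : 0 < p) (hq : 0 < q) (B : ℕ) :
    ∃ k : ℕ, ∃ C : ℝ, 0 < C ∧ ∀ n : ℕ, 1 ≤ n →
      (n : ℝ) ^ B * monomialNorm φ p (n + k) ≤ C * monomialNorm φ q n := by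
  obtain ⟨C₁, hC₁, A₁, h₁⟩ := fockNorm_pow_bounds hφ hp
  obtain ⟨C₂, hC₂, A₂, h₂⟩ := fockNorm_pow_bounds hφ hq
  obtain ⟨D, hD, hpk⟩ := hφ.exists_peak_sq_le
  -- for `k = 2 * l` the factorials gain `n ^ (2 * l)` and the peak costs `n ^ l`, so that `l` has
  -- to cover the remaining powers of `n`
  set l := A₁ + A₂ + B
  refine ⟨2 * l, C₁ * C₂ * D ^ l * (2 * l + 1) ^ (A₁ + l), by positivity, fun n hn => ?_⟩
  obtain ⟨ρ, hρ⟩ := hφ.exists_isPeak hn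
  obtain ⟨σ, hσ⟩ := hφ.exists_isPeak (n := n + 2 * l) (by omega)
  have hn1 : (1 : ℝ) ≤ n := by exact_mod_cast hn
  have hσ2 := hpk _ (by omega) σ hσ
  have hnk : ((n + 2 * l : ℕ) : ℝ) ≤ (2 * l + 1) * n := by
    push_cast
    nlinarith [(Nat.cast_nonneg l : (0 : ℝ) ≤ l)]
  have hfac : (n.factorial : ℝ) * (n : ℝ) ^ (2 * l) ≤ (n + 2 * l).factorial := by
    have h := @Nat.factorial_mul_pow_le_factorial n (2 * l)
    have h' : (n.factorial : ℝ) * ((n : ℝ) + 1) ^ (2 * l) ≤ (n + 2 * l).factorial := by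
      exact_mod_cast h
    refine le_trans ?_ h'
    gcongr
    linarith
  have hN := fockNorm_nonneg (φ := φ) (p := q) fun z => z ^ n
  have hρ0 := hρ.pos
  have hσ0 := hσ.pos
  have key : fockNorm φ p (fun z => z ^ (n + 2 * l)) ≤
      C₁ * ((2 * l + 1) * n) ^ A₁ * ((D * ((2 * l + 1) * n)) ^ l *
        (C₂ * (n : ℝ) ^ A₂ * fockNorm φ q (fun z => z ^ n))) := by
    refine (h₁ _ (by omega) σ hσ).1.trans ?_
    refine mul_le_mul (by gcongr) ((hρ.add_le hσ).trans ?_) (by positivity) (by positivity)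
    refine mul_le_mul ?_ ?_ (by positivity) (by positivity)
    · rw [pow_mul]
      exact pow_le_pow_left₀ (by positivity) (hσ2.trans (by gcongr)) l
    · exact (h₂ n hn ρ hρ).2
  unfold monomialNorm
  rw [← mul_div_assoc, ← mul_div_assoc, div_le_div_iff₀ (by positivity) (by positivity)]
  calc (n : ℝ) ^ B * fockNorm φ p (fun z => z ^ (n + 2 * l)) * n.factorial
      ≤ (n : ℝ) ^ B * (C₁ * ((2 * l + 1) * n) ^ A₁ * ((D * ((2 * l + 1) * n)) ^ l *
        (C₂ * (n : ℝ) ^ A₂ * fockNorm φ q (fun z => z ^ n)))) * n.factorial := by gcongr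
    _ = C₁ * C₂ * D ^ l * (2 * l + 1) ^ (A₁ + l) * fockNorm φ q (fun z => z ^ n) *
        (n.factorial * (n : ℝ) ^ (2 * l)) := by
      rw [show 2 * l = l + (A₁ + A₂ + B) by omega]
      simp only [mul_pow, pow_add]
      ring
    _ ≤ _ := by gcongr

theorem volterraWeight_eq (φ : ℝ → ℝ) (n : ℕ) :
    volterraWeight φ n = monomialNorm φ 2 (n + 1) / monomialNorm φ 2 n := by
  unfold volterraWeight monomialNorm
  rw [Nat.factorial_succ]
  push_cast
  by_cases h0 : fockNorm φ 2 (fun z => z ^ n) = 0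
  · simp [h0]
  · field_simp

end MonomialNorm

/-! ### Derivatives at the origin and the Volterra operator as linear maps -/

section Operators

variable {φ : ℝ → ℝ} {p : ℝ}

theorem fockSpace_differentiable (f : fockSpace φ p) : Differentiable ℂ (f : ℂ → ℂ) := f.2.1

/-- The linear functional `f ↦ f^{(n)}(0)`. -/
noncomputable def derivAtZero (φ : ℝ → ℝ) (p : ℝ) (n : ℕ) : fockSpace φ p →ₗ[ℂ] ℂ where
  toFun f := iteratedDeriv n (f : ℂ → ℂ) 0
  map_add' f g := iteratedDeriv_add (fockSpace_differentiable f).contDiff.contDiffAt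
    (fockSpace_differentiable g).contDiff.contDiffAt
  map_smul' c _ := iteratedDeriv_const_smul_field c _

theorem derivAtZero_apply (n : ℕ) (f : fockSpace φ p) :
    derivAtZero φ p n f = iteratedDeriv n (f : ℂ → ℂ) 0 := rfl

theorem fockSpace_ext_derivAtZero {f g : fockSpace φ p}
    (h : ∀ n, derivAtZero φ p n f = derivAtZero φ p n g) : f = g := by
  refine Subtype.ext (funext fun z => ?_)
  have h1 := hasSum_taylor (fockSpace_differentiable f) z
  have h2 := hasSum_taylor (fockSpace_differentiable g) z
  simp only [derivAtZero_apply] at h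
  simp only [h] at h1
  exact h1.unique h2

/-- The Volterra operator on the space. -/
noncomputable def volterraOp (hφ : HasQuadraticGrowth φ) (hp : 0 < p) :
    fockSpace φ p →ₗ[ℂ] fockSpace φ p where
  toFun f := ⟨volterra f, volterra_mem_fockSpace hφ hp f.2⟩
  map_add' f g := by
    refine Subtype.ext ?_
    change volterra ((f : ℂ → ℂ) + g) = volterra f + volterra g
    rw [volterra_eq_sub ((fockSpace_differentiable f).add (fockSpace_differentiable g)) fun z =>
      (hasDerivAt_volterra (fockSpace_differentiable f) z).add
        (hasDerivAt_volterra (fockSpace_differentiable g) z)]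
    ext z
    simp [volterra_zero]
  map_smul' c f := by
    refine Subtype.ext ?_
    change volterra (c • (f : ℂ → ℂ)) = c • volterra f
    rw [volterra_eq_sub ((fockSpace_differentiable f).const_smul c) fun z =>
      (hasDerivAt_volterra (fockSpace_differentiable f) z).const_smul c]
    ext z
    simp [volterra_zero]

variable (hφ : HasQuadraticGrowth φ) (hp : 0 < p)

theorem coe_volterraOp (f : fockSpace φ p) : (volterraOp hφ hp f : ℂ → ℂ) = volterra f := rfl

theorem derivAtZero_volterraOp_pow_add (f : fockSpace φ p) (k n : ℕ) :
    derivAtZero φ p (n + k) ((volterraOp hφ hp ^ k) f) = derivAtZero φ p n f := by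
  induction k generalizing n with
  | zero => rfl
  | succ k ih =>
    rw [pow_succ', Module.End.mul_apply, ← add_assoc, ← ih, derivAtZero_apply, coe_volterraOp,
      iteratedDeriv_succ_volterra (fockSpace_differentiable _), ← derivAtZero_apply]

theorem derivAtZero_volterraOp_pow_of_lt (f : fockSpace φ p) {k n : ℕ} (h : n < k) :
    derivAtZero φ p n ((volterraOp hφ hp ^ k) f) = 0 := by
  induction k generalizing n with
  | zero => omega
  | succ k ih =>
    rw [pow_succ', Module.End.mul_apply, derivAtZero_apply, coe_volterraOp]
    rcases n with _ | n
    · simp [volterra_zero]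
    · rw [iteratedDeriv_succ_volterra (fockSpace_differentiable _)]
      exact ih (by omega)

/-- The function `z ^ n / n!`. -/
noncomputable def unitMonomial (n : ℕ) : fockSpace φ p :=
  (n.factorial : ℂ)⁻¹ • ⟨fun z => z ^ n, pow_mem_fockSpace hφ hp n⟩

theorem derivAtZero_unitMonomial (n k : ℕ) :
    derivAtZero φ p k (unitMonomial hφ hp n) = if k = n then 1 else 0 := by
  have h : (n.factorial : ℂ) ≠ 0 := by exact_mod_cast n.factorial_ne_zero
  rw [unitMonomial, map_smul, derivAtZero_apply]
  change (n.factorial : ℂ)⁻¹ • iteratedDeriv k (fun z : ℂ => z ^ n) 0 = _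
  rw [iteratedDeriv_fun_pow_zero]
  split_ifs <;> simp [h]

theorem volterraOp_pow_unitMonomial (n k : ℕ) :
    (volterraOp hφ hp ^ k) (unitMonomial hφ hp n) = unitMonomial hφ hp (n + k) := by
  refine fockSpace_ext_derivAtZero fun i => ?_
  rw [derivAtZero_unitMonomial]
  rcases lt_or_ge i k with h | h
  · rw [derivAtZero_volterraOp_pow_of_lt hφ hp _ h, if_neg (by omega)]
  · obtain ⟨j, rfl⟩ := Nat.exists_eq_add_of_le' h
    rw [derivAtZero_volterraOp_pow_add, derivAtZero_unitMonomial]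
    simp

theorem unitMonomial_ne_zero (n : ℕ) : unitMonomial hφ hp n ≠ 0 := by
  intro h
  have := derivAtZero_unitMonomial hφ hp n n
  simp [h] at this

theorem monomialSpan_le_of_unitMonomial_mem {M : Submodule ℂ (fockSpace φ p)} {N : ℕ}
    (h : ∀ n, N ≤ n → unitMonomial hφ hp n ∈ M) : monomialSpan φ p N ≤ M := by
  refine Submodule.span_le.2 ?_
  rintro f ⟨n, hn, hf⟩
  have h0 : (n.factorial : ℂ) ≠ 0 := by exact_mod_cast n.factorial_ne_zero
  have h1 : f = (n.factorial : ℂ) • unitMonomial hφ hp n := by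
    rw [unitMonomial, smul_smul, mul_inv_cancel₀ h0, one_smul]
    exact Subtype.ext hf
  rw [h1]
  exact M.smul_mem _ (h n hn)

theorem isVolterraInvariant_iff (M : Submodule ℂ (fockSpace φ p)) :
    IsVolterraInvariant M ↔ ∀ f ∈ M, volterraOp hφ hp f ∈ M := by
  refine forall₂_congr fun f _ => ⟨?_, fun h => ⟨_, h, rfl⟩⟩
  rintro ⟨g, hg, h⟩
  rwa [show volterraOp hφ hp f = g from Subtype.ext h.symm]

theorem volterraOp_pow_mem {M : Submodule ℂ (fockSpace φ p)}
    (h : ∀ f ∈ M, volterraOp hφ hp f ∈ M) {f : fockSpace φ p} (hf : f ∈ M) (k : ℕ) :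
    (volterraOp hφ hp ^ k) f ∈ M := by
  induction k with
  | zero => exact hf
  | succ k ih =>
    rw [pow_succ', Module.End.mul_apply]
    exact h _ ih

end Operators

/-! ### The topology of the space -/

section FockTopology

variable {φ : ℝ → ℝ} {p : ℝ}

theorem mem_of_isClosed_of_forall_fockNorm_lt {S : Set (fockSpace φ p)}
    (hS : IsClosed[fockTopology φ p] S) {f : fockSpace φ p}
    (h : ∀ ε : ℝ, 0 < ε → ∃ g ∈ S, fockNorm φ p ((g : ℂ → ℂ) - f) < ε) : f ∈ S := by
  by_contra hf
  obtain ⟨ε, hε, hU⟩ := (@isOpen_compl_iff _ S (fockTopology φ p)).2 hS f hf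
  obtain ⟨g, hg, hgf⟩ := h ε hε
  exact hU g hgf hg

theorem norm_iteratedDeriv_le_fockNorm (hφ : HasQuadraticGrowth φ) (hp : 0 < p) (k : ℕ) :
    ∃ C : ℝ, 0 < C ∧ ∀ f ∈ fockSpace φ p, ‖iteratedDeriv k f 0‖ ≤ C * fockNorm φ p f := by
  obtain ⟨D, hD, B, hB⟩ := exists_le_of_rpow_le hp (C := 3 ^ p * (k + 2) ^ 2) (by positivity) 0
  have hη := fockNorm_pow_pos hφ hp k
  have hfac : (0 : ℝ) < k.factorial := by positivity
  refine ⟨k.factorial * D / fockNorm φ p (fun z => z ^ k), by positivity, fun f hf => ?_⟩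
  rw [mem_fockSpace_iff hφ hp] at hf
  have h := enorm_coeff_rpow_mul_fockIntegral_le hφ hf.1 hp k
  have h1 := ENNReal.toReal_mono (ENNReal.mul_ne_top ENNReal.ofReal_ne_top hf.2) h
  rw [ENNReal.toReal_mul, ENNReal.toReal_mul, enorm_rpow_eq_ofReal hp,
    ENNReal.toReal_ofReal (by positivity), ENNReal.toReal_ofReal (by positivity),
    ← fockNorm_rpow hφ hp, ← fockNorm_rpow hφ hp, ← Real.mul_rpow (by positivity) hη.le] at h1
  -- only the extraction of roots is needed here, so the polynomial factor is taken at `1`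
  have h2 := hB 1 _ _ le_rfl (mul_nonneg (norm_nonneg _) hη.le) (fockNorm_nonneg f)
    (by rwa [Nat.cast_one, one_pow, mul_one])
  simp only [Nat.cast_one, one_pow, mul_one, norm_div, Complex.norm_natCast] at h2
  rw [div_mul_eq_mul_div, div_le_iff₀ hfac] at h2
  rw [div_mul_eq_mul_div, le_div_iff₀ hη]
  linarith

theorem isClosed_fockVanishing (hφ : HasQuadraticGrowth φ) (hp : 0 < p) (N : ℕ) :
    IsClosed[fockTopology φ p] (fockVanishing φ p N) := by
  refine (@isOpen_compl_iff _ _ (fockTopology φ p)).1 fun f hf => ?_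
  simp only [fockVanishing, Set.mem_compl_iff, Set.mem_ofPred_eq, not_forall] at hf
  obtain ⟨k, hk, hne⟩ := hf
  obtain ⟨C, hC, h⟩ := norm_iteratedDeriv_le_fockNorm hφ hp k
  have h0 := norm_pos_iff.2 hne
  refine ⟨‖iteratedDeriv k (f : ℂ → ℂ) 0‖ / C, by positivity, fun g hg hgv => ?_⟩
  have h1 := h _ (g - f).2
  have h2 : iteratedDeriv k ((g - f : fockSpace φ p) : ℂ → ℂ) 0 =
      -iteratedDeriv k (f : ℂ → ℂ) 0 := by
    rw [← derivAtZero_apply, map_sub, derivAtZero_apply, derivAtZero_apply, hgv k hk, zero_sub]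
  rw [h2, norm_neg] at h1
  rw [lt_div_iff₀ hC] at hg
  have h3 : fockNorm φ p ((g - f : fockSpace φ p) : ℂ → ℂ) = fockNorm φ p (g - f : ℂ → ℂ) := rfl
  rw [h3] at h1
  linarith

/-- A closed set containing the span of the monomials of degree at least `N` contains all functions
that vanish to order `N` at the origin. -/
theorem fockVanishing_subset_of_isClosed (hφ : HasQuadraticGrowth φ) (hp : 0 < p) {N : ℕ}
    {S : Set (fockSpace φ p)} (hS : IsClosed[fockTopology φ p] S)
    (h : (monomialSpan φ p N : Set (fockSpace φ p)) ⊆ S) : fockVanishing φ p N ⊆ S := by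
  intro f hf
  refine mem_of_isClosed_of_forall_fockNorm_lt hS fun ε hε => ?_
  obtain ⟨hfd, hfi⟩ := (mem_fockSpace_iff hφ hp).1 f.2
  obtain ⟨g, hg, hgf⟩ := exists_mem_monomialSpan_fockIntegral_lt hφ hp hfd hfi hf
    (ε := ENNReal.ofReal (ε ^ p)) (ENNReal.ofReal_pos.2 (by positivity))
  exact ⟨g, h hg, fockNorm_lt_of_fockIntegral_lt hφ hp hε hgf⟩

end FockTopology

/-! ### Invariant subspaces -/

section InvariantSubspaces

variable {φ : ℝ → ℝ} {p : ℝ}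

/-- A power of the Volterra operator is bounded from the coefficientwise supremum norm, weighted by
the norms for the exponent `2`, to the space. -/
theorem exists_fockNorm_volterraOp_pow_le (hφ : HasQuadraticGrowth φ) (hp : 0 < p) :
    ∃ k : ℕ, ∃ C : ℝ, 0 < C ∧ ∀ f : fockSpace φ p, derivAtZero φ p 0 f = 0 →
      ∀ δ : ℝ, 0 ≤ δ → (∀ n, ‖derivAtZero φ p n f‖ * monomialNorm φ 2 n ≤ δ) →
        fockNorm φ p ((volterraOp hφ hp ^ k) f) ≤ C * δ := by
  -- after raising to the power `p`, the surplus `n ^ (-b)` makes the series of the terms converge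
  set b : ℕ := ⌈2 / p⌉₊
  have hbp : 2 ≤ b * p := by
    have := Nat.le_ceil (2 / p)
    rwa [div_le_iff₀ hp] at this
  obtain ⟨k, K, hK, hkK⟩ := exists_monomialNorm_add_le hφ hp two_pos (2 + b)
  set T := ∑' n : ℕ, (((n : ENNReal) + 1) ^ 2)⁻¹ with hT
  have hTt : T ^ p * T ≠ ⊤ := ENNReal.mul_ne_top
    (ENNReal.rpow_ne_top_of_nonneg hp.le tsum_inv_sq_ne_top) tsum_inv_sq_ne_top
  obtain ⟨C, hC, A, hA⟩ := exists_le_of_rpow_le hp (C := (T ^ p * T).toReal)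
    ENNReal.toReal_nonneg 0
  set M : ℝ := ((k : ℝ) + 2) ^ (2 + b) * K with hM
  refine ⟨k, C * M, by positivity, fun f hf0 δ hδ hf => ?_⟩
  set g := (volterraOp hφ hp ^ k) f with hg
  have hterm : ∀ n : ℕ, (((n : ENNReal) + 1) ^ 2) ^ p *
      (‖iteratedDeriv n (g : ℂ → ℂ) 0 / n.factorial‖ₑ ^ p * fockIntegral φ p (fun z => z ^ n)) ≤
      (((n : ENNReal) + 1) ^ 2)⁻¹ * ENNReal.ofReal ((M * δ) ^ p) := by
    intro n
    rw [← derivAtZero_apply, hg]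
    rcases lt_or_ge n k with h | h
    · rw [derivAtZero_volterraOp_pow_of_lt hφ hp f h]
      simp [hp]
    obtain ⟨m, rfl⟩ := Nat.exists_eq_add_of_le' h
    rw [derivAtZero_volterraOp_pow_add]
    rcases Nat.eq_zero_or_pos m with rfl | hm
    · rw [hf0]
      simp [hp]
    have hm1 : (1 : ℝ) ≤ m := by exact_mod_cast hm
    set N : ℝ := ((m + k : ℕ) : ℝ) + 1 with hN
    have hN1 : 1 ≤ N := by simp [hN]; positivity
    have hNm : N ≤ (k + 2) * m := by
      rw [hN]
      push_cast
      nlinarith [(Nat.cast_nonneg k : (0 : ℝ) ≤ k)]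
    set x : ℝ := ‖derivAtZero φ p m f‖ * monomialNorm φ p (m + k) with hx
    have hβ := monomialNorm_pos hφ hp (m + k)
    have hβ2 := monomialNorm_pos hφ two_pos m
    have hxδ : N ^ (2 + b) * x ≤ M * δ := by
      calc N ^ (2 + b) * x ≤ ((k + 2) * m) ^ (2 + b) * x := by gcongr
        _ = (k + 2) ^ (2 + b) * ‖derivAtZero φ p m f‖ *
            ((m : ℝ) ^ (2 + b) * monomialNorm φ p (m + k)) := by rw [hx, mul_pow]; ring
        _ ≤ (k + 2) ^ (2 + b) * ‖derivAtZero φ p m f‖ * (K * monomialNorm φ 2 m) := by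
          exact mul_le_mul_of_nonneg_left (hkK m hm) (by positivity)
        _ = M * (‖derivAtZero φ p m f‖ * monomialNorm φ 2 m) := by rw [hM]; ring
        _ ≤ M * δ := by
          gcongr
          exact hf m
    have hNe : (((m + k : ℕ) : ENNReal) + 1) ^ 2 = ENNReal.ofReal (N ^ 2) := by
      rw [ENNReal.ofReal_pow (by positivity), hN, ENNReal.ofReal_add (by positivity) one_pos.le,
        ENNReal.ofReal_natCast, ENNReal.ofReal_one]
    have hη : 0 ≤ fockNorm φ p (fun z => z ^ (m + k)) := fockNorm_nonneg _
    rw [← ENNReal.ofReal_toReal (fockIntegral_pow_ne_top hφ hp (m + k)), ← fockNorm_rpow hφ hp,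
      enorm_rpow_eq_ofReal hp, hNe, ENNReal.ofReal_rpow_of_nonneg (by positivity) hp.le,
      ← ENNReal.ofReal_mul (by positivity), ← ENNReal.ofReal_mul (by positivity),
      ← ENNReal.ofReal_inv_of_pos (by positivity), ← ENNReal.ofReal_mul (by positivity),
      ← Real.mul_rpow (by positivity) hη, ← Real.mul_rpow (by positivity) (by positivity)]
    refine ENNReal.ofReal_le_ofReal ?_
    have hxe : ‖derivAtZero φ p m f / ((m + k).factorial : ℂ)‖ *
        fockNorm φ p (fun z => z ^ (m + k)) = x := by
      rw [hx, monomialNorm, norm_div, Complex.norm_natCast]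
      ring
    rw [hxe, ← div_eq_inv_mul, le_div_iff₀ (by positivity)]
    calc (N ^ 2 * x) ^ p * N ^ 2 ≤ (N ^ 2 * x) ^ p * (N ^ b) ^ p := by
          gcongr
          rw [← Real.rpow_natCast N b, ← Real.rpow_mul (by positivity), ← Real.rpow_natCast N 2]
          exact Real.rpow_le_rpow_of_exponent_le hN1 (by exact_mod_cast hbp)
      _ = (N ^ (2 + b) * x) ^ p := by
          rw [← Real.mul_rpow (by positivity) (by positivity)]
          congr 1
          ring
      _ ≤ (M * δ) ^ p := Real.rpow_le_rpow (by positivity) hxδ hp.le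
  have hint : fockIntegral φ p g ≤ T ^ p * T * ENNReal.ofReal ((M * δ) ^ p) := by
    refine (fockIntegral_le_tsum hφ hp (hasSum_taylor (fockSpace_differentiable g))).trans ?_
    rw [mul_assoc, hT, ← ENNReal.tsum_mul_right]
    exact mul_le_mul' le_rfl (ENNReal.tsum_le_tsum hterm)
  have h1 := ENNReal.toReal_mono (ENNReal.mul_ne_top hTt ENNReal.ofReal_ne_top) hint
  rw [ENNReal.toReal_mul, ENNReal.toReal_ofReal (by positivity), ← fockNorm_rpow hφ hp] at h1
  have h2 := hA 1 _ (M * δ) le_rfl (fockNorm_nonneg g) (by positivity)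
    (by rwa [Nat.cast_one, one_pow, mul_one])
  rw [Nat.cast_one, one_pow, mul_one] at h2
  linarith

/-- The derivatives at the origin of a function in the range of a power of the Volterra operator
are square summable with respect to the norms for the exponent `2`. -/
theorem exists_summable_derivAtZero_volterraOp_pow (hφ : HasQuadraticGrowth φ) (hp : 0 < p) :
    ∃ k : ℕ, ∀ f : fockSpace φ p, Summable fun n =>
      (‖derivAtZero φ p n ((volterraOp hφ hp ^ k) f)‖ * monomialNorm φ 2 n) ^ 2 := by
  obtain ⟨C, hC, A, hA⟩ := norm_coeff_mul_fockNorm_le hφ hp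
  obtain ⟨k, K, hK, hkK⟩ := exists_monomialNorm_add_le hφ two_pos hp (A + 1)
  refine ⟨k, fun f => ?_⟩
  rw [← summable_nat_add_iff (k + 1)]
  have hs := ((summable_nat_add_iff 1).2
    (Real.summable_one_div_nat_pow.2 (by norm_num : 1 < 2))).mul_left
    ((K * C * fockNorm φ p f) ^ 2)
  refine Summable.of_nonneg_of_le (fun n => by positivity) (fun m => ?_) hs
  rw [show m + (k + 1) = m + 1 + k by ring, derivAtZero_volterraOp_pow_add]
  set n := m + 1
  have hn0 : (0 : ℝ) < n := by positivity
  have h1 := hA n (by omega) f f.2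
  have h2 := hkK n (by omega)
  have h3 := monomialNorm_pos hφ two_pos (n + k)
  have h4 := monomialNorm_pos hφ hp n
  rw [norm_div, Complex.norm_natCast, ← derivAtZero_apply, div_mul_eq_mul_div, mul_div_assoc,
    ← monomialNorm] at h1
  rw [mul_one_div, ← div_pow]
  refine pow_le_pow_left₀ (by positivity) ?_ 2
  rw [le_div_iff₀ hn0]
  have hnA : (0 : ℝ) < (n : ℝ) ^ A := by positivity
  refine le_of_mul_le_mul_left ?_ hnA
  calc (n : ℝ) ^ A * (‖derivAtZero φ p n f‖ * monomialNorm φ 2 (n + k) * n)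
      = ‖derivAtZero φ p n f‖ * ((n : ℝ) ^ (A + 1) * monomialNorm φ 2 (n + k)) := by
        rw [pow_succ]; ring
    _ ≤ ‖derivAtZero φ p n f‖ * (K * monomialNorm φ p n) := by gcongr
    _ = K * (‖derivAtZero φ p n f‖ * monomialNorm φ p n) := by ring
    _ ≤ K * (C * (n : ℝ) ^ A * fockNorm φ p f) := by gcongr
    _ = _ := by ring

theorem exists_summable_monomialNorm_add_div (hφ : HasQuadraticGrowth φ) :
    ∃ m : ℕ, ∀ L, Summable fun n => monomialNorm φ 2 (L + (n + m)) / monomialNorm φ 2 (L + n) := by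
  obtain ⟨m, K, hK, hmK⟩ := exists_monomialNorm_add_le hφ two_pos two_pos 2
  refine ⟨m, fun L => ?_⟩
  have h : Summable fun n => monomialNorm φ 2 (n + m) / monomialNorm φ 2 n := by
    rw [← summable_nat_add_iff 1]
    have hs := ((summable_nat_add_iff 1).2
      (Real.summable_one_div_nat_pow.2 (by norm_num : 1 < 2))).mul_left K
    refine Summable.of_nonneg_of_le (fun n => ?_) (fun n => ?_) hs
    · exact div_nonneg (monomialNorm_pos hφ two_pos _).le (monomialNorm_pos hφ two_pos _).le
    · have h0 := monomialNorm_pos hφ two_pos (n + 1)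
      rw [mul_one_div, div_le_div_iff₀ h0 (by positivity)]
      linarith [hmK (n + 1) (by omega)]
  have h2 := (summable_nat_add_iff L).2 h
  refine h2.congr fun n => ?_
  rw [show n + L + m = L + (n + m) by ring, add_comm n L]

/-- A nonzero function generates all monomials of high degree: after a power of the Volterra
operator the sequence of its derivatives is a cyclic vector of a weighted shift on `ℓ²`, and a
further power of the operator turns approximation in `ℓ²` into approximation in the space. -/
theorem exists_forall_unitMonomial_mem (hφ : HasQuadraticGrowth φ) (hp : 0 < p)
    (hdec : ∃ n₀ : ℕ, AntitoneOn (volterraWeight φ) (Set.Ici n₀))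
    (hlim : Tendsto (volterraWeight φ) atTop (𝓝 0)) {M : Submodule ℂ (fockSpace φ p)}
    (hM : IsClosed[fockTopology φ p] (M : Set (fockSpace φ p)))
    (hV : ∀ f ∈ M, volterraOp hφ hp f ∈ M) {f : fockSpace φ p} (hf : f ∈ M) {N : ℕ}
    (hN : derivAtZero φ p N f ≠ 0) (hlt : ∀ k < N, derivAtZero φ p k f = 0) :
    ∃ J, ∀ n, J ≤ n → unitMonomial hφ hp n ∈ M := by
  obtain ⟨n₀, hdec⟩ := hdec
  obtain ⟨k₁, C, hC, hk₁⟩ := exists_fockNorm_volterraOp_pow_le hφ hp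
  obtain ⟨k₂, hk₂⟩ := exists_summable_derivAtZero_volterraOp_pow hφ hp
  obtain ⟨m, hm⟩ := exists_summable_monomialNorm_add_div hφ
  set V := volterraOp hφ hp
  -- the order of `F` at the origin is positive and at least `n₀`, and `F` is in the range of `V ^
  -- k₂`
  set K := k₂ + (n₀ + 1)
  set F := (V ^ K) f with hF
  set L := N + K
  have hFM : F ∈ M := volterraOp_pow_mem hφ hp hV hf K
  have hF0 : ∀ i < L, derivAtZero φ p i F = 0 := by
    intro i hi
    rcases lt_or_ge i K with h | h
    · exact derivAtZero_volterraOp_pow_of_lt hφ hp f h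
    · obtain ⟨j, rfl⟩ := Nat.exists_eq_add_of_le' h
      rw [hF, derivAtZero_volterraOp_pow_add]
      exact hlt j (by omega)
  set b : ℕ → ℝ := fun n => monomialNorm φ 2 (L + n)
  set c : ℕ → ℂ := fun n => derivAtZero φ p (L + n) F
  have hb0 : ∀ n, 0 < b n := fun n => monomialNorm_pos hφ two_pos _
  have hratio : (fun n => b (n + 1) / b n) = fun n => volterraWeight φ (L + n) :=
    funext fun n => (volterraWeight_eq φ (L + n)).symm
  have hanti : Antitone fun n => b (n + 1) / b n := by
    rw [hratio]
    exact fun i j hij => hdec (Set.mem_Ici.2 (by omega)) (Set.mem_Ici.2 (by omega)) (by omega)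
  have hlim' : Tendsto (fun n => b (n + 1) / b n) atTop (𝓝 0) := by
    rw [hratio]
    exact hlim.comp (tendsto_atTop_mono (fun n => Nat.le_add_left n L) tendsto_id)
  have hc0 : c 0 ≠ 0 := by
    change derivAtZero φ p (N + K) F ≠ 0
    rwa [hF, derivAtZero_volterraOp_pow_add]
  have hcs : Summable fun n => (‖c n‖ * b n) ^ 2 := by
    have h := (summable_nat_add_iff L).2 (hk₂ ((V ^ (n₀ + 1)) f))
    rw [← Module.End.mul_apply, ← pow_add] at h
    refine h.congr fun n => ?_
    rw [add_comm n L]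
  -- the powers of the operator act on the derivatives of `F` as shifts
  have hshift : ∀ k i, derivAtZero φ p (L + i) ((V ^ k) F) = shiftRight c k i := by
    intro k i
    rcases lt_or_ge i k with h | h
    · rw [shiftRight, if_neg (by omega)]
      rcases lt_or_ge (L + i) k with h' | h'
      · exact derivAtZero_volterraOp_pow_of_lt hφ hp F h'
      · obtain ⟨j, hj⟩ := Nat.exists_eq_add_of_le' h'
        rw [hj, derivAtZero_volterraOp_pow_add]
        exact hF0 j (by omega)
    · obtain ⟨j, rfl⟩ := Nat.exists_eq_add_of_le' h
      rw [shiftRight_add, ← add_assoc, derivAtZero_volterraOp_pow_add]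
  have hshift0 : ∀ k, ∀ i < L, derivAtZero φ p i ((V ^ k) F) = 0 := by
    intro k i hi
    rcases lt_or_ge i k with h | h
    · exact derivAtZero_volterraOp_pow_of_lt hφ hp F h
    · obtain ⟨j, rfl⟩ := Nat.exists_eq_add_of_le' h
      rw [derivAtZero_volterraOp_pow_add]
      exact hF0 j (by omega)
  refine ⟨L + k₁, fun n hn => ?_⟩
  obtain ⟨j, rfl⟩ := Nat.exists_eq_add_of_le hn
  rw [show L + k₁ + j = L + j + k₁ by ring]
  refine mem_of_isClosed_of_forall_fockNorm_lt hM fun ε hε => ?_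
  obtain ⟨l, hl⟩ := exists_shift_combination hb0 hanti hlim' (m := m) (hm L) hc0 hcs j
    (ε := ε / (2 * C)) (by positivity)
  set G := l.sum fun k x => x • (V ^ k) F with hG
  have hGM : G ∈ M := Submodule.sum_mem _ fun k _ =>
    M.smul_mem _ (volterraOp_pow_mem hφ hp hV hFM k)
  refine ⟨(V ^ k₁) G, volterraOp_pow_mem hφ hp hV hGM k₁, ?_⟩
  have hDG : ∀ i, derivAtZero φ p i G = l.sum fun k x => x * derivAtZero φ p i ((V ^ k) F) := by
    intro i
    rw [hG, map_finsuppSum]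
    simp only [map_smul, smul_eq_mul]
  have hsmall : ∀ i < L, derivAtZero φ p i (G - unitMonomial hφ hp (L + j)) = 0 := by
    intro i hi
    rw [map_sub, hDG, derivAtZero_unitMonomial, if_neg (by omega)]
    simp [hshift0 _ i hi]
  have h := hk₁ (G - unitMonomial hφ hp (L + j)) (hsmall 0 (by omega)) (ε / (2 * C))
    (by positivity) fun i => by
      rcases lt_or_ge i L with h | h
      · rw [hsmall i h, norm_zero, zero_mul]
        positivity
      · obtain ⟨i, rfl⟩ := Nat.exists_eq_add_of_le h
        rw [map_sub, hDG, derivAtZero_unitMonomial]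
        simpa only [hshift, add_right_inj] using hl i
  rw [map_sub, volterraOp_pow_unitMonomial] at h
  refine lt_of_le_of_lt h ?_
  rw [mul_div_assoc', mul_comm C ε, mul_div_mul_right _ _ hC.ne']
  linarith

theorem mem_fockVanishing_iff {N : ℕ} {f : fockSpace φ p} :
    f ∈ fockVanishing φ p N ↔ ∀ k < N, derivAtZero φ p k f = 0 := Iff.rfl

/-- An invariant subspace containing a function of exact order `N` at the origin and all functions
of order at least `J` contains all functions of order at least `N`. -/
theorem fockVanishing_subset_of_derivAtZero_ne_zero (hφ : HasQuadraticGrowth φ) (hp : 0 < p)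
    {M : Submodule ℂ (fockSpace φ p)} (hV : ∀ f ∈ M, volterraOp hφ hp f ∈ M)
    {f : fockSpace φ p} (hf : f ∈ M) {N J : ℕ} (hN : derivAtZero φ p N f ≠ 0)
    (hlt : ∀ k < N, derivAtZero φ p k f = 0)
    (hJ : fockVanishing φ p J ⊆ M) : fockVanishing φ p N ⊆ M := by
  have key : ∀ d n : ℕ, N ≤ n → J ≤ n + d → fockVanishing φ p n ⊆ M := by
    intro d
    induction d with
    | zero => exact fun n _ hn h hh => hJ fun k hk => hh k (by omega)
    | succ d ih =>
      intro n hNn hn h hh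
      obtain ⟨i, rfl⟩ := Nat.exists_eq_add_of_le hNn
      set g := (derivAtZero φ p (N + i) h / derivAtZero φ p N f) • (volterraOp hφ hp ^ i) f with hg
      have hgM : g ∈ M := M.smul_mem _ (volterraOp_pow_mem hφ hp hV hf i)
      have h1 : h - g ∈ fockVanishing φ p (N + i + 1) := by
        refine mem_fockVanishing_iff.2 fun k hk => ?_
        rw [map_sub, hg, map_smul, smul_eq_mul]
        rcases (Nat.lt_succ_iff.1 hk).eq_or_lt with rfl | hk
        · rw [derivAtZero_volterraOp_pow_add, div_mul_cancel₀ _ hN, sub_self]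
        · rw [mem_fockVanishing_iff.1 hh k hk, zero_sub, neg_eq_zero]
          rcases lt_or_ge k i with hki | hki
          · rw [derivAtZero_volterraOp_pow_of_lt hφ hp f hki, mul_zero]
          · obtain ⟨j, rfl⟩ := Nat.exists_eq_add_of_le' hki
            rw [derivAtZero_volterraOp_pow_add, hlt j (by omega), mul_zero]
      have h2 := ih _ (by omega) (by omega) h1
      rw [← sub_add_cancel h g]
      exact M.add_mem h2 hgM
  exact key J N le_rfl (by omega)

theorem monomialSpan_subset_fockVanishing (φ : ℝ → ℝ) (p : ℝ) (N : ℕ) :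
    (monomialSpan φ p N : Set (fockSpace φ p)) ⊆ fockVanishing φ p N := by
  intro f hf
  refine mem_fockVanishing_iff.2 fun k hk => ?_
  refine (Submodule.span_le (p := LinearMap.ker (derivAtZero φ p k))).2 ?_ hf
  rintro g ⟨n, hn, hg⟩
  rw [SetLike.mem_coe, LinearMap.mem_ker, derivAtZero_apply, hg, iteratedDeriv_fun_pow_zero,
    if_neg (by omega), Nat.cast_zero]

end InvariantSubspaces

theorem mainTheorem7 (p : ℝ) (hp : 0 < p) (φ : ℝ → ℝ) (hφ : IsRapidlyIncreasing φ)
    (hdec : ∃ n₀ : ℕ, AntitoneOn (volterraWeight φ) (Set.Ici n₀))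
    (hlim : Tendsto (volterraWeight φ) atTop (𝓝 0)) :
    (∀ M : Submodule ℂ (fockSpace φ p),
      (IsClosed[fockTopology φ p] (M : Set (fockSpace φ p)) ∧ M ≠ ⊥ ∧ M ≠ ⊤ ∧
          IsVolterraInvariant M) ↔
        ∃ N : ℕ, 1 ≤ N ∧ (M : Set (fockSpace φ p)) = fockVanishing φ p N) ∧
    (∀ N : ℕ, 1 ≤ N →
      fockVanishing φ p N =
        closure[fockTopology φ p] (monomialSpan φ p N : Set (fockSpace φ p))) := by
  replace hφ := hφ.hasQuadraticGrowth
  refine ⟨fun M => ⟨?_, ?_⟩, fun N _ => Set.Subset.antisymm ?_ ?_⟩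
  · rintro ⟨hcl, hbot, htop, hinv⟩
    rw [isVolterraInvariant_iff hφ hp] at hinv
    have hex : ∃ n, ∃ f ∈ M, derivAtZero φ p n f ≠ 0 := by
      obtain ⟨f, hf, hne⟩ := Submodule.exists_mem_ne_zero_of_ne_bot hbot
      by_contra! h
      exact hne (fockSpace_ext_derivAtZero fun n => by rw [h n f hf, map_zero])
    classical
    set N := Nat.find hex
    obtain ⟨f, hf, hN⟩ := Nat.find_spec hex
    have hmin : ∀ k < N, ∀ g ∈ M, derivAtZero φ p k g = 0 := by
      intro k hk g hg
      by_contra h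
      exact Nat.find_min hex hk ⟨g, hg, h⟩
    obtain ⟨J, hJ⟩ := exists_forall_unitMonomial_mem hφ hp hdec hlim hcl hinv hf hN
      fun k hk => hmin k hk f hf
    have hsub : fockVanishing φ p N ⊆ M :=
      fockVanishing_subset_of_derivAtZero_ne_zero hφ hp hinv hf hN (fun k hk => hmin k hk f hf)
        (fockVanishing_subset_of_isClosed hφ hp hcl
          (monomialSpan_le_of_unitMonomial_mem hφ hp hJ))
    refine ⟨N, Nat.one_le_iff_ne_zero.2 fun h0 => htop (Submodule.eq_top_iff'.2 fun g => hsub ?_),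
      Set.Subset.antisymm (fun g hg k hk => hmin k hk g hg) hsub⟩
    intro k hk
    omega
  · rintro ⟨N, hN, hM⟩
    have hmem : ∀ f, f ∈ M ↔ ∀ k < N, derivAtZero φ p k f = 0 := fun f => by
      rw [← SetLike.mem_coe, hM, mem_fockVanishing_iff]
    refine ⟨hM ▸ isClosed_fockVanishing hφ hp N, ?_, ?_, ?_⟩
    · refine (Submodule.ne_bot_iff M).2 ⟨unitMonomial hφ hp N, (hmem _).2 fun k hk => ?_,
        unitMonomial_ne_zero hφ hp N⟩
      rw [derivAtZero_unitMonomial, if_neg (by omega)]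
    · intro htop
      have h := (hmem (unitMonomial hφ hp 0)).1 (htop ▸ Submodule.mem_top) 0 (by omega)
      simp [derivAtZero_unitMonomial] at h
    · refine (isVolterraInvariant_iff hφ hp M).2 fun f hf => (hmem _).2 fun k hk => ?_
      rcases k with _ | k
      · exact derivAtZero_volterraOp_pow_of_lt hφ hp f (k := 1) (by omega)
      · have h := derivAtZero_volterraOp_pow_add hφ hp f 1 k
        rw [pow_one] at h
        rw [h]
        exact (hmem f).1 hf k (by omega)
  · exact fockVanishing_subset_of_isClosed hφ hp (@isClosed_closure _ (fockTopology φ p) _)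
      (@subset_closure _ (fockTopology φ p) _)
  · exact @closure_minimal _ (fockTopology φ p) _ _ (monomialSpan_subset_fockVanishing φ p N)
      (isClosed_fockVanishing hφ hp N)
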